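/- Let $d\in\{2,3\}$, let $\Omega\subset\mathbb R^d$ be a bounded connected open set with $\Omega=\operatorname{int}\overline\Omega$ (for instance a Lipschitz polygon or polyhedron), and let $T>0$. The data satisfy: * the porosity $\varphi$ satisfies $0<\varphi_{\min}\le\varphi\le\varphi_{\max}$ a.e. in $\Omega$; * the mobilities $\eta_w,\eta_o\ge 0$ are continuous on $[0,1]$, $\eta_w$ is nondecreasing, $\eta_o$ is nonincreasing, and $\eta_w+\eta_o\ge\eta_*$ on $[0,1]$ with a constant $\eta_*>0$; set $f_w=\eta_w/(\eta_w+\eta_o)$ and $f_o=1-f_w$; * the capillary pressure $p_c$ is continuous and strictly decreasing on $[0,1]$ and lies in $W^{1,1}(0,1)$; set $p_{wg}(x)=\int_0^x f_o\,p_c'\,ds$ and $p_{og}(x)=\int_0^x f_w\,p_c'\,ds$ for $x\in[0,1]$; * $\bar q,\underline q\in L^2(\Omega\times]0,T[)$ are nonnegative with $\int_\Omega\bar q=\int_\Omega\underline q$ for a.e. $t$; $s_{\rm in}$ is measurable on $\Omega\times]0,T[$ and $s^0_w$ is measurable on $\Omega$, both with values in $[0,1]$ a.e. The functions $p_c,\eta_\alpha,f_\alpha$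 ($\alpha=w,o$) are extended to $\mathbb R$ continuously by constants. Let $\mathcal T_h$ be a conforming simplicial mesh of $\overline\Omega$ whose elements $K$ have all their (dihedral) angles at most $\pi/2$, such that $\varphi$ is constant on every $K$ and such that every $K$ contains a ball of diameter $\rho$ with $\operatorname{diam}K\le\sigma\rho$. Let $x_1,\dots,x_M$ be its nodes, $\phi_i$ the continuous piecewise affine Lagrange basis functions, $I_h$ the nodal interpolation operator, $\Delta_i$ the union of the elements sharing $x_i$, and $$m_i=\tfrac{|\Delta_i|}{d+1},\qquad \tilde m_i=\tfrac1{d+1}\sum_{K\ni x_i}\varphi|_K|K|,\qquad c_{ij}=\int_{\Delta_i\cap\Delta_j}|\nabla\phi_i\cdot\nabla\phi_j| .$$ Let $r_h(g)=\sum_i\big(|\Delta_i|^{-1}\int_{\Delta_i}g\big)\phi_i$, $\tau=T/N$ with $N\ge1$, $t_n=n\tau$, and $\rho_\tau(f)^n=\tau^{-1}\int_{t_{n-1}}^{t_n}f$. Denote by $s_{\rm in}^{n,i},\bar q^{n,i},\underline q^{n,i}$ the values at $x_i$ of $\rho_\tau(r_h(s_{\rm in}))^n$ and of $\rho_\tau\big(r_h(q)-|\Omega|^{-1}\int_\Omega(r_h(q)-q)\big)^n$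 for $q=\bar q,\underline q$. A discrete solution consists of real numbers $S^{n,i}$ ($0\le n\le N$) and $P_w^{n,i},P_o^{n,i}$ ($1\le n\le N$), $1\le i\le M$, with $S^{0,i}=r_h(s_w^0)(x_i)$ and, for $1\le n\le N$, $$\tfrac{\tilde m_i}{\tau}(S^{n,i}-S^{n-1,i})-\sum_j c_{ij}\,\eta_w(S_w^{n,ij})(P_w^{n,j}-P_w^{n,i})=m_i\big(f_w(s_{\rm in}^{n,i})\bar q^{n,i}-f_w(S^{n,i})\underline q^{n,i}\big),\quad 1\le i\le M-1,$$ $$-\tfrac{\tilde m_i}{\tau}(S^{n,i}-S^{n-1,i})-\sum_j c_{ij}\,\eta_o(S_o^{n,ij})(P_o^{n,j}-P_o^{n,i})=m_i\big(f_o(s_{\rm in}^{n,i})\bar q^{n,i}-f_o(S^{n,i})\underline q^{n,i}\big),\quad 1\le i\le M,$$ $$P_o^{n,i}-P_w^{n,i}=p_c(S^{n,i}),\quad 1\le i\le M,\qquad \sum_{i=1}^M m_iP_w^{n,i}=0 .$$ Here, for $\alpha=w,o$, the upwind value $S_\alpha^{n,ij}$ is $S^{n,i}$ if $P_\alpha^{n,i}>P_\alpha^{n,j}$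 and $S^{n,j}$ if $P_\alpha^{n,i}<P_\alpha^{n,j}$; if $P_\alpha^{n,i}=P_\alpha^{n,j}$, it is $\max(S^{n,i},S^{n,j})$ for $\alpha=w$ and $\min(S^{n,i},S^{n,j})$ for $\alpha=o$. The discrete auxiliary pressures are the functions that are piecewise constant in time with, for $t\in\,]t_{n-1},t_n]$, $$U_{w,h,\tau}(\cdot,t)=\sum_i\big(P_w^{n,i}+p_{wg}(S^{n,i})\big)\phi_i,\qquad U_{o,h,\tau}(\cdot,t)=\sum_i\big(P_o^{n,i}-p_{og}(S^{n,i})\big)\phi_i .$$ **Theorem.** For given data and given $\sigma$ there is a constant $C$, independent of the mesh (in particular of $h$) and of $\tau$, such that every discrete solution, on every such mesh and for every $N\ge1$, satisfies $$\tau\sum_{n=1}^N\sum_{i,j=1}^M c_{ij}\Big(\eta_w(S_w^{n,ij})(P_w^{n,i}-P_w^{n,j})^2+\eta_o(S_o^{n,ij})(P_o^{n,i}-P_o^{n,j})^2\Big)\le C$$ and, with the same constant $C$, $$\eta_*\,\|\nabla U_{\alpha,h,\tau}\|^2_{L^2(\Omega\times]0,T[)}\le C,\qquad \alpha=w,o .$$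 -/

import Mathlib

open MeasureTheory
open scoped InnerProductSpace

noncomputable section

/-- The Euclidean space `ℝ^d`. -/
abbrev Space (d : ℕ) : Type := EuclideanSpace ℝ (Fin d)

/-! ### Simplicial meshes and piecewise affine finite elements -/

/-- A conforming mesh of `d`-simplices in `ℝ^d`. Every element is given by the set of its `d + 1`
affinely independent vertices, and two elements meet exactly along the simplex spanned by their
common vertices. -/
structure SimplicialMesh (d : ℕ) where
  elems : Finset (Finset (Space d))
  card_elem : ∀ K ∈ elems, K.card = d + 1
  affineIndependent : ∀ K ∈ elems, AffineIndependent ℝ (fun v : K => (v : Space d))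
  conforming : ∀ K ∈ elems, ∀ L ∈ elems,
    convexHull ℝ (K : Set (Space d)) ∩ convexHull ℝ (L : Set (Space d)) =
      convexHull ℝ ((K : Set (Space d)) ∩ (L : Set (Space d)))

/-- The closed simplex with vertex set `K`. -/
def cell {d : ℕ} (K : Finset (Space d)) : Set (Space d) := convexHull ℝ (K : Set (Space d))

namespace SimplicialMesh

variable {d : ℕ} (T : SimplicialMesh d)

open Classical in
/-- The set of nodes: all vertices of all elements. -/
def nodes : Finset (Space d) := T.elems.biUnion id

/-- The index set of the nodes. -/
abbrev Node : Type := {x : Space d // x ∈ T.nodes}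

theorem affineSpan_elem_eq_top {K : Finset (Space d)} (hK : K ∈ T.elems) :
    affineSpan ℝ (Set.range fun v : K => (v : Space d)) = ⊤ := by
  rw [(T.affineIndependent K hK).affineSpan_eq_top_iff_card_eq_finrank_add_one]
  simp [T.card_elem K hK]

/-- The vertices of an element, as an affine basis of `ℝ^d`. -/
def elemBasis {K : Finset (Space d)} (hK : K ∈ T.elems) : AffineBasis K ℝ (Space d) :=
  ⟨fun v => (v : Space d), T.affineIndependent K hK, T.affineSpan_elem_eq_top hK⟩

open Classical in
/-- The barycentric coordinate of the element `K` attached to its vertex `v`, as an affine function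
on `ℝ^d`. It is `0` if `v` is not a vertex of `K`. -/
def bary (K : Finset (Space d)) (v x : Space d) : ℝ :=
  if h : K ∈ T.elems ∧ v ∈ K then (T.elemBasis h.1).coord ⟨v, h.2⟩ x else 0

open Classical in
/-- The Lagrange basis function `φ_i`: on each element `K` it is the barycentric coordinate of `K`
attached to the node `i`. By conformity the value does not depend on the element that is chosen
among those that contain `x`; the value outside the mesh is irrelevant. -/
def hat (i : T.Node) (x : Space d) : ℝ :=
  if h : ∃ K ∈ T.elems, x ∈ cell K then T.bary h.choose i x else 0

/-- The function `∑ i, U^i φ_i` of `X_h` with the nodal values `U^i`. -/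
def lagrange (U : T.Node → ℝ) (x : Space d) : ℝ := ∑ i, U i * T.hat i x

/-- `T` is a mesh of the domain `Ω`: its elements cover exactly the closure of `Ω`. -/
def Triangulates (Ω : Set (Space d)) : Prop := ⋃ K ∈ T.elems, cell K = closure Ω

/-- The dihedral angle of `K` between the facets opposite to the vertices `v` and `w`. The gradient
of the barycentric coordinate of a vertex is an inward normal of the facet opposite to it. -/
def dihedralAngle (K : Finset (Space d)) (v w : Space d) : ℝ :=
  Real.pi - InnerProductGeometry.angle (gradient (T.bary K v) v) (gradient (T.bary K w) w)

/-- No angle of an element is larger than `π / 2`. -/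
def Nonobtuse : Prop :=
  ∀ K ∈ T.elems, ∀ v ∈ K, ∀ w ∈ K, v ≠ w → T.dihedralAngle K v w ≤ Real.pi / 2

/-- Shape regularity with constant `σ`: the diameter of every element is at most `σ` times the
diameter of a ball that it contains. -/
def ShapeRegular (σ : ℝ) : Prop :=
  ∀ K ∈ T.elems, ∃ (c : Space d) (r : ℝ), 0 < r ∧ Metric.closedBall c r ⊆ cell K ∧
    Metric.diam (cell K) ≤ σ * (2 * r)

/-- The function `φ` is (a.e. equal to) a constant on each element. -/
def Resolves (φ : Space d → ℝ) : Prop :=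
  ∀ K ∈ T.elems, ∃ c : ℝ, ∀ᵐ x ∂(volume.restrict (cell K)), φ x = c

/-- `Δ_i`, the union of the elements that share the node `i`. -/
def patch (i : T.Node) : Set (Space d) := ⋃ K ∈ {K | K ∈ T.elems ∧ (i : Space d) ∈ K}, cell K

/-- `c_{ij}`, the integral of `|∇φ_i · ∇φ_j|` over `Δ_i ∩ Δ_j`. -/
def stiff (i j : T.Node) : ℝ :=
  ∫ x in T.patch i ∩ T.patch j, |⟪gradient (T.hat i) x, gradient (T.hat j) x⟫_ℝ|

/-- `m_i = |Δ_i| / (d + 1)`. -/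
def mass (i : T.Node) : ℝ := volume.real (T.patch i) / (d + 1)

open Classical in
/-- `m̃_i(φ) = (d + 1)⁻¹ ∑_K φ|_K |K|`, the sum being over the elements that share the node `i`;
`φ|_K |K|` is the integral of `φ` over `K`. -/
def weightedMass (φ : Space d → ℝ) (i : T.Node) : ℝ :=
  (∑ K ∈ T.elems with (i : Space d) ∈ K, ∫ x in cell K, φ x) / (d + 1)

/-- The nodal values of `r_h(g)`: the mean values of `g` over the sets `Δ_i`. -/
def nodalMean (g : Space d → ℝ) (i : T.Node) : ℝ :=
  (∫ x in T.patch i, g x) / volume.real (T.patch i)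

end SimplicialMesh

/-- Mean value in time over `]t_{n-1}, t_n]`, where `t_n = n τ`. -/
def timeMean (τ : ℝ) (f : ℝ → ℝ) (n : ℕ) : ℝ :=
  (∫ t in (((n : ℝ) - 1) * τ)..((n : ℝ) * τ), f t) / τ

/-! ### Data of the two-phase flow problem -/

/-- Continuous extension by constants to `ℝ` of a function given on `[0,1]`. -/
def extendConst (f : ℝ → ℝ) (x : ℝ) : ℝ := f (max 0 (min x 1))

/-- `f'` is the weak derivative in `L¹(0,1)` of the function `f`. -/
def IsWeakDerivUnitInterval (f f' : ℝ → ℝ) : Prop :=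
  IntegrableOn f' (Set.Ioo 0 1) ∧
    ∀ ψ : ℝ → ℝ, ContDiff ℝ (⊤ : ℕ∞) ψ → HasCompactSupport ψ → tsupport ψ ⊆ Set.Ioo 0 1 →
      ∫ x in Set.Ioo 0 1, f x * deriv ψ x = -∫ x in Set.Ioo 0 1, f' x * ψ x

/-- The data of the problem. -/
structure FlowData (d : ℕ) where
  /-- the domain -/
  Ω : Set (Space d)
  /-- the final time -/
  tf : ℝ
  /-- the porosity -/
  φ : Space d → ℝ
  /-- the mobility of the wetting phase (on `[0,1]`) -/
  ηw : ℝ → ℝ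
  /-- the mobility of the non-wetting phase (on `[0,1]`) -/
  ηo : ℝ → ℝ
  /-- the lower bound of the total mobility -/
  ηs : ℝ
  /-- the capillary pressure (on `[0,1]`) -/
  pc : ℝ → ℝ
  /-- the weak derivative of the capillary pressure -/
  pc' : ℝ → ℝ
  /-- the flow rate at the injection wells, as a function of `x` and `t` -/
  qin : Space d → ℝ → ℝ
  /-- the flow rate at the production wells, as a function of `x` and `t` -/
  qout : Space d → ℝ → ℝ
  /-- the input saturation, as a function of `x` and `t` -/
  sin : Space d → ℝ → ℝ
  /-- the initial saturation -/
  s0 : Space d → ℝ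

namespace FlowData

variable {d : ℕ} (D : FlowData d)

/-- Lebesgue measure on the space-time cylinder `Ω × ]0,T[`. -/
def cylinder : Measure (Space d × ℝ) := volume.restrict (D.Ω ×ˢ Set.Ioo 0 D.tf)

/-- The standing assumptions on the data. -/
structure Admissible : Prop where
  connected : IsConnected D.Ω
  bounded : Bornology.IsBounded D.Ω
  /-- `Ω` is open and lies on one side of its boundary, as every Lipschitz domain does -/
  regular : interior (closure D.Ω) = D.Ω
  tf_pos : 0 < D.tf
  φ_bounds : ∃ a b : ℝ, 0 < a ∧ ∀ᵐ x ∂(volume.restrict D.Ω), a ≤ D.φ x ∧ D.φ x ≤ b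
  ηw_nonneg : ∀ s ∈ Set.Icc (0 : ℝ) 1, 0 ≤ D.ηw s
  ηw_cont : ContinuousOn D.ηw (Set.Icc 0 1)
  ηw_mono : MonotoneOn D.ηw (Set.Icc 0 1)
  ηo_nonneg : ∀ s ∈ Set.Icc (0 : ℝ) 1, 0 ≤ D.ηo s
  ηo_cont : ContinuousOn D.ηo (Set.Icc 0 1)
  ηo_anti : AntitoneOn D.ηo (Set.Icc 0 1)
  ηs_pos : 0 < D.ηs
  ηs_le : ∀ s ∈ Set.Icc (0 : ℝ) 1, D.ηs ≤ D.ηw s + D.ηo s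
  pc_cont : ContinuousOn D.pc (Set.Icc 0 1)
  pc_anti : StrictAntiOn D.pc (Set.Icc 0 1)
  pc_weakDeriv : IsWeakDerivUnitInterval D.pc D.pc'
  qin_memLp : MemLp (fun p : Space d × ℝ => D.qin p.1 p.2) 2 D.cylinder
  qout_memLp : MemLp (fun p : Space d × ℝ => D.qout p.1 p.2) 2 D.cylinder
  qin_nonneg : ∀ᵐ p ∂D.cylinder, 0 ≤ D.qin p.1 p.2
  qout_nonneg : ∀ᵐ p ∂D.cylinder, 0 ≤ D.qout p.1 p.2
  q_balance : ∀ᵐ t ∂(volume.restrict (Set.Ioo 0 D.tf)),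
    ∫ x in D.Ω, D.qin x t = ∫ x in D.Ω, D.qout x t
  sin_meas : AEStronglyMeasurable (fun p : Space d × ℝ => D.sin p.1 p.2) D.cylinder
  sin_bounds : ∀ᵐ p ∂D.cylinder, 0 ≤ D.sin p.1 p.2 ∧ D.sin p.1 p.2 ≤ 1
  s0_meas : AEStronglyMeasurable D.s0 (volume.restrict D.Ω)
  s0_bounds : ∀ᵐ x ∂(volume.restrict D.Ω), 0 ≤ D.s0 x ∧ D.s0 x ≤ 1

/-- The fractional flow of the wetting phase. -/
def fw (s : ℝ) : ℝ := D.ηw s / (D.ηw s + D.ηo s)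

/-- The fractional flow of the non-wetting phase. -/
def fo (s : ℝ) : ℝ := 1 - D.fw s

/-- The auxiliary pressure `p_{wg}` on `[0,1]`. -/
def pwg (x : ℝ) : ℝ := ∫ s in (0 : ℝ)..x, D.fo s * D.pc' s

/-- The auxiliary pressure `p_{og}` on `[0,1]`. -/
def pog (x : ℝ) : ℝ := ∫ s in (0 : ℝ)..x, D.fw s * D.pc' s

/-! ### The numerical scheme -/

/-- The time step `τ = T / N`. -/
def step (N : ℕ) : ℝ := D.tf / N

/-- The nodal values `s_in^{n,i}` of `ρ_τ(r_h(s_in))`. -/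
def sinDisc (T : SimplicialMesh d) (N n : ℕ) (i : T.Node) : ℝ :=
  timeMean (D.step N) (fun t => T.nodalMean (fun x => D.sin x t) i) n

/-- The nodal values of `ρ_τ(r_h(q) - |Ω|⁻¹ ∫_Ω (r_h(q) - q))`. -/
def rateDisc (T : SimplicialMesh d) (N : ℕ) (q : Space d → ℝ → ℝ) (n : ℕ) (i : T.Node) : ℝ :=
  timeMean (D.step N) (fun t => T.nodalMean (fun x => q x t) i -
    (∫ x in D.Ω, (T.lagrange (T.nodalMean (fun y => q y t)) x - q x t)) / volume.real D.Ω) n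

end FlowData

/-- The upwind value `S_w^{ij}` for the saturation values `si`, `sj` and pressure values `pi`, `pj`
of the wetting phase. -/
def upwindW (si sj pi pj : ℝ) : ℝ :=
  if pj < pi then si else if pi < pj then sj else max si sj

/-- The upwind value `S_o^{ij}` for the saturation values `si`, `sj` and pressure values `pi`, `pj`
of the non-wetting phase. -/
def upwindO (si sj pi pj : ℝ) : ℝ :=
  if pj < pi then si else if pi < pj then sj else min si sj

namespace FlowData

variable {d : ℕ} (D : FlowData d)

/-- The nodal values `S n i`, `Pw n i`, `Po n i`, for `n = 0, …, N` in the case of `S` and for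
`n = 1, …, N` in the case of `Pw` and `Po`, solve the discrete scheme on the mesh `T` with `N` time
steps. The discrete equation of the wetting phase is imposed at all nodes but one. -/
structure IsDiscreteSolution (T : SimplicialMesh d) (N : ℕ) (S Pw Po : ℕ → T.Node → ℝ) : Prop where
  initial : ∀ i, S 0 i = T.nodalMean D.s0 i
  wetting : ∃ last : T.Node, ∀ n ∈ Set.Icc 1 N, ∀ i, i ≠ last →
    T.weightedMass D.φ i / D.step N * (S n i - S (n - 1) i)
      - ∑ j, T.stiff i j * extendConst D.ηw (upwindW (S n i) (S n j) (Pw n i) (Pw n j))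
          * (Pw n j - Pw n i)
      = T.mass i * (extendConst D.fw (D.sinDisc T N n i) * D.rateDisc T N D.qin n i
          - extendConst D.fw (S n i) * D.rateDisc T N D.qout n i)
  nonwetting : ∀ n ∈ Set.Icc 1 N, ∀ i,
    -(T.weightedMass D.φ i / D.step N) * (S n i - S (n - 1) i)
      - ∑ j, T.stiff i j * extendConst D.ηo (upwindO (S n i) (S n j) (Po n i) (Po n j))
          * (Po n j - Po n i)
      = T.mass i * (extendConst D.fo (D.sinDisc T N n i) * D.rateDisc T N D.qin n i
          - extendConst D.fo (S n i) * D.rateDisc T N D.qout n i)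
  capillary : ∀ n ∈ Set.Icc 1 N, ∀ i, Po n i - Pw n i = extendConst D.pc (S n i)
  normalized : ∀ n ∈ Set.Icc 1 N, ∑ i, T.mass i * Pw n i = 0

/-- The function of `(x, t)` that is piecewise constant in time, equal to `∑ i, (V n i) φ_i(x)` for
`t` in `]t_{n-1}, t_n]`. -/
def spaceTime (T : SimplicialMesh d) (N : ℕ) (V : ℕ → T.Node → ℝ) (x : Space d) (t : ℝ) : ℝ :=
  T.lagrange (V ⌈t / D.step N⌉₊) x

/-- The discrete auxiliary pressure `U_w = P_w + I_h(p_{wg}(S))`. -/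
def Uw (T : SimplicialMesh d) (N : ℕ) (S Pw : ℕ → T.Node → ℝ) : Space d → ℝ → ℝ :=
  D.spaceTime T N fun n i => Pw n i + D.pwg (S n i)

/-- The discrete auxiliary pressure `U_o = P_o - I_h(p_{og}(S))`. -/
def Uo (T : SimplicialMesh d) (N : ℕ) (S Po : ℕ → T.Node → ℝ) : Space d → ℝ → ℝ :=
  D.spaceTime T N fun n i => Po n i - D.pog (S n i)

/-- The `L²(Ω × ]0,T[)` norm of the spatial gradient of `U`. -/
def gradNorm (U : Space d → ℝ → ℝ) : ENNReal :=
  eLpNorm (fun p : Space d × ℝ => gradient (fun x => U x p.2) p.1) 2 D.cylinder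

/-- The upwinded discrete energy of the two phase pressures,
`τ ∑_n ∑_{i,j} c_{ij} (η_w(S_w^{n,ij}) (P_w^{n,i} - P_w^{n,j})²
+ η_o(S_o^{n,ij}) (P_o^{n,i} - P_o^{n,j})²)`. -/
def pressureEnergy (T : SimplicialMesh d) (N : ℕ) (S Pw Po : ℕ → T.Node → ℝ) : ℝ :=
  D.step N * ∑ n ∈ Finset.Icc 1 N, ∑ i, ∑ j, T.stiff i j *
    (extendConst D.ηw (upwindW (S n i) (S n j) (Pw n i) (Pw n j)) * (Pw n i - Pw n j) ^ 2
      + extendConst D.ηo (upwindO (S n i) (S n j) (Po n i) (Po n j)) * (Po n i - Po n j) ^ 2)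

end FlowData

end

/-! The estimate comes from testing each phase equation with its own pressure. Summation by parts
turns the fluxes into the upwinded energy (`StepSolution.energy_eq`). Since the pressures differ by
`p_c(S)`, the accumulation terms combine into `(S^n - S^{n-1}) p_c(S^n)`. As `p_c` is nonincreasing,
this is at most the integral of `p_c` from `S^{n-1}` to `S^n`, which telescopes in `n` and stays
bounded because the saturations lie in `[0,1]`. What remains is a source term containing `P_w`, and
the energy does not control `P_w` where its mobility vanishes.

The remedy is the auxiliary pressure `U_w`. By a weighted mean value theorem its increment along an
edge is a convex combination `f_w(ξ) δP_w + f_o(ξ) δP_o` with `ξ` between the two saturations.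
Upwinding selects mobilities for which a weighted Cauchy-Schwarz inequality bounds `η_* (δU_w)²` by
the energy density of the edge (`auxiliary_increment_le`). On a nonobtuse mesh the coefficients
`c_{ij}` are, off the diagonal, the negatives of the stiffness entries, so half the edge sum of
`(δU_w)²` is the Dirichlet energy (`dirichlet_eq`). This yields the gradient bound once the energy
is bounded. It also closes the energy estimate: with `P_w = U_w - p_{wg}(S)` the source becomes a
bounded part plus `∑ m_i (q̄_i - q_i) U_i`, written with `q` for the production rate. The difference
of the rates has mean zero, so only differences of `U_w` enter, and the Poincaré and Young
inequalities absorb them (`StepSolution.energy_le`). `U_o` has the same increments as `U_w`.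

Three ingredients support this. First, the Poincaré constant must not see the mesh
(`exists_discrete_poincare`): one fixed reference mesh cuts the domain into convex cells, a chain of
overlapping balls links any two of them, and piecewise affine functions on every other mesh enter
only through an upper gradient; the passage to lumped masses costs a constant depending on `d`
alone. Second, the maximum principle (`IsDiscreteSolution.mem_Icc`): after elimination of the total
flow, the monotonicity of the upwind fluxes fixes the sign of everything at an extremal node. Third,
`p_c` has only a weak derivative: it is the primitive of that derivative, which is nonpositive
almost everywhere, and this is what the mean value theorem requires. -/

noncomputable section

/-! ### Functions of one real variable -/

/-- A compact subset of the open unit interval is contained in a compact subinterval. -/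
theorem exists_Icc_of_isCompact_subset_Ioo {K : Set ℝ} (hK : IsCompact K)
    (h : K ⊆ Set.Ioo 0 1) : ∃ a b : ℝ, 0 < a ∧ a ≤ b ∧ b < 1 ∧ K ⊆ Set.Icc a b := by
  rcases K.eq_empty_or_nonempty with rfl | hne
  · exact ⟨1 / 2, 1 / 2, by norm_num, le_rfl, by norm_num, by simp⟩
  · obtain ⟨a, ha⟩ := hK.exists_isLeast hne
    obtain ⟨b, hb⟩ := hK.exists_isGreatest hne
    exact ⟨a, b, (h ha.1).1, ha.2 hb.1, (h hb.1).2, fun x hx => ⟨ha.2 hx, hb.2 hx⟩⟩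

/-- A smooth function supported in the open unit interval whose integral vanishes is the derivative
of another one. -/
theorem exists_primitive_of_integral_eq_zero {χ : ℝ → ℝ} (hχ : ContDiff ℝ (⊤ : ℕ∞) χ)
    (hc : HasCompactSupport χ) (hs : tsupport χ ⊆ Set.Ioo 0 1) (h0 : ∫ x, χ x = 0) :
    ∃ ψ : ℝ → ℝ, ContDiff ℝ (⊤ : ℕ∞) ψ ∧ HasCompactSupport ψ ∧ tsupport ψ ⊆ Set.Ioo 0 1 ∧
      deriv ψ = χ := by
  obtain ⟨a, b, ha, hab, hb, hsub⟩ := exists_Icc_of_isCompact_subset_Ioo hc hs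
  have hz : ∀ x, x ∉ Set.Icc a b → χ x = 0 := fun x hx =>
    image_eq_zero_of_notMem_tsupport fun h => hx (hsub h)
  have hcont := hχ.continuous
  have hder : ∀ x, HasDerivAt (fun x => ∫ t in (0 : ℝ)..x, χ t) (χ x) x := fun x =>
    intervalIntegral.integral_hasDerivAt_right (hcont.intervalIntegrable _ _)
      (hcont.stronglyMeasurableAtFilter _ _) hcont.continuousAt
  have hd : deriv (fun x => ∫ t in (0 : ℝ)..x, χ t) = χ := funext fun x => (hder x).deriv
  have hz0 : ∀ x, x ∉ Set.Icc a b → ∫ t in (0 : ℝ)..x, χ t = 0 := by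
    intro x hx
    rw [Set.mem_Icc, not_and_or, not_le, not_le] at hx
    rcases hx with hx | hx
    · rw [intervalIntegral.integral_congr (g := fun _ => 0), intervalIntegral.integral_zero]
      intro t ht
      refine hz t fun h => ?_
      have := ht.2
      have : t ≤ max 0 x := ht.2
      have := h.1
      have : max 0 x < a := max_lt ha hx
      linarith
    -- To the right of the support the primitive equals the full integral of `χ`, which vanishes by
    -- hypothesis.
    · have hsupp : Function.support χ ⊆ Set.Ioc 0 x := by
        intro t ht
        by_contra hcon
        refine ht (hz t fun h => hcon ⟨by linarith [h.1], by linarith [h.2]⟩)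
      rw [intervalIntegral.integral_eq_integral_of_support_subset hsupp, h0]
  have hts : tsupport (fun x => ∫ t in (0 : ℝ)..x, χ t) ⊆ Set.Icc a b :=
    closure_minimal (fun x hx => by
      by_contra hcon
      exact hx (hz0 x hcon)) isClosed_Icc
  refine ⟨_, ?_, ?_, hts.trans fun x hx => ⟨by linarith [hx.1], by linarith [hx.2]⟩, hd⟩
  · rw [contDiff_infty_iff_deriv, hd]
    exact ⟨fun x => (hder x).differentiableAt, hχ⟩
  · exact isCompact_Icc.of_isClosed_subset (isClosed_tsupport _) hts

/-- A smooth function supported in the open unit interval with integral one. -/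
theorem exists_unit_bump : ∃ χ : ℝ → ℝ, ContDiff ℝ (⊤ : ℕ∞) χ ∧ HasCompactSupport χ ∧
    tsupport χ ⊆ Set.Ioo 0 1 ∧ ∫ x, χ x = 1 := by
  let f : ContDiffBump (1 / 2 : ℝ) := ⟨1 / 8, 1 / 4, by norm_num, by norm_num⟩
  refine ⟨f.normed volume, f.contDiff_normed, f.hasCompactSupport_normed, ?_, f.integral_normed⟩
  rw [f.tsupport_normed_eq]
  intro x hx
  rw [Metric.mem_closedBall, Real.dist_eq, abs_le] at hx
  have : f.rOut = 1 / 4 := rfl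
  constructor <;> linarith [hx.1, hx.2]

/-- The fundamental theorem of calculus for continuous functions in `W^{1,1}(0,1)`. -/
theorem IsWeakDerivUnitInterval.integral_eq_sub {f f' : ℝ → ℝ} (h : IsWeakDerivUnitInterval f f')
    (hf : ContinuousOn f (Set.Icc 0 1)) {x : ℝ} (hx : x ∈ Set.Icc (0 : ℝ) 1) :
    ∫ s in (0 : ℝ)..x, f' s = f x - f 0 := by
  have hint : IntervalIntegrable f' volume 0 1 := by
    rw [intervalIntegrable_iff_integrableOn_Ioo_of_le zero_le_one]; exact h.1
  -- The du Bois-Reymond argument: `f - F` has weak derivative zero, hence is constant almost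
  -- everywhere, and by continuity everywhere on the closed interval.
  set F : ℝ → ℝ := fun x => ∫ s in (0 : ℝ)..x, f' s with hF
  have hFac : AbsolutelyContinuousOnInterval F 0 1 :=
    hint.absolutelyContinuousOnInterval_intervalIntegral (by simp)
  have hFc : ContinuousOn F (Set.Icc 0 1) := by
    have := hFac.continuousOn; rwa [Set.uIcc_of_le zero_le_one] at this
  have hdF : ∀ᵐ x, x ∈ Set.Ioc (0 : ℝ) 1 → deriv F x = f' x := by
    filter_upwards [hint.ae_hasDerivAt_integral] with x hx hx1
    refine (hx ?_ 0 (by simp)).deriv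
    rw [Set.uIcc_of_le zero_le_one]; exact ⟨hx1.1.le, hx1.2⟩
  have hgc : ContinuousOn (fun x => f x - F x) (Set.Icc 0 1) := hf.sub hFc
  have hfi : IntegrableOn f (Set.Ioo 0 1) :=
    (hf.integrableOn_Icc).mono_set Set.Ioo_subset_Icc_self
  have hFi : IntegrableOn F (Set.Ioo 0 1) :=
    (hFc.integrableOn_Icc).mono_set Set.Ioo_subset_Icc_self
  have hgi : IntegrableOn (fun x => f x - F x) (Set.Ioo 0 1) := hfi.sub hFi
  have mulb : ∀ {u χ : ℝ → ℝ}, IntegrableOn u (Set.Ioo 0 1) → Continuous χ →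
      HasCompactSupport χ → IntegrableOn (fun x => u x * χ x) (Set.Ioo 0 1) := by
    intro u χ hu hχ hc
    obtain ⟨C, hC⟩ := hχ.bounded_above_of_compact_support hc
    exact Integrable.mul_bdd hu hχ.aestronglyMeasurable (Filter.Eventually.of_forall hC)
  have key : ∀ χ : ℝ → ℝ, ContDiff ℝ (⊤ : ℕ∞) χ → HasCompactSupport χ →
      tsupport χ ⊆ Set.Ioo 0 1 → ∫ x, χ x = 0 → ∫ x in Set.Ioo 0 1, (f x - F x) * χ x = 0 := by
    intro χ h1 h2 h3 h4
    obtain ⟨ψ, p1, p2, p3, rfl⟩ := exists_primitive_of_integral_eq_zero h1 h2 h3 h4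
    have e1 := h.2 ψ p1 p2 p3
    have p0 : ψ 0 = 0 := image_eq_zero_of_notMem_tsupport fun h => by simpa using (p3 h).1
    have p0' : ψ 1 = 0 := image_eq_zero_of_notMem_tsupport fun h => by simpa using (p3 h).2
    have hψac : AbsolutelyContinuousOnInterval ψ 0 1 := by
      obtain ⟨K, hK⟩ := (p1.of_le (m := 1) (by simp)).lipschitzWith_of_hasCompactSupport p2 (by simp)
      exact (hK.lipschitzOnWith).absolutelyContinuousOnInterval
    have e2 := hFac.integral_mul_deriv_eq_deriv_mul hψac
    rw [p0, p0', mul_zero, mul_zero, sub_zero, zero_sub,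
      intervalIntegral.integral_of_le zero_le_one, intervalIntegral.integral_of_le zero_le_one,
      integral_Ioc_eq_integral_Ioo] at e2
    have e3 : ∫ x in Set.Ioc (0 : ℝ) 1, deriv F x * ψ x = ∫ x in Set.Ioo (0 : ℝ) 1, f' x * ψ x := by
      rw [← integral_Ioc_eq_integral_Ioo]
      refine setIntegral_congr_ae measurableSet_Ioc ?_
      filter_upwards [hdF] with x hx hx1
      rw [hx hx1]
    simp_rw [sub_mul]
    rw [integral_sub (mulb hfi (h1.continuous) h2) (mulb hFi h1.continuous h2), e1, e2, e3, sub_self]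
  obtain ⟨χ₀, c1, c2, c3, c4⟩ := exists_unit_bump
  set c := ∫ x in Set.Ioo 0 1, (f x - F x) * χ₀ x with hc
  have hae : ∀ᵐ x, x ∈ Set.Ioo (0 : ℝ) 1 → f x - F x - c = 0 := by
    refine isOpen_Ioo.ae_eq_zero_of_integral_contDiff_smul_eq_zero ?_ ?_
    · exact (hgi.sub (integrableOn_const (by simp))).locallyIntegrableOn
    · intro χ h1 h2 h3
      set I := ∫ x, χ x
      have hz : ∀ {χ : ℝ → ℝ}, tsupport χ ⊆ Set.Ioo 0 1 → ∀ u : ℝ → ℝ,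
          ∫ x, χ x * u x = ∫ x in Set.Ioo 0 1, u x * χ x := by
        intro χ hs u
        rw [← setIntegral_eq_integral_of_forall_compl_eq_zero (s := Set.Ioo 0 1)]
        · simp_rw [mul_comm]
        · intro x hx
          rw [image_eq_zero_of_notMem_tsupport fun h => hx (hs h), zero_mul]
      -- Subtracting `I` times the unit bump makes the mean of the test function zero, so that `key`
      -- applies; the correction term produces exactly the constant `c`.
      have hk := key (fun x => χ x - I * χ₀ x) (h1.sub (contDiff_const.mul c1))
        (h2.sub c2.mul_left) ?_ ?_
      · simp_rw [smul_eq_mul]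
        rw [hz h3]
        have i1 := mulb hgi h1.continuous h2
        have i2 := mulb hgi c1.continuous c2
        have i3 : IntegrableOn χ (Set.Ioo 0 1) :=
          (h1.continuous.integrable_of_hasCompactSupport h2).integrableOn
        have : ∀ x, (f x - F x) * (χ x - I * χ₀ x)
            = (f x - F x) * χ x - I * ((f x - F x) * χ₀ x) := fun x => by ring
        simp_rw [this] at hk
        rw [integral_sub i1 (i2.const_mul _), integral_const_mul] at hk
        have : ∀ x, (f x - F x - c) * χ x = (f x - F x) * χ x - c * χ x := fun x => by ring
        simp_rw [this]
        rw [integral_sub i1 (i3.const_mul _), integral_const_mul]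
        have : ∫ x in Set.Ioo 0 1, χ x = I := by
          have := hz h3 (fun _ => 1)
          simpa using this.symm
        rw [this]
        linarith
      · refine (tsupport_sub _ _).trans (Set.union_subset h3 ?_)
        exact (closure_mono (Function.support_mul_subset_right _ _)).trans c3
      · rw [integral_sub (h1.continuous.integrable_of_hasCompactSupport h2)
          ((c1.continuous.integrable_of_hasCompactSupport c2).const_mul _), integral_const_mul, c4,
          mul_one, sub_self]
  have heqo : Set.EqOn (fun x => f x - F x) (fun _ => c) (Set.Ioo 0 1) := by
    refine Measure.eqOn_open_of_ae_eq (μ := volume) ?_ isOpen_Ioo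
      (hgc.mono Set.Ioo_subset_Icc_self) continuousOn_const
    rw [Filter.EventuallyEq, ae_restrict_iff' measurableSet_Ioo]
    filter_upwards [hae] with x hx hx1
    linarith [hx hx1]
  have heq : Set.EqOn (fun x => f x - F x) (fun _ => c) (Set.Icc 0 1) := by
    refine heqo.of_subset_closure hgc continuousOn_const Set.Ioo_subset_Icc_self ?_
    rw [closure_Ioo zero_ne_one]
  have h1 := heq hx
  have h2 := heq (show (0 : ℝ) ∈ Set.Icc (0 : ℝ) 1 by simp)
  simp only [hF, intervalIntegral.integral_same] at h1 h2
  linarith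

/-- The weak derivative of a nonincreasing continuous function is nonpositive. -/
theorem IsWeakDerivUnitInterval.nonpos_of_antitoneOn {f f' : ℝ → ℝ}
    (h : IsWeakDerivUnitInterval f f') (hf : ContinuousOn f (Set.Icc 0 1))
    (hanti : AntitoneOn f (Set.Icc 0 1)) : ∀ᵐ x, x ∈ Set.Ioo (0 : ℝ) 1 → f' x ≤ 0 := by
  have hint : IntervalIntegrable f' volume 0 1 := by
    rw [intervalIntegrable_iff_integrableOn_Ioo_of_le zero_le_one]; exact h.1
  filter_upwards [hint.ae_hasDerivAt_integral] with x hx hx1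
  have hmem : Set.Ioo (0 : ℝ) 1 ∈ nhds x := isOpen_Ioo.mem_nhds hx1
  have hd := hx (by rw [Set.uIcc_of_le zero_le_one]; exact ⟨hx1.1.le, hx1.2.le⟩) 0 (by simp)
  -- At almost every point the weak derivative is a classical derivative of `f`, and its sign can be
  -- read off from monotonicity.
  have hd' : HasDerivAt (fun x => f x - f 0) (f' x) x := by
    refine hd.congr_of_eventuallyEq ?_
    filter_upwards [hmem] with y hy
    exact (h.integral_eq_sub hf ⟨hy.1.le, hy.2.le⟩).symm
  have hw := hd'.hasDerivWithinAt (s := Set.Icc 0 1)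
  rw [← hw.derivWithin (uniqueDiffOn_Icc zero_lt_one x ⟨hx1.1.le, hx1.2.le⟩)]
  refine AntitoneOn.derivWithin_nonpos fun y hy z hz hyz => ?_
  simpa using hanti hy hz hyz

/-- The tangent inequality for the concave primitive of a nonincreasing function. -/
theorem sub_mul_le_integral_of_antitoneOn {f : ℝ → ℝ} (hf : ContinuousOn f (Set.Icc 0 1))
    (hanti : AntitoneOn f (Set.Icc 0 1)) {a b : ℝ} (ha : a ∈ Set.Icc (0 : ℝ) 1)
    (hb : b ∈ Set.Icc (0 : ℝ) 1) : (b - a) * f b ≤ ∫ s in a..b, f s := by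
  have hi : IntervalIntegrable f volume a b :=
    (hf.mono (Set.uIcc_subset_Icc ha hb)).intervalIntegrable
  rcases le_total a b with hab | hab
  · rw [← smul_eq_mul, ← intervalIntegral.integral_const]
    refine intervalIntegral.integral_mono_on hab intervalIntegrable_const hi fun x hx => ?_
    exact hanti ⟨ha.1.trans hx.1, hx.2.trans hb.2⟩ hb hx.2
  · rw [intervalIntegral.integral_symm, ← neg_sub, neg_mul, neg_le_neg_iff,
      ← smul_eq_mul, ← intervalIntegral.integral_const]
    refine intervalIntegral.integral_mono_on hab hi.symm intervalIntegrable_const fun x hx => ?_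
    exact hanti hb ⟨hb.1.trans hx.1, hx.2.trans ha.2⟩ hx.1

/-! ### Constant extensions and upwind values -/

theorem extendConst_of_mem {f : ℝ → ℝ} {x : ℝ} (hx : x ∈ Set.Icc (0 : ℝ) 1) :
    extendConst f x = f x := by
  rw [extendConst, min_eq_left hx.2, max_eq_right hx.1]

theorem clamp_mem (x : ℝ) : max 0 (min x 1) ∈ Set.Icc (0 : ℝ) 1 :=
  ⟨le_max_left _ _, max_le zero_le_one (min_le_right _ _)⟩

theorem clamp_mono {x y : ℝ} (h : x ≤ y) : max 0 (min x 1) ≤ max 0 (min y 1) :=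
  max_le_max le_rfl (min_le_min h le_rfl)

theorem MonotoneOn.extendConst {f : ℝ → ℝ} (h : MonotoneOn f (Set.Icc 0 1)) :
    Monotone (extendConst f) := fun x y hxy => h (clamp_mem x) (clamp_mem y) (clamp_mono hxy)

theorem AntitoneOn.extendConst {f : ℝ → ℝ} (h : AntitoneOn f (Set.Icc 0 1)) :
    Antitone (extendConst f) := fun x y hxy => h (clamp_mem x) (clamp_mem y) (clamp_mono hxy)

/-- The upwind value belongs to the edge and not to its orientation. This makes the flux
coefficients symmetric, hence the fluxes conservative. -/
theorem upwindW_symm (si sj pi pj : ℝ) : upwindW si sj pi pj = upwindW sj si pj pi := by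
  unfold upwindW
  split_ifs with h1 h2 <;> first | rfl | exact max_comm _ _ | (exfalso; linarith)

theorem upwindO_symm (si sj pi pj : ℝ) : upwindO si sj pi pj = upwindO sj si pj pi := by
  unfold upwindO
  split_ifs with h1 h2 <;> first | rfl | exact min_comm _ _ | (exfalso; linarith)

theorem upwindW_mem {s : Set ℝ} {si sj : ℝ} (hi : si ∈ s) (hj : sj ∈ s) (pi pj : ℝ) :
    upwindW si sj pi pj ∈ s := by
  unfold upwindW
  split_ifs
  · exact hi
  · exact hj
  · rcases max_choice si sj with h | h <;> rw [h] <;> assumption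

theorem upwindO_mem {s : Set ℝ} {si sj : ℝ} (hi : si ∈ s) (hj : sj ∈ s) (pi pj : ℝ) :
    upwindO si sj pi pj ∈ s := by
  unfold upwindO
  split_ifs
  · exact hi
  · exact hj
  · rcases min_choice si sj with h | h <;> rw [h] <;> assumption

/-- The Cauchy-Schwarz inequality behind the bound for the auxiliary pressures. -/
theorem mul_sq_le_of_abs_mul_le {a b x y u e : ℝ} (ha : 0 ≤ a) (hb : 0 ≤ b) (he : 0 < e)
    (hab : e ≤ a + b) (hu : |u| * (a + b) ≤ |a * x + b * y|) :
    e * u ^ 2 ≤ a * x ^ 2 + b * y ^ 2 := by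
  have hpos : 0 < a + b := he.trans_le hab
  have h1 : u ^ 2 * (a + b) ^ 2 ≤ (a * x + b * y) ^ 2 := by
    have := pow_le_pow_left₀ (by positivity) hu 2
    rwa [mul_pow, sq_abs, sq_abs] at this
  have h2 : (a * x + b * y) ^ 2 ≤ (a + b) * (a * x ^ 2 + b * y ^ 2) := by
    -- The difference of the two sides is exactly `a b (x - y)²`.
    nlinarith [mul_nonneg (mul_nonneg ha hb) (sq_nonneg (x - y))]
  have h3 : u ^ 2 * (a + b) ≤ a * x ^ 2 + b * y ^ 2 := by
    refine le_of_mul_le_mul_left ?_ hpos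
    nlinarith
  nlinarith [mul_le_mul_of_nonneg_right hab (sq_nonneg u)]

/-! ### Fractional flows and auxiliary pressures -/

namespace FlowData

namespace Admissible

variable {d : ℕ} {D : FlowData d} (hD : D.Admissible)
include hD

theorem total_pos {s : ℝ} (hs : s ∈ Set.Icc (0 : ℝ) 1) : 0 < D.ηw s + D.ηo s :=
  hD.ηs_pos.trans_le (hD.ηs_le s hs)

theorem fw_nonneg {s : ℝ} (hs : s ∈ Set.Icc (0 : ℝ) 1) : 0 ≤ D.fw s :=
  div_nonneg (hD.ηw_nonneg s hs) (hD.total_pos hs).le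

theorem fw_le_one {s : ℝ} (hs : s ∈ Set.Icc (0 : ℝ) 1) : D.fw s ≤ 1 := by
  rw [fw, div_le_one (hD.total_pos hs)]
  linarith [hD.ηo_nonneg s hs]

theorem fw_monotoneOn : MonotoneOn D.fw (Set.Icc 0 1) := by
  intro s hs t ht hst
  rw [fw, fw, div_le_div_iff₀ (hD.total_pos hs) (hD.total_pos ht)]
  nlinarith [mul_le_mul (hD.ηw_mono hs ht hst) (hD.ηo_anti hs ht hst) (hD.ηo_nonneg t ht)
    (hD.ηw_nonneg t ht)]

theorem fw_continuousOn : ContinuousOn D.fw (Set.Icc 0 1) :=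
  hD.ηw_cont.div (hD.ηw_cont.add hD.ηo_cont) fun _ hs => (hD.total_pos hs).ne'

theorem fo_continuousOn : ContinuousOn D.fo (Set.Icc 0 1) :=
  continuousOn_const.sub hD.fw_continuousOn

theorem fo_nonneg {s : ℝ} (hs : s ∈ Set.Icc (0 : ℝ) 1) : 0 ≤ D.fo s :=
  sub_nonneg.2 (hD.fw_le_one hs)

theorem fo_le_one {s : ℝ} (hs : s ∈ Set.Icc (0 : ℝ) 1) : D.fo s ≤ 1 :=
  sub_le_self _ (hD.fw_nonneg hs)

theorem fw_mul_total {s : ℝ} (hs : s ∈ Set.Icc (0 : ℝ) 1) :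
    D.fw s * (D.ηw s + D.ηo s) = D.ηw s :=
  div_mul_cancel₀ _ (hD.total_pos hs).ne'

theorem fo_mul_total {s : ℝ} (hs : s ∈ Set.Icc (0 : ℝ) 1) :
    D.fo s * (D.ηw s + D.ηo s) = D.ηo s := by
  rw [fo, sub_mul, hD.fw_mul_total hs]; ring

theorem pc'_intervalIntegrable {a b : ℝ} (ha : a ∈ Set.Icc (0 : ℝ) 1)
    (hb : b ∈ Set.Icc (0 : ℝ) 1) : IntervalIntegrable D.pc' volume a b := by
  have : IntervalIntegrable D.pc' volume 0 1 := by
    rw [intervalIntegrable_iff_integrableOn_Ioo_of_le zero_le_one]; exact hD.pc_weakDeriv.1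
  refine this.mono_set ?_
  rw [Set.uIcc_of_le zero_le_one]
  exact Set.uIcc_subset_Icc ha hb

theorem fo_pc'_intervalIntegrable {a b : ℝ} (ha : a ∈ Set.Icc (0 : ℝ) 1)
    (hb : b ∈ Set.Icc (0 : ℝ) 1) :
    IntervalIntegrable (fun s => D.fo s * D.pc' s) volume a b :=
  (hD.pc'_intervalIntegrable ha hb).continuousOn_mul
    (hD.fo_continuousOn.mono (Set.uIcc_subset_Icc ha hb))

theorem fw_pc'_intervalIntegrable {a b : ℝ} (ha : a ∈ Set.Icc (0 : ℝ) 1)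
    (hb : b ∈ Set.Icc (0 : ℝ) 1) :
    IntervalIntegrable (fun s => D.fw s * D.pc' s) volume a b :=
  (hD.pc'_intervalIntegrable ha hb).continuousOn_mul
    (hD.fw_continuousOn.mono (Set.uIcc_subset_Icc ha hb))

/-- The two auxiliary pressures split the capillary pressure. -/
theorem pwg_add_pog {s : ℝ} (hs : s ∈ Set.Icc (0 : ℝ) 1) :
    D.pwg s + D.pog s = D.pc s - D.pc 0 := by
  have h0 : (0 : ℝ) ∈ Set.Icc (0 : ℝ) 1 := by simp
  rw [pwg, pog, ← intervalIntegral.integral_add (hD.fo_pc'_intervalIntegrable h0 hs)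
    (hD.fw_pc'_intervalIntegrable h0 hs), ← hD.pc_weakDeriv.integral_eq_sub hD.pc_cont hs]
  congr 1
  funext t
  rw [fo]; ring

/-- Mean value theorem for the auxiliary pressure of the wetting phase. -/
theorem exists_pwg_sub {a b : ℝ} (ha : a ∈ Set.Icc (0 : ℝ) 1) (hb : b ∈ Set.Icc (0 : ℝ) 1) :
    ∃ ξ ∈ Set.uIcc a b, D.pwg b - D.pwg a = D.fo ξ * (D.pc b - D.pc a) := by
  have h0 : (0 : ℝ) ∈ Set.Icc (0 : ℝ) 1 := by simp
  have hae : ∀ᵐ x ∂(volume.restrict (Set.uIoc a b)), 0 ≤ -D.pc' x := by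
    rw [ae_restrict_iff' measurableSet_uIoc]
    -- The sign of `pc'` is known on the open interval only, whereas the half-open interval of
    -- integration may contain `1`.
    have h1 : ∀ᵐ x : ℝ, x ≠ 1 := by simp [ae_iff, measure_singleton]
    filter_upwards [hD.pc_weakDeriv.nonpos_of_antitoneOn hD.pc_cont hD.pc_anti.antitoneOn, h1]
      with x hx hx1 hxm
    have hlow : min a b < x := hxm.1
    have hup : x ≤ max a b := hxm.2
    have := hx ⟨(le_min ha.1 hb.1).trans_lt hlow,
      lt_of_le_of_ne (hup.trans (max_le ha.2 hb.2)) hx1⟩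
    linarith
  obtain ⟨ξ, hξ, h⟩ := exists_eq_const_mul_intervalIntegral_of_ae_nonneg
    (hD.fo_continuousOn.mono (Set.uIcc_subset_Icc ha hb))
    (hD.pc'_intervalIntegrable ha hb).neg hae
  refine ⟨ξ, hξ, ?_⟩
  have e1 : D.pwg b - D.pwg a = ∫ s in a..b, D.fo s * D.pc' s :=
    intervalIntegral.integral_interval_sub_left (hD.fo_pc'_intervalIntegrable h0 hb)
      (hD.fo_pc'_intervalIntegrable h0 ha)
  have e2 : D.pc b - D.pc a = ∫ s in a..b, D.pc' s := by
    rw [← intervalIntegral.integral_interval_sub_left (hD.pc'_intervalIntegrable h0 hb)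
      (hD.pc'_intervalIntegrable h0 ha), hD.pc_weakDeriv.integral_eq_sub hD.pc_cont hb,
      hD.pc_weakDeriv.integral_eq_sub hD.pc_cont ha]
    ring
  simp only [Pi.neg_apply, mul_neg, intervalIntegral.integral_neg] at h
  rw [e1, e2]
  linarith

theorem abs_pwg_le {s : ℝ} (hs : s ∈ Set.Icc (0 : ℝ) 1) :
    |D.pwg s| ≤ D.pc 0 - D.pc 1 := by
  obtain ⟨ξ, hξ, h⟩ := hD.exists_pwg_sub (a := 0) (by simp) hs
  have h0 : D.pwg 0 = 0 := by simp [pwg]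
  have hξ' : ξ ∈ Set.Icc (0 : ℝ) 1 := Set.uIcc_subset_Icc (by simp) hs hξ
  have h1 := hD.pc_anti.antitoneOn (a := 0) (b := s) (by simp) hs hs.1
  have h2 := hD.pc_anti.antitoneOn (a := s) (b := 1) hs (by simp) hs.2
  rw [h0, sub_zero] at h
  rw [h, abs_mul, abs_of_nonneg (hD.fo_nonneg hξ'), abs_of_nonpos (by linarith)]
  nlinarith [hD.fo_le_one hξ', hD.fo_nonneg hξ']

/-- With `x` and `y` the increments of the two pressures, monotonicity of `pc` gives `y ≤ x`, and
the increment of the auxiliary pressure is `y + f_w(ξ) (x - y)`, which is nondecreasing in `f_w`. If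
both increments are positive, both upwind values are `si`, and replacing `ξ` by `si` only increases
the modulus. If both are negative, the same holds with `sj`. If `y ≤ 0 ≤ x`, the upwind mobilities
are `η_w(si) ≥ η_w(ξ)` and `η_o(sj) ≥ η_o(ξ)`, so the Cauchy-Schwarz inequality is applied at `ξ`
itself. -/
theorem edge_of_le {si sj pwi pwj poi poj : ℝ} (hi : si ∈ Set.Icc (0 : ℝ) 1)
    (hj : sj ∈ Set.Icc (0 : ℝ) 1) (hle : sj ≤ si) (ci : poi - pwi = D.pc si)
    (cj : poj - pwj = D.pc sj) :
    D.ηs * ((pwi + D.pwg si) - (pwj + D.pwg sj)) ^ 2 ≤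
      D.ηw (upwindW si sj pwi pwj) * (pwi - pwj) ^ 2
        + D.ηo (upwindO si sj poi poj) * (poi - poj) ^ 2 := by
  obtain ⟨ξ, hξ, h⟩ := hD.exists_pwg_sub hj hi
  rw [Set.uIcc_of_le hle] at hξ
  have hξ' : ξ ∈ Set.Icc (0 : ℝ) 1 := ⟨hj.1.trans hξ.1, hξ.2.trans hi.2⟩
  have hpc := hD.pc_anti.antitoneOn hj hi hle
  set x := pwi - pwj with hx
  set y := poi - poj with hy
  have hyx : y ≤ x := by simp only [hx, hy]; linarith
  have hU : (pwi + D.pwg si) - (pwj + D.pwg sj) = D.fw ξ * x + D.fo ξ * y := by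
    have e : D.pc si - D.pc sj = y - x := by simp only [hx, hy]; linarith
    rw [e] at h
    have : (pwi + D.pwg si) - (pwj + D.pwg sj) = x + (D.pwg si - D.pwg sj) := by
      simp only [hx]; ring
    rw [this, h, fo]; ring
  rw [hU]
  have tot : ∀ s ∈ Set.Icc (0 : ℝ) 1,
      (D.fw s * x + D.fo s * y) * (D.ηw s + D.ηo s) = D.ηw s * x + D.ηo s * y := fun s hs => by
    rw [add_mul, mul_right_comm, hD.fw_mul_total hs, mul_right_comm, hD.fo_mul_total hs]
  have conv : ∀ s, D.fw s * x + D.fo s * y = y + D.fw s * (x - y) := fun s => by rw [fo]; ring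
  have cs : ∀ s ∈ Set.Icc (0 : ℝ) 1, |D.fw ξ * x + D.fo ξ * y| ≤ |D.fw s * x + D.fo s * y| →
      D.ηs * (D.fw ξ * x + D.fo ξ * y) ^ 2 ≤ D.ηw s * x ^ 2 + D.ηo s * y ^ 2 := by
    intro s hs hcmp
    refine mul_sq_le_of_abs_mul_le (hD.ηw_nonneg s hs) (hD.ηo_nonneg s hs) hD.ηs_pos
      (hD.ηs_le s hs) ?_
    rw [← tot s hs, abs_mul, abs_of_pos (hD.total_pos hs)]
    exact mul_le_mul_of_nonneg_right hcmp (hD.total_pos hs).le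
  rcases lt_or_ge 0 y with hy0 | hy0
  · have hx0 : 0 < x := hy0.trans_le hyx
    have e1 : upwindW si sj pwi pwj = si := by
      rw [upwindW, if_pos (by simp only [hx] at hx0; linarith)]
    have e2 : upwindO si sj poi poj = si := by
      rw [upwindO, if_pos (by simp only [hy] at hy0; linarith)]
    rw [e1, e2]
    refine cs si hi ?_
    have hf := hD.fw_monotoneOn hξ' hi hξ.2
    have h0 := hD.fw_nonneg hξ'
    rw [conv, conv]
    refine abs_le_abs_of_nonneg ?_ ?_ <;> nlinarith
  rcases lt_or_ge x 0 with hx0 | hx0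
  · have hy1 : y < 0 := hyx.trans_lt hx0
    have e1 : upwindW si sj pwi pwj = sj := by
      rw [upwindW, if_neg (by simp only [hx] at hx0; linarith),
        if_pos (by simp only [hx] at hx0; linarith)]
    have e2 : upwindO si sj poi poj = sj := by
      rw [upwindO, if_neg (by simp only [hy] at hy1; linarith),
        if_pos (by simp only [hy] at hy1; linarith)]
    rw [e1, e2]
    refine cs sj hj ?_
    have hf := hD.fw_monotoneOn hj hξ' hξ.1
    have h1 := hD.fw_le_one hξ'
    rw [conv, conv, abs_of_nonpos (by nlinarith), abs_of_nonpos (by nlinarith)]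
    nlinarith
  · refine (cs ξ hξ' le_rfl).trans (add_le_add ?_ ?_)
    -- For equal pressures the mobility multiplies zero, so the tie-breaking rule does not matter.
    · rcases hx0.eq_or_lt with h0 | h0
      · rw [← h0]; simp
      · rw [upwindW, if_pos (by simp only [hx] at h0; linarith)]
        exact mul_le_mul_of_nonneg_right (hD.ηw_mono hξ' hi hξ.2) (sq_nonneg _)
    · rcases hy0.eq_or_lt with h0 | h0
      · rw [h0]; simp
      · rw [upwindO, if_neg (by simp only [hy] at h0; linarith),
          if_pos (by simp only [hy] at h0; linarith)]
        exact mul_le_mul_of_nonneg_right (hD.ηo_anti hj hξ' hξ.1) (sq_nonneg _)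

/-- The increment of the auxiliary pressure along an edge is controlled by the upwinded increments
of the two phase pressures. -/
theorem auxiliary_increment_le {si sj pwi pwj poi poj : ℝ} (hi : si ∈ Set.Icc (0 : ℝ) 1)
    (hj : sj ∈ Set.Icc (0 : ℝ) 1) (ci : poi - pwi = D.pc si) (cj : poj - pwj = D.pc sj) :
    D.ηs * ((pwi + D.pwg si) - (pwj + D.pwg sj)) ^ 2 ≤
      D.ηw (upwindW si sj pwi pwj) * (pwi - pwj) ^ 2
        + D.ηo (upwindO si sj poi poj) * (poi - poj) ^ 2 := by
  rcases le_total sj si with h | h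
  · exact hD.edge_of_le hi hj h ci cj
  · have := hD.edge_of_le hj hi h cj ci
    rw [upwindW_symm, upwindO_symm, sub_sq_comm pwi, sub_sq_comm poi, sub_sq_comm (pwi + _)]
    exact this

end Admissible

end FlowData

/-! ### Geometry of simplicial meshes -/

theorem isCompact_cell {d : ℕ} (K : Finset (Space d)) : IsCompact (cell K) :=
  K.finite_toSet.isCompact_convexHull (𝕜 := ℝ)

theorem convex_cell {d : ℕ} (K : Finset (Space d)) : Convex ℝ (cell K) := convex_convexHull ℝ _

theorem measurableSet_cell {d : ℕ} (K : Finset (Space d)) : MeasurableSet (cell K) :=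
  (isCompact_cell K).measurableSet

theorem volume_cell_ne_top {d : ℕ} (K : Finset (Space d)) : volume (cell K) ≠ ⊤ :=
  (isCompact_cell K).measure_lt_top.ne

theorem mem_cell_of_mem {d : ℕ} {K : Finset (Space d)} {v : Space d} (hv : v ∈ K) : v ∈ cell K :=
  subset_convexHull ℝ _ hv

namespace SimplicialMesh

variable {d : ℕ} (T : SimplicialMesh d)

theorem mem_nodes {K : Finset (Space d)} (hK : K ∈ T.elems) {v : Space d} (hv : v ∈ K) :
    v ∈ T.nodes := by
  classical
  exact Finset.mem_biUnion.2 ⟨K, hK, hv⟩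

@[simp]
theorem elemBasis_apply {K : Finset (Space d)} (hK : K ∈ T.elems) (v : K) :
    T.elemBasis hK v = v := rfl

theorem range_elemBasis {K : Finset (Space d)} (hK : K ∈ T.elems) :
    Set.range (T.elemBasis hK) = (K : Set (Space d)) := by
  ext x
  constructor
  · rintro ⟨v, rfl⟩; exact v.2
  · intro hx; exact ⟨⟨x, hx⟩, rfl⟩

theorem bary_of_mem {K : Finset (Space d)} (hK : K ∈ T.elems) (v : K) (x : Space d) :
    T.bary K v x = (T.elemBasis hK).coord v x := by
  rw [bary, dif_pos ⟨hK, v.2⟩]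

theorem bary_of_notMem {K : Finset (Space d)} {v : Space d} (hv : v ∉ K) (x : Space d) :
    T.bary K v x = 0 := by
  rw [bary, dif_neg fun h => hv h.2]

theorem cell_eq {K : Finset (Space d)} (hK : K ∈ T.elems) :
    cell K = {x | ∀ v : K, 0 ≤ T.bary K v x} := by
  rw [cell, ← T.range_elemBasis hK, AffineBasis.convexHull_eq_nonneg_coord]
  simp_rw [T.bary_of_mem hK]

theorem interior_cell_eq {K : Finset (Space d)} (hK : K ∈ T.elems) :
    interior (cell K) = {x | ∀ v : K, 0 < T.bary K v x} := by
  rw [cell, ← T.range_elemBasis hK, AffineBasis.interior_convexHull]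
  simp_rw [T.bary_of_mem hK]

theorem sum_bary {K : Finset (Space d)} (hK : K ∈ T.elems) (x : Space d) :
    ∑ v : K, T.bary K v x = 1 := by
  simp_rw [T.bary_of_mem hK]
  exact (T.elemBasis hK).sum_coord_apply_eq_one x

theorem sum_bary_smul {K : Finset (Space d)} (hK : K ∈ T.elems) (x : Space d) :
    ∑ v : K, T.bary K v x • (v : Space d) = x := by
  simp_rw [T.bary_of_mem hK]
  exact (T.elemBasis hK).linear_combination_coord_eq_self x

open Classical in
theorem bary_vertex {K : Finset (Space d)} (hK : K ∈ T.elems) (v w : K) :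
    T.bary K v w = if v = w then 1 else 0 := by
  rw [T.bary_of_mem hK, ← T.elemBasis_apply hK w, AffineBasis.coord_apply]

/-- The barycentric coordinates of a convex combination of some of the vertices vanish at the other
vertices. -/
theorem bary_eq_zero_of_mem_convexHull {K : Finset (Space d)} (hK : K ∈ T.elems)
    {s : Set (Space d)} (hs : s ⊆ K) {x : Space d} (hx : x ∈ convexHull ℝ s) (v : Space d)
    (hv : v ∉ s) : T.bary K v x = 0 := by
  by_cases hvK : v ∈ K
  · have hconv : convexHull ℝ s ⊆ {y | T.bary K v y = 0} := by
      refine convexHull_min (fun w hw => ?_) ?_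
      · have := T.bary_vertex hK ⟨v, hvK⟩ ⟨w, hs hw⟩
        simp only [Set.mem_ofPred_eq]
        rw [this, if_neg]
        intro h
        exact hv ((Subtype.mk.injEq _ _ _ _ ▸ h : v = w) ▸ hw)
      · have : {y | T.bary K v y = 0} = (T.elemBasis hK).coord ⟨v, hvK⟩ ⁻¹' {0} := by
          ext y
          simp only [Set.mem_ofPred_eq, Set.mem_preimage, Set.mem_singleton_iff]
          rw [← T.bary_of_mem hK ⟨v, hvK⟩]
        rw [this]
        exact (convex_singleton (0 : ℝ)).affine_preimage _
    exact hconv hx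
  · exact T.bary_of_notMem hvK x

/-- Two elements that contain a point have the same barycentric coordinates there. -/
theorem bary_congr {K L : Finset (Space d)} (hK : K ∈ T.elems) (hL : L ∈ T.elems) {x : Space d}
    (hxK : x ∈ cell K) (hxL : x ∈ cell L) (v : Space d) : T.bary K v x = T.bary L v x := by
  classical
  have hx : x ∈ convexHull ℝ ((K : Set (Space d)) ∩ L) := by
    rw [← T.conforming K hK L hL]; exact ⟨hxK, hxL⟩
  have zK : ∀ w, w ∉ (K : Set (Space d)) ∩ L → T.bary K w x = 0 := fun w hw =>
    T.bary_eq_zero_of_mem_convexHull hK Set.inter_subset_left hx w hw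
  have zL : ∀ w, w ∉ (K : Set (Space d)) ∩ L → T.bary L w x = 0 := fun w hw =>
    T.bary_eq_zero_of_mem_convexHull hL Set.inter_subset_right hx w hw
  -- both families are affine coordinates with respect to the basis `K`
  have key : ∀ w : K, (T.elemBasis hK).coord w x = T.bary L w x := by
    have e1 : ∑ w : K, T.bary L w x = 1 := by
      rw [← T.sum_bary hL x, Finset.sum_coe_sort K fun w => T.bary L w x,
        Finset.sum_coe_sort L fun w => T.bary L w x,
        ← Finset.sum_subset (s₁ := K ∩ L) Finset.inter_subset_left,
        ← Finset.sum_subset (s₁ := K ∩ L) Finset.inter_subset_right]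
      · intro w _ hw; exact zL w (by simpa using hw)
      · intro w _ hw; exact zL w (by simpa using hw)
    have e2 : ∑ w : K, T.bary L w x • (w : Space d) = x := by
      conv_rhs => rw [← T.sum_bary_smul hL x]
      rw [Finset.sum_coe_sort K fun w => T.bary L w x • w,
        Finset.sum_coe_sort L fun w => T.bary L w x • w,
        ← Finset.sum_subset (s₁ := K ∩ L) Finset.inter_subset_left,
        ← Finset.sum_subset (s₁ := K ∩ L) Finset.inter_subset_right]
      · intro w _ hw; rw [zL w (by simpa using hw), zero_smul]
      · intro w _ hw; rw [zL w (by simpa using hw), zero_smul]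
    intro w
    have h := (T.elemBasis hK).coord_apply_combination_of_mem (Finset.mem_univ w) e1
    rw [Finset.univ.affineCombination_eq_linear_combination _ _ e1] at h
    simp only [elemBasis_apply] at h
    rw [e2] at h
    exact h
  by_cases hv : v ∈ K
  · rw [T.bary_of_mem hK ⟨v, hv⟩, key ⟨v, hv⟩]
  · rw [T.bary_of_notMem hv, zL v fun h => hv h.1]

theorem hat_eq_bary {K : Finset (Space d)} (hK : K ∈ T.elems) {x : Space d} (hx : x ∈ cell K)
    (i : T.Node) : T.hat i x = T.bary K i x := by
  have h : ∃ K ∈ T.elems, x ∈ cell K := ⟨K, hK, hx⟩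
  rw [hat, dif_pos h]
  exact T.bary_congr h.choose_spec.1 hK h.choose_spec.2 hx i

/-- The gradient of a barycentric coordinate. -/
def baryGrad (K : Finset (Space d)) (v : Space d) : Space d := gradient (T.bary K v) 0

theorem exists_bary_affine (K : Finset (Space d)) (v : Space d) :
    ∃ (ℓ : Space d →L[ℝ] ℝ) (c : ℝ), ∀ x, T.bary K v x = ℓ x + c := by
  by_cases h : K ∈ T.elems ∧ v ∈ K
  · let f := (T.elemBasis h.1).coord ⟨v, h.2⟩
    refine ⟨LinearMap.toContinuousLinearMap f.linear, f 0, fun x => ?_⟩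
    rw [bary, dif_pos h]
    simpa using congrFun f.decomp x
  · refine ⟨0, 0, fun x => ?_⟩
    rw [bary, dif_neg h]; simp

theorem hasGradientAt_bary (K : Finset (Space d)) (v x : Space d) :
    HasGradientAt (T.bary K v) (T.baryGrad K v) x := by
  obtain ⟨ℓ, c, h⟩ := T.exists_bary_affine K v
  have hf : T.bary K v = fun x => ℓ x + c := funext h
  have hg : ∀ y, HasGradientAt (T.bary K v) ((InnerProductSpace.toDual ℝ (Space d)).symm ℓ) y := by
    intro y
    rw [hf]
    exact (ℓ.hasFDerivAt.add_const c).hasGradientAt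
  rw [baryGrad, (hg 0).gradient]
  exact hg x

theorem gradient_bary (K : Finset (Space d)) (v x : Space d) :
    gradient (T.bary K v) x = T.baryGrad K v :=
  (T.hasGradientAt_bary K v x).gradient

theorem bary_sub (K : Finset (Space d)) (v x y : Space d) :
    T.bary K v y - T.bary K v x = ⟪T.baryGrad K v, y - x⟫_ℝ := by
  obtain ⟨ℓ, c, h⟩ := T.exists_bary_affine K v
  have hf : T.bary K v = fun x => ℓ x + c := funext h
  have hg : HasGradientAt (T.bary K v) ((InnerProductSpace.toDual ℝ (Space d)).symm ℓ) 0 := by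
    rw [hf]
    exact (ℓ.hasFDerivAt.add_const c).hasGradientAt
  rw [baryGrad, hg.gradient, InnerProductSpace.toDual_symm_apply, h, h, map_sub]
  ring

theorem baryGrad_of_notMem {K : Finset (Space d)} {v : Space d} (hv : v ∉ K) :
    T.baryGrad K v = 0 := by
  refine ext_inner_right ℝ fun x => ?_
  have := T.bary_sub K v 0 x
  rw [T.bary_of_notMem hv, T.bary_of_notMem hv, sub_zero, sub_zero] at this
  rw [← this, inner_zero_left]

theorem continuous_bary (K : Finset (Space d)) (v : Space d) : Continuous (T.bary K v) := by
  obtain ⟨ℓ, c, h⟩ := T.exists_bary_affine K v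
  rw [funext h]
  exact ℓ.continuous.add continuous_const

/-- A sum over the nodes of quantities that vanish away from `K` is a sum over the vertices. -/
theorem sum_node_eq {M : Type*} [AddCommMonoid M] {K : Finset (Space d)} (hK : K ∈ T.elems)
    (f : T.Node → M) (hf : ∀ i : T.Node, (i : Space d) ∉ K → f i = 0) :
    ∑ i, f i = ∑ v : K, f ⟨v, T.mem_nodes hK v.2⟩ := by
  classical
  refine (Finset.sum_of_injOn (fun v : K => (⟨v, T.mem_nodes hK v.2⟩ : T.Node)) ?_ ?_ ?_ ?_).symm
  · intro v _ w _ h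
    exact Subtype.ext (congrArg (fun i : T.Node => (i : Space d)) h)
  · intro v _; simp
  · intro i _ hi
    refine hf i fun h => hi ⟨⟨i, h⟩, by simp, rfl⟩
  · intro v _; rfl

theorem sum_node_bary {K : Finset (Space d)} (hK : K ∈ T.elems) (x : Space d) :
    ∑ i : T.Node, T.bary K i x = 1 := by
  rw [T.sum_node_eq hK _ fun i hi => T.bary_of_notMem hi x]
  exact T.sum_bary hK x

theorem sum_node_baryGrad {K : Finset (Space d)} (hK : K ∈ T.elems) :
    ∑ i : T.Node, T.baryGrad K i = 0 := by
  refine ext_inner_right ℝ fun x => ?_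
  rw [sum_inner, inner_zero_left]
  have : ∀ i : T.Node, ⟪T.baryGrad K i, x⟫_ℝ = T.bary K i x - T.bary K i 0 := fun i => by
    rw [T.bary_sub, sub_zero]
  simp_rw [this]
  rw [Finset.sum_sub_distrib, T.sum_node_bary hK, T.sum_node_bary hK, sub_self]

/-! #### Null sets -/

theorem interior_cell_nonempty {K : Finset (Space d)} (hK : K ∈ T.elems) :
    (interior (cell K)).Nonempty := by
  rw [cell, interior_convexHull_nonempty_iff_affineSpan_eq_top, ← T.range_elemBasis hK]
  exact (T.elemBasis hK).tot

theorem volume_cell_pos {K : Finset (Space d)} (hK : K ∈ T.elems) : 0 < volume (cell K) :=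
  (isOpen_interior.measure_pos volume (T.interior_cell_nonempty hK)).trans_le
    (measure_mono interior_subset)

theorem volume_real_cell_pos {K : Finset (Space d)} (hK : K ∈ T.elems) :
    0 < volume.real (cell K) :=
  ENNReal.toReal_pos (T.volume_cell_pos hK).ne' (volume_cell_ne_top K)

theorem volume_frontier_cell (K : Finset (Space d)) : volume (frontier (cell K)) = 0 :=
  (convex_cell K).addHaar_frontier volume

theorem interior_cell_ae_eq (K : Finset (Space d)) : interior (cell K) =ᵐ[volume] cell K :=
  interior_ae_eq_of_null_frontier (volume_frontier_cell K)

/-- Distinct elements have equally many vertices, so some vertex of `K` is not in `L`. By conformity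
its barycentric coordinate vanishes on the intersection, which therefore lies in the frontier of the
convex set `cell K`, a null set. -/
theorem aedisjoint_cell {K L : Finset (Space d)} (hK : K ∈ T.elems) (hL : L ∈ T.elems)
    (h : K ≠ L) : AEDisjoint volume (cell K) (cell L) := by
  have hne : ∃ v ∈ K, v ∉ L := by
    by_contra! hcon
    exact h (Finset.eq_of_subset_of_card_le hcon (by rw [T.card_elem K hK, T.card_elem L hL]))
  obtain ⟨v, hvK, hvL⟩ := hne
  have hsub : cell K ∩ cell L ⊆ frontier (cell K) := by
    rintro x ⟨hxK, hxL⟩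
    rw [(isCompact_cell K).isClosed.frontier_eq]
    refine ⟨hxK, fun hint => ?_⟩
    rw [T.interior_cell_eq hK] at hint
    have := hint ⟨v, hvK⟩
    rw [T.bary_congr hK hL hxK hxL, T.bary_of_notMem hvL] at this
    exact this.false
  exact measure_mono_null hsub (volume_frontier_cell K)

theorem restrict_biUnion_cell {E : Finset (Finset (Space d))} (hE : E ⊆ T.elems) :
    volume.restrict (⋃ K ∈ E, cell K) = ∑ K ∈ E, volume.restrict (cell K) := by
  have h := Measure.restrict_iUnion_ae (μ := (volume : Measure (Space d)))
    (s := fun K : E => cell (K : Finset (Space d)))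
    (fun K L hKL => T.aedisjoint_cell (hE K.2) (hE L.2) fun h => hKL (Subtype.ext h))
    (fun K => (measurableSet_cell _).nullMeasurableSet)
  rw [Measure.sum_fintype, Finset.sum_coe_sort E fun K => volume.restrict (cell K)] at h
  rw [← h, Set.iUnion_subtype]

end SimplicialMesh

namespace SimplicialMesh

variable {d : ℕ} (T : SimplicialMesh d)

/-! #### Integrals of barycentric coordinates -/

/-- An affine involution of Euclidean space preserves the volume. -/
theorem measurePreserving_of_involutive (A : Space d →ₗ[ℝ] Space d) (c : Space d)
    (h : ∀ x, A (A x) = x) : MeasurePreserving (fun x => A x + c) volume volume := by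
  have hdet : |LinearMap.det A| = 1 := by
    have h1 : A * A = 1 := LinearMap.ext h
    have h2 : LinearMap.det A * LinearMap.det A = 1 := by
      rw [← map_mul, h1, map_one]
    have h3 : |LinearMap.det A| * |LinearMap.det A| = 1 := by rw [← abs_mul, h2, abs_one]
    nlinarith [abs_nonneg (LinearMap.det A)]
  have hne : LinearMap.det A ≠ 0 := fun h0 => by simp [h0] at hdet
  have hA : MeasurePreserving A volume volume := by
    refine ⟨(LinearMap.continuous_of_finiteDimensional A).measurable, ?_⟩
    rw [Measure.map_linearMap_addHaar_eq_smul_addHaar _ hne, abs_inv, hdet]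
    simp
  exact (measurePreserving_add_right volume c).comp hA

/-- The affine map that exchanges `v` and `w` and fixes the other vertices is a volume-preserving
involution of the cell which exchanges the two coordinates. -/
theorem integral_bary_swap {K : Finset (Space d)} (hK : K ∈ T.elems) (v w : K) :
    ∫ x in cell K, T.bary K v x = ∫ x in cell K, T.bary K w x := by
  classical
  by_cases hvw : v = w
  · rw [hvw]
  set g := T.baryGrad K v - T.baryGrad K w with hg
  set e : Space d := (w : Space d) - v with he
  have inner_e : ∀ u : K, ⟪T.baryGrad K u, e⟫_ℝ = (if u = w then 1 else 0) - if u = v then 1 else 0 := by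
    intro u
    rw [he, ← T.bary_sub, T.bary_vertex hK, T.bary_vertex hK]
  have hge : ⟪g, e⟫_ℝ = -2 := by
    rw [hg, inner_sub_left, inner_e, inner_e]
    simp [hvw, Ne.symm hvw]; norm_num
  -- The linear part of the exchange. It is an oblique reflection because `⟪g, e⟫ = -2`; the
  -- translation `c` restores the constant terms of the coordinates.
  let A : Space d →ₗ[ℝ] Space d := LinearMap.id + (innerₛₗ ℝ g).smulRight e
  have hA : ∀ x, A x = x + ⟪g, x⟫_ℝ • e := fun x => rfl
  have hAA : ∀ x, A (A x) = x := by
    intro x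
    rw [hA, hA, inner_add_right, inner_smul_right, hge]
    module
  let c : Space d := (T.bary K v 0 - T.bary K w 0) • e
  have hf : ∀ x, A x + c = x + (T.bary K v x - T.bary K w x) • e := by
    intro x
    have h1 := T.bary_sub K v 0 x
    have h2 := T.bary_sub K w 0 x
    rw [sub_zero] at h1 h2
    rw [hA, hg, inner_sub_left, ← h1, ← h2]
    simp only [c]
    module
  have hmp : MeasurePreserving (fun x => A x + c) volume volume :=
    measurePreserving_of_involutive A c hAA
  have hb : ∀ (u : K) x, T.bary K u (A x + c) = T.bary K u x +
      (T.bary K v x - T.bary K w x) * ((if u = w then 1 else 0) - if u = v then 1 else 0) := by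
    intro u x
    have := T.bary_sub K u x (A x + c)
    rw [hf, add_sub_cancel_left, inner_smul_right, inner_e] at this
    rw [hf]
    linarith
  have hpre : (fun x => A x + c) ⁻¹' cell K = cell K := by
    ext x
    rw [Set.mem_preimage, T.cell_eq hK, Set.mem_ofPred_eq, Set.mem_ofPred_eq]
    simp_rw [hb]
    constructor
    · intro h u
      by_cases hu : u = v
      · have := h w; rw [hu]; simpa [hvw, Ne.symm hvw] using this
      · by_cases hu' : u = w
        · have := h v; rw [hu']; simpa [hvw, Ne.symm hvw] using this
        · simpa [hu, hu'] using h u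
    · intro h u
      by_cases hu : u = v
      · have := h w; rw [hu]; simpa [hvw, Ne.symm hvw] using this
      · by_cases hu' : u = w
        · have := h v; rw [hu']; simpa [hvw, Ne.symm hvw] using this
        · simpa [hu, hu'] using h u
  have hme : MeasurableEmbedding fun x => A x + c := by
    have hinv : ∀ x, A (A x + c) + c = x := by
      intro x
      rw [hf, hb, hb, hf]
      simp only [hvw, Ne.symm hvw, if_true, if_false]
      module
    have hm : Measurable fun x => A x + c := hmp.measurable
    exact (MeasurableEquiv.mk ⟨fun x => A x + c, fun x => A x + c, hinv, hinv⟩ hm hm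
      ).measurableEmbedding
  have := hmp.setIntegral_preimage_emb hme (T.bary K v) (cell K)
  rw [hpre] at this
  rw [← this]
  refine setIntegral_congr_fun (measurableSet_cell K) fun x _ => ?_
  simp only [hb, hvw, if_true, if_false]
  ring

theorem integrableOn_bary (K L : Finset (Space d)) (v : Space d) :
    IntegrableOn (T.bary K v) (cell L) :=
  (T.continuous_bary K v).continuousOn.integrableOn_compact (isCompact_cell L)

theorem integral_bary {K : Finset (Space d)} (hK : K ∈ T.elems) (v : K) :
    ∫ x in cell K, T.bary K v x = volume.real (cell K) / (d + 1) := by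
  have h : ∑ w : K, ∫ x in cell K, T.bary K w x = volume.real (cell K) := by
    rw [← integral_finsetSum Finset.univ fun (w : K) _ => T.integrableOn_bary K K w]
    simp_rw [T.sum_bary hK]
    simp
  simp_rw [fun w => T.integral_bary_swap hK w v] at h
  rw [Finset.sum_const, Finset.card_univ, Fintype.card_coe, T.card_elem K hK, nsmul_eq_mul] at h
  push_cast at h
  rw [eq_div_iff (by positivity)]
  linarith

/-! #### Decomposition of the domain -/

theorem cell_subset_closure {Ω : Set (Space d)} (hT : T.Triangulates Ω) {K : Finset (Space d)}
    (hK : K ∈ T.elems) : cell K ⊆ closure Ω := by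
  rw [← show _ = _ from hT]
  exact Set.subset_biUnion_of_mem (u := fun K => cell K) hK

theorem interior_cell_subset {Ω : Set (Space d)} (hT : T.Triangulates Ω)
    (hΩ : interior (closure Ω) = Ω) {K : Finset (Space d)} (hK : K ∈ T.elems) :
    interior (cell K) ⊆ Ω := by
  rw [← hΩ]
  exact interior_mono (T.cell_subset_closure hT hK)

/-- Interiors of cells lie in `interior (closure Ω) = Ω`, so the part of the closure outside `Ω` is
covered by the finitely many null frontiers of cells. -/
theorem ae_eq_closure {Ω : Set (Space d)} (hT : T.Triangulates Ω)
    (hΩ : interior (closure Ω) = Ω) : Ω =ᵐ[volume] closure Ω := by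
  refine (subset_closure.eventuallyLE).antisymm ?_
  rw [ae_le_set]
  refine measure_mono_null (t := ⋃ K ∈ T.elems, frontier (cell K)) ?_ ?_
  · rintro x ⟨hx, hxΩ⟩
    rw [← show _ = _ from hT] at hx
    obtain ⟨K, hK, hxK⟩ := Set.mem_iUnion₂.1 hx
    refine Set.mem_iUnion₂.2 ⟨K, hK, ?_⟩
    rw [(isCompact_cell K).isClosed.frontier_eq]
    exact ⟨hxK, fun h => hxΩ (T.interior_cell_subset hT hΩ hK h)⟩
  · exact (measure_biUnion_null_iff T.elems.countable_toSet).2 fun K _ => volume_frontier_cell K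

/-- Lebesgue measure on the domain is the sum of its restrictions to the elements. -/
theorem restrict_domain {Ω : Set (Space d)} (hT : T.Triangulates Ω)
    (hΩ : interior (closure Ω) = Ω) :
    volume.restrict Ω = ∑ K ∈ T.elems, volume.restrict (cell K) := by
  rw [Measure.restrict_congr_set (T.ae_eq_closure hT hΩ), ← show _ = _ from hT,
    T.restrict_biUnion_cell subset_rfl]

open Classical in
theorem patch_eq (i : T.Node) :
    T.patch i = ⋃ K ∈ T.elems.filter fun K => (i : Space d) ∈ K, cell K := by
  simp only [patch, Finset.mem_filter, Set.mem_ofPred_eq]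

open Classical in
theorem restrict_patch (i : T.Node) : volume.restrict (T.patch i) =
    ∑ K ∈ T.elems with (i : Space d) ∈ K, volume.restrict (cell K) := by
  rw [patch_eq, T.restrict_biUnion_cell (Finset.filter_subset _ _)]

theorem isCompact_patch (i : T.Node) : IsCompact (T.patch i) := by
  classical
  rw [patch_eq]
  exact Finset.isCompact_biUnion _ fun K _ => isCompact_cell K

theorem measurableSet_patch (i : T.Node) : MeasurableSet (T.patch i) :=
  (T.isCompact_patch i).measurableSet

theorem cell_subset_patch {K : Finset (Space d)} (hK : K ∈ T.elems) (i : T.Node)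
    (hi : (i : Space d) ∈ K) : cell K ⊆ T.patch i :=
  Set.subset_biUnion_of_mem (u := fun K => cell K) (show K ∈ {K | K ∈ T.elems ∧ (i : Space d) ∈ K} from ⟨hK, hi⟩)

theorem patch_subset_closure {Ω : Set (Space d)} (hT : T.Triangulates Ω) (i : T.Node) :
    T.patch i ⊆ closure Ω :=
  Set.iUnion₂_subset fun _ hK => T.cell_subset_closure hT hK.1

theorem exists_elem (i : T.Node) : ∃ K ∈ T.elems, (i : Space d) ∈ K := by
  classical
  simpa [nodes] using i.2

theorem volume_real_patch_pos (i : T.Node) : 0 < volume.real (T.patch i) := by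
  obtain ⟨K, hK, hi⟩ := T.exists_elem i
  exact (T.volume_real_cell_pos hK).trans_le
    (measureReal_mono (T.cell_subset_patch hK i hi) (T.isCompact_patch i).measure_lt_top.ne)

theorem mass_pos (i : T.Node) : 0 < T.mass i :=
  div_pos (T.volume_real_patch_pos i) (by positivity)

open Classical in
/-- Exchange of a sum over the elements that share a node with a sum over the vertices of an
element. -/
theorem sum_node_sum_elem {M : Type*} [AddCommMonoid M] (f : T.Node → Finset (Space d) → M) :
    ∑ i : T.Node, ∑ K ∈ T.elems with (i : Space d) ∈ K, f i K =
      ∑ K ∈ T.elems, ∑ i : T.Node, if (i : Space d) ∈ K then f i K else 0 := by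
  simp_rw [Finset.sum_filter]
  exact Finset.sum_comm

open Classical in
theorem sum_node_const {M : Type*} [AddCommMonoid M] {K : Finset (Space d)} (hK : K ∈ T.elems)
    (a : M) : ∑ i : T.Node, (if (i : Space d) ∈ K then a else 0) = (d + 1) • a := by
  rw [T.sum_node_eq hK _ fun i hi => if_neg hi]
  simp [T.card_elem K hK]

/-- Every element belongs to the patches of exactly its `d + 1` vertices. This is the source of the
factor `d + 1` in all sums over patches. -/
theorem sum_restrict_patch {Ω : Set (Space d)} (hT : T.Triangulates Ω)
    (hΩ : interior (closure Ω) = Ω) :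
    ∑ i, volume.restrict (T.patch i) = (d + 1) • volume.restrict Ω := by
  classical
  simp_rw [restrict_patch]
  rw [sum_node_sum_elem, T.restrict_domain hT hΩ, Finset.smul_sum]
  exact Finset.sum_congr rfl fun K hK => T.sum_node_const hK _

theorem restrict_patch_le {Ω : Set (Space d)} (hT : T.Triangulates Ω)
    (hΩ : interior (closure Ω) = Ω) (i : T.Node) :
    volume.restrict (T.patch i) ≤ volume.restrict Ω := by
  rw [Measure.restrict_congr_set (T.ae_eq_closure hT hΩ)]
  exact Measure.restrict_mono (T.patch_subset_closure hT i) le_rfl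

theorem sum_integral_patch {Ω : Set (Space d)} (hT : T.Triangulates Ω)
    (hΩ : interior (closure Ω) = Ω) {g : Space d → ℝ} (hg : IntegrableOn g Ω) :
    ∑ i, ∫ x in T.patch i, g x = (d + 1) * ∫ x in Ω, g x := by
  have h := integral_finsetSum_measure (s := Finset.univ) (f := g)
    (μ := fun i => volume.restrict (T.patch i))
    fun i _ => Integrable.mono_measure hg (T.restrict_patch_le hT hΩ i)
  rw [← h, T.sum_restrict_patch hT hΩ, ← Nat.cast_smul_eq_nsmul NNReal,
    integral_smul_nnreal_measure, NNReal.smul_def]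
  simp

theorem integral_domain {Ω : Set (Space d)} (hT : T.Triangulates Ω)
    (hΩ : interior (closure Ω) = Ω) {g : Space d → ℝ}
    (hg : ∀ K ∈ T.elems, IntegrableOn g (cell K)) :
    ∫ x in Ω, g x = ∑ K ∈ T.elems, ∫ x in cell K, g x := by
  rw [T.restrict_domain hT hΩ, integral_finsetSum_measure hg]

theorem integrableOn_domain {Ω : Set (Space d)} (hT : T.Triangulates Ω)
    (hΩ : interior (closure Ω) = Ω) {g : Space d → ℝ}
    (hg : ∀ K ∈ T.elems, IntegrableOn g (cell K)) : IntegrableOn g Ω := by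
  rw [IntegrableOn, T.restrict_domain hT hΩ, integrable_finsetSum_measure]
  exact hg

open Classical in
theorem mass_eq (i : T.Node) :
    T.mass i = ∑ K ∈ T.elems with (i : Space d) ∈ K, volume.real (cell K) / (d + 1) := by
  have h : volume.real (T.patch i) = ∑ K ∈ T.elems with (i : Space d) ∈ K, volume.real (cell K) := by
    have := congrArg (fun μ : Measure (Space d) => μ Set.univ) (T.restrict_patch i)
    simp only [Measure.restrict_apply_univ, Measure.finsetSum_apply] at this
    rw [Measure.real, this, ENNReal.toReal_sum fun K _ => volume_cell_ne_top K]
    rfl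
  rw [mass, h, Finset.sum_div]

open Classical in
/-- Mass lumping is the sum of the vertex quadrature rules. -/
theorem sum_mass_mul (F : T.Node → ℝ) : ∑ i, T.mass i * F i =
    ∑ K ∈ T.elems, volume.real (cell K) / (d + 1) *
      ∑ i : T.Node, if (i : Space d) ∈ K then F i else 0 := by
  simp_rw [mass_eq, Finset.sum_mul, sum_node_sum_elem, Finset.mul_sum]
  refine Finset.sum_congr rfl fun K _ => Finset.sum_congr rfl fun i _ => ?_
  split_ifs <;> simp

theorem volume_real_domain {Ω : Set (Space d)} (hT : T.Triangulates Ω)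
    (hΩ : interior (closure Ω) = Ω) : volume.real Ω = ∑ K ∈ T.elems, volume.real (cell K) := by
  have := congrArg (fun μ : Measure (Space d) => μ Set.univ) (T.restrict_domain hT hΩ)
  simp only [Measure.restrict_apply_univ, Measure.finsetSum_apply] at this
  rw [Measure.real, this, ENNReal.toReal_sum fun K _ => volume_cell_ne_top K]
  rfl

theorem sum_mass {Ω : Set (Space d)} (hT : T.Triangulates Ω)
    (hΩ : interior (closure Ω) = Ω) : ∑ i, T.mass i = volume.real Ω := by
  classical
  have h := T.sum_mass_mul fun _ => 1
  simp only [mul_one] at h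
  rw [h, T.volume_real_domain hT hΩ]
  refine Finset.sum_congr rfl fun K hK => ?_
  rw [T.sum_node_const hK]
  simp only [nsmul_eq_mul, mul_one]
  push_cast
  field_simp

/-! #### Piecewise affine functions -/

theorem lagrange_eq (U : T.Node → ℝ) {K : Finset (Space d)} (hK : K ∈ T.elems) {x : Space d}
    (hx : x ∈ cell K) : T.lagrange U x = ∑ i, U i * T.bary K i x :=
  Finset.sum_congr rfl fun i _ => by rw [T.hat_eq_bary hK hx]

theorem integrableOn_lagrange_cell (U : T.Node → ℝ) {K : Finset (Space d)} (hK : K ∈ T.elems) :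
    IntegrableOn (T.lagrange U) (cell K) := by
  refine IntegrableOn.congr_fun (f := fun x => ∑ i, U i * T.bary K i x) ?_
    (fun x hx => (T.lagrange_eq U hK hx).symm) (measurableSet_cell K)
  exact integrable_finsetSum _ fun i _ => (T.integrableOn_bary K K i).const_mul _

/-- The vertex quadrature rule is exact for affine functions, since every barycentric coordinate has
mean `1 / (d + 1)` on its cell. -/
theorem integral_lagrange {Ω : Set (Space d)} (hT : T.Triangulates Ω)
    (hΩ : interior (closure Ω) = Ω) (U : T.Node → ℝ) :
    ∫ x in Ω, T.lagrange U x = ∑ i, T.mass i * U i := by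
  classical
  rw [T.integral_domain hT hΩ fun K hK => T.integrableOn_lagrange_cell U hK, T.sum_mass_mul]
  refine Finset.sum_congr rfl fun K hK => ?_
  rw [setIntegral_congr_fun (measurableSet_cell K) fun x hx => T.lagrange_eq U hK hx,
    integral_finsetSum Finset.univ fun (i : T.Node) _ =>
      (T.integrableOn_bary K K i).const_mul (U i), Finset.mul_sum]
  refine Finset.sum_congr rfl fun i _ => ?_
  rw [integral_const_mul]
  split_ifs with hi
  · rw [T.integral_bary hK ⟨i, hi⟩, mul_comm]
  · simp_rw [T.bary_of_notMem hi]
    simp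

theorem gradient_hat {K : Finset (Space d)} (hK : K ∈ T.elems) {x : Space d}
    (hx : x ∈ interior (cell K)) (i : T.Node) : gradient (T.hat i) x = T.baryGrad K i := by
  refine ((T.hasGradientAt_bary K i x).congr_of_eventuallyEq ?_).gradient
  filter_upwards [isOpen_interior.mem_nhds hx] with y hy
  exact T.hat_eq_bary hK (interior_subset hy) i

/-- The gradient on the element `K` of the piecewise affine function with nodal values `U`. -/
def elemGrad (U : T.Node → ℝ) (K : Finset (Space d)) : Space d := ∑ i, U i • T.baryGrad K i

theorem lagrange_sub (U : T.Node → ℝ) {K : Finset (Space d)} (hK : K ∈ T.elems) {x y : Space d}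
    (hx : x ∈ cell K) (hy : y ∈ cell K) :
    T.lagrange U y - T.lagrange U x = ⟪T.elemGrad U K, y - x⟫_ℝ := by
  rw [T.lagrange_eq U hK hx, T.lagrange_eq U hK hy, ← Finset.sum_sub_distrib, elemGrad, sum_inner]
  refine Finset.sum_congr rfl fun i _ => ?_
  rw [inner_smul_left, ← T.bary_sub]
  simp [mul_sub]

theorem gradient_lagrange (U : T.Node → ℝ) {K : Finset (Space d)} (hK : K ∈ T.elems) {x : Space d}
    (hx : x ∈ interior (cell K)) : gradient (T.lagrange U) x = T.elemGrad U K := by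
  refine HasGradientAt.gradient ?_
  rw [hasGradientAt_iff_isLittleO]
  refine Asymptotics.IsLittleO.congr' (Asymptotics.isLittleO_zero _ _) ?_ Filter.EventuallyEq.rfl
  filter_upwards [isOpen_interior.mem_nhds hx] with y hy
  rw [← T.lagrange_sub U hK (interior_subset hx) (interior_subset hy), sub_self]

/-! #### The stiffness coefficients -/

theorem ae_mem_interior_cell (K : Finset (Space d)) :
    ∀ᵐ x ∂volume.restrict (cell K), x ∈ interior (cell K) := by
  rw [← Measure.restrict_congr_set (interior_cell_ae_eq K)]
  exact ae_restrict_mem isOpen_interior.measurableSet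

/-- The gradients of the hat functions are constant inside each cell. The sum may run over all
elements because a gradient vanishes on the cells that do not contain its node. -/
theorem stiff_eq (i j : T.Node) : T.stiff i j =
    ∑ K ∈ T.elems, volume.real (cell K) * |⟪T.baryGrad K i, T.baryGrad K j⟫_ℝ| := by
  set P := T.patch i ∩ T.patch j with hP
  set F : Space d → ℝ := fun x => |⟪gradient (T.hat i) x, gradient (T.hat j) x⟫_ℝ| with hF
  have hPm : MeasurableSet P := (T.measurableSet_patch i).inter (T.measurableSet_patch j)
  have hsub : P ⊆ ⋃ K ∈ T.elems, cell K := fun x hx => by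
    obtain ⟨K, hK, hxK⟩ := Set.mem_iUnion₂.1 hx.1
    exact Set.mem_iUnion₂.2 ⟨K, hK.1, hxK⟩
  have hμ : volume.restrict P = ∑ K ∈ T.elems, (volume.restrict (cell K)).restrict P := by
    rw [← Set.inter_eq_self_of_subset_left hsub, ← Measure.restrict_restrict hPm,
      T.restrict_biUnion_cell subset_rfl, Set.inter_eq_self_of_subset_left hsub]
    ext s hs
    simp [Measure.restrict_apply hs]
  have hae : ∀ K ∈ T.elems, F =ᵐ[(volume.restrict (cell K)).restrict P]
      fun _ => |⟪T.baryGrad K i, T.baryGrad K j⟫_ℝ| := by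
    intro K hK
    refine ae_restrict_of_ae ?_
    filter_upwards [ae_mem_interior_cell K] with x hx
    simp only [hF]
    rw [T.gradient_hat hK hx, T.gradient_hat hK hx]
  have hfin : ∀ K : Finset (Space d), IsFiniteMeasure (volume.restrict (cell K)) := fun K =>
    ⟨by rw [Measure.restrict_apply_univ]; exact (isCompact_cell K).measure_lt_top⟩
  rw [stiff, ← hP, hμ, integral_finsetSum_measure fun K hK =>
    (integrable_congr (hae K hK)).2 (integrable_const _)]
  refine Finset.sum_congr rfl fun K hK => ?_
  rw [integral_congr_ae (hae K hK), integral_const, smul_eq_mul]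
  by_cases h : (i : Space d) ∈ K ∧ (j : Space d) ∈ K
  · congr 1
    have : cell K ∩ P = cell K := Set.inter_eq_self_of_subset_left
      (Set.subset_inter (T.cell_subset_patch hK i h.1) (T.cell_subset_patch hK j h.2))
    rw [Measure.restrict_restrict hPm, Set.inter_comm, this]
    simp [Measure.real]
  · rcases not_and_or.1 h with h | h <;> rw [T.baryGrad_of_notMem h] <;> simp

theorem stiff_symm (i j : T.Node) : T.stiff i j = T.stiff j i := by
  simp_rw [stiff_eq, real_inner_comm]

theorem stiff_nonneg (i j : T.Node) : 0 ≤ T.stiff i j :=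
  integral_nonneg fun _ => abs_nonneg _

/-- The gradients are inward normals of facets and enclose the angle `π` minus the dihedral angle,
hence at least `π / 2`. -/
theorem inner_baryGrad_nonpos (hT : T.Nonobtuse) {K : Finset (Space d)} (hK : K ∈ T.elems)
    {i j : T.Node} (hij : i ≠ j) : ⟪T.baryGrad K i, T.baryGrad K j⟫_ℝ ≤ 0 := by
  by_cases hi : (i : Space d) ∈ K
  · by_cases hj : (j : Space d) ∈ K
    · have h := hT K hK i hi j hj fun h => hij (Subtype.ext h)
      rw [dihedralAngle, gradient_bary, gradient_bary] at h
      by_contra! hcon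
      have hlt : InnerProductGeometry.angle (T.baryGrad K i) (T.baryGrad K j) < Real.pi / 2 := by
        rw [InnerProductGeometry.angle, Real.arccos_lt_pi_div_two]
        refine div_pos hcon (mul_pos (norm_pos_iff.2 ?_) (norm_pos_iff.2 ?_)) <;>
          rintro h0 <;> simp [h0] at hcon
      linarith
    · rw [T.baryGrad_of_notMem hj, inner_zero_right]
  · rw [T.baryGrad_of_notMem hi, inner_zero_left]

/-- On a nonobtuse mesh the Dirichlet energy is a sum over the edges with the coefficients
`c_{ij}`. -/
theorem dirichlet_eq (hT : T.Nonobtuse) (U : T.Node → ℝ) :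
    ∑ K ∈ T.elems, volume.real (cell K) * ‖T.elemGrad U K‖ ^ 2 =
      (∑ i, ∑ j, T.stiff i j * (U i - U j) ^ 2) / 2 := by
  have hK : ∀ K ∈ T.elems, ‖T.elemGrad U K‖ ^ 2 =
      (∑ i : T.Node, ∑ j : T.Node, |⟪T.baryGrad K i, T.baryGrad K j⟫_ℝ| * (U i - U j) ^ 2) / 2 := by
    intro K hK
    -- Off the diagonal the modulus is minus the inner product; on the diagonal both sides vanish.
    -- The pure squares then drop out because the gradients sum to zero.
    have e1 : ∀ i j : T.Node, |⟪T.baryGrad K i, T.baryGrad K j⟫_ℝ| * (U i - U j) ^ 2 =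
        2 * (U i * (U j * ⟪T.baryGrad K i, T.baryGrad K j⟫_ℝ))
          - U i ^ 2 * ⟪T.baryGrad K i, T.baryGrad K j⟫_ℝ
          - U j ^ 2 * ⟪T.baryGrad K j, T.baryGrad K i⟫_ℝ := by
      intro i j
      rw [real_inner_comm (T.baryGrad K i) (T.baryGrad K j)]
      by_cases hij : i = j
      · rw [hij]; ring
      · rw [abs_of_nonpos (T.inner_baryGrad_nonpos hT hK hij)]; ring
    have e2 : ∀ i : T.Node, ∑ j : T.Node, ⟪T.baryGrad K i, T.baryGrad K j⟫_ℝ = 0 := by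
      intro i
      rw [← inner_sum, T.sum_node_baryGrad hK, inner_zero_right]
    have e3 : ‖T.elemGrad U K‖ ^ 2 =
        ∑ i : T.Node, ∑ j : T.Node, U i * (U j * ⟪T.baryGrad K i, T.baryGrad K j⟫_ℝ) := by
      rw [← real_inner_self_eq_norm_sq, elemGrad, sum_inner]
      refine Finset.sum_congr rfl fun i _ => ?_
      rw [inner_sum]
      refine Finset.sum_congr rfl fun j _ => ?_
      rw [real_inner_smul_left, real_inner_smul_right]
    simp_rw [e1, Finset.sum_sub_distrib]
    have e4 : ∑ i : T.Node, ∑ j : T.Node, U i ^ 2 * ⟪T.baryGrad K i, T.baryGrad K j⟫_ℝ = 0 := by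
      simp_rw [← Finset.mul_sum, e2]; simp
    have e5 : ∑ i : T.Node, ∑ j : T.Node, U j ^ 2 * ⟪T.baryGrad K j, T.baryGrad K i⟫_ℝ = 0 := by
      rw [Finset.sum_comm]; exact e4
    rw [e4, e5, e3]
    simp_rw [← Finset.mul_sum]
    ring
  rw [Finset.sum_congr rfl fun K h => by rw [hK K h]]
  simp_rw [stiff_eq, Finset.sum_mul, Finset.sum_div, Finset.mul_sum]
  rw [Finset.sum_comm]
  refine Finset.sum_congr rfl fun i _ => ?_
  rw [Finset.sum_comm]
  refine Finset.sum_congr rfl fun j _ => ?_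
  refine Finset.sum_congr rfl fun K _ => ?_
  ring

end SimplicialMesh

/-! ### The Poincaré inequality -/

/-- `G` dominates the difference quotients of `u` along all segments in `W`. -/
structure IsUpperGradientOn {d : ℕ} (W : Set (Space d)) (u : Space d → ℝ)
    (G : Space d → ENNReal) : Prop where
  measurable_fun : Measurable u
  measurable_grad : Measurable G
  le_integral : ∀ x y, segment ℝ y x ⊆ W →
    ‖u x - u y‖ₑ ≤ ‖x - y‖ₑ * ∫⁻ t in Set.Icc (0 : ℝ) 1, G (AffineMap.lineMap y x t)

/-- The mean square difference of the values on `A` and on `B` is controlled by the upper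
gradients. -/
def PoincarePair {d : ℕ} (W A B : Set (Space d)) : Prop :=
  ∃ C : ENNReal, C ≠ ⊤ ∧ ∀ u G, IsUpperGradientOn W u G →
    ∫⁻ x in A, ∫⁻ y in B, ‖u x - u y‖ₑ ^ 2 ≤ C * ∫⁻ x in W, G x ^ 2

theorem lintegral_sq_le {α : Type*} [MeasurableSpace α] (μ : Measure α) [IsProbabilityMeasure μ]
    {f : α → ENNReal} (hf : AEMeasurable f μ) : (∫⁻ x, f x ∂μ) ^ 2 ≤ ∫⁻ x, f x ^ 2 ∂μ := by
  have h := ENNReal.lintegral_mul_le_Lp_mul_Lq μ Real.HolderConjugate.two_two hf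
    (aemeasurable_const (b := (1 : ENNReal)))
  simp only [Pi.mul_apply, mul_one, lintegral_const, measure_univ,
    ENNReal.rpow_two, one_pow, ENNReal.one_rpow] at h
  calc (∫⁻ x, f x ∂μ) ^ 2 ≤ ((∫⁻ x, f x ^ 2 ∂μ) ^ (1 / 2 : ℝ)) ^ 2 := by gcongr
    _ = ∫⁻ x, f x ^ 2 ∂μ := by
      rw [← ENNReal.rpow_two, ← ENNReal.rpow_mul]; norm_num

theorem sq_add_le_two_mul (a b : ENNReal) : (a + b) ^ 2 ≤ 2 * a ^ 2 + 2 * b ^ 2 := by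
  have h := ENNReal.rpow_add_le_mul_rpow_add_rpow a b (p := 2) (by norm_num)
  norm_num at h
  rwa [mul_add] at h

theorem enorm_sub_sq_le (a b c : ℝ) :
    ‖a - c‖ₑ ^ 2 ≤ 2 * ‖a - b‖ₑ ^ 2 + 2 * ‖b - c‖ₑ ^ 2 := by
  refine le_trans ?_ (sq_add_le_two_mul _ _)
  gcongr
  rw [← sub_add_sub_cancel a b c]
  exact enorm_add_le _ _

theorem measurable_diff_sq {d : ℕ} {u : Space d → ℝ} (hu : Measurable u) :
    Measurable fun p : Space d × Space d => ‖u p.1 - u p.2‖ₑ ^ 2 :=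
  (((hu.comp measurable_fst).sub (hu.comp measurable_snd)).enorm).pow_const 2

/-- Change of variables under a contraction of a set into itself. -/
theorem setLIntegral_comp_le {d : ℕ} {A : Set (Space d)} (hA : MeasurableSet A)
    {F : Space d → ENNReal} (hF : Measurable F) {t : ℝ} (ht : 1 / 2 ≤ t) (c : Space d)
    (hc : ∀ x ∈ A, c + t • x ∈ A) :
    ∫⁻ x in A, F (c + t • x) ≤ 2 ^ d * ∫⁻ x in A, F x := by
  have ht0 : 0 < t := by linarith
  rw [← lintegral_indicator hA, ← lintegral_indicator hA]
  have hmeas : Measurable (A.indicator F) := hF.indicator hA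
  calc ∫⁻ x, A.indicator (fun x => F (c + t • x)) x
      ≤ ∫⁻ x, (fun z => A.indicator F (c + z)) (t • x) := by
        refine lintegral_mono fun x => ?_
        by_cases hx : x ∈ A
        · simp [hx, hc x hx]
        · simp [hx]
    _ = ∫⁻ z, A.indicator F (c + z) ∂(Measure.map (fun x => t • x) volume) :=
        (lintegral_map (hmeas.comp (measurable_const_add c)) (measurable_const_smul t)).symm
    _ = ENNReal.ofReal |(t ^ d)⁻¹| * ∫⁻ z, A.indicator F z := by
        rw [Measure.map_addHaar_smul volume ht0.ne', lintegral_smul_measure,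
          lintegral_add_left_eq_self]
        simp
    _ ≤ 2 ^ d * ∫⁻ z, A.indicator F z := by
        gcongr
        rw [abs_of_pos (by positivity), ← inv_pow, ENNReal.ofReal_pow (by positivity)]
        gcongr
        rw [← ENNReal.ofReal_ofNat]
        refine ENNReal.ofReal_le_ofReal ?_
        rw [inv_le_comm₀ ht0 (by norm_num)]
        linarith

/-- For `t ≥ 1/2` freeze `y`, for `t ≤ 1/2` freeze `x`: the point then depends on the other variable
through a contraction of ratio at least `1/2`, whose inverse Jacobian is at most `2^d`. A bound
uniform in `t` results. -/
theorem lintegral_lineMap_le {d : ℕ} {A : Set (Space d)} (hA : MeasurableSet A)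
    (hconv : Convex ℝ A) {F : Space d → ENNReal} (hF : Measurable F) {t : ℝ}
    (ht : t ∈ Set.Icc (0 : ℝ) 1) :
    ∫⁻ x in A, ∫⁻ y in A, F (AffineMap.lineMap y x t) ≤
      2 ^ d * volume A * ∫⁻ x in A, F x := by
  have hl : ∀ x y : Space d, AffineMap.lineMap y x t = (1 - t) • y + t • x := fun x y =>
    AffineMap.lineMap_apply_module _ _ _
  have hm : Measurable fun p : Space d × Space d => F (AffineMap.lineMap p.2 p.1 t) := by
    refine hF.comp ?_
    simp_rw [hl]
    fun_prop
  have hfinal : ∫⁻ _ in A, 2 ^ d * ∫⁻ x in A, F x = 2 ^ d * volume A * ∫⁻ x in A, F x := by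
    rw [setLIntegral_const]; ring
  rcases le_total (1 / 2) t with h | h
  · rw [lintegral_lintegral_swap hm.aemeasurable, ← hfinal]
    refine setLIntegral_mono measurable_const fun y hy => ?_
    simp_rw [hl]
    refine setLIntegral_comp_le hA hF h _ fun x hx => ?_
    exact hconv hy hx (by linarith [ht.2]) ht.1 (by ring)
  · rw [← hfinal]
    refine setLIntegral_mono measurable_const fun x hx => ?_
    simp_rw [hl, add_comm _ (t • x)]
    refine setLIntegral_comp_le hA hF (by linarith) _ fun y hy => ?_
    exact hconv hx hy ht.1 (by linarith [ht.2]) (by ring)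

theorem lintegral_rotate {α β γ : Type*} [MeasurableSpace α] [MeasurableSpace β]
    [MeasurableSpace γ] (μ : Measure α) (ν : Measure β) (ρ : Measure γ) [SFinite μ] [SFinite ν]
    [SFinite ρ] {f : α → β → γ → ENNReal}
    (hf : Measurable fun p : (α × β) × γ => f p.1.1 p.1.2 p.2) :
    ∫⁻ x, ∫⁻ y, ∫⁻ t, f x y t ∂ρ ∂ν ∂μ = ∫⁻ t, ∫⁻ x, ∫⁻ y, f x y t ∂ν ∂μ ∂ρ := by
  have h1 : ∀ x, Measurable fun p : β × γ => f x p.1 p.2 := fun x =>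
    hf.comp ((measurable_const.prodMk measurable_fst).prodMk measurable_snd)
  have h2 : Measurable fun q : (α × γ) × β => f q.1.1 q.2 q.1.2 :=
    hf.comp (((measurable_fst.comp measurable_fst).prodMk measurable_snd).prodMk
      (measurable_snd.comp measurable_fst))
  simp_rw [fun x => lintegral_lintegral_swap (μ := ν) (ν := ρ) (h1 x).aemeasurable]
  exact lintegral_lintegral_swap h2.lintegral_prod_right'.aemeasurable

/-- The classical proof by segments: square the upper gradient inequality, use Cauchy-Schwarz in the
segment parameter, and integrate over the endpoints with the parameter outermost. -/
theorem PoincarePair.of_convex {d : ℕ} {W A : Set (Space d)} (hA : MeasurableSet A)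
    (hconv : Convex ℝ A) (hb : Bornology.IsBounded A) (hAW : A ⊆ W) : PoincarePair W A A := by
  set D := Metric.ediam A with hD
  have hDtop : D ≠ ⊤ := hb.ediam_ne_top
  refine ⟨D ^ 2 * (2 ^ d * volume A), ?_, fun u G hG => ?_⟩
  · exact ENNReal.mul_ne_top (ENNReal.pow_ne_top hDtop)
      (ENNReal.mul_ne_top (ENNReal.pow_ne_top (by simp)) hb.measure_lt_top.ne)
  have : IsProbabilityMeasure (volume.restrict (Set.Icc (0 : ℝ) 1)) := ⟨by simp⟩
  have hline : Measurable fun p : (Space d × Space d) × ℝ => AffineMap.lineMap p.1.2 p.1.1 p.2 := by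
    simp_rw [AffineMap.lineMap_apply_module]
    fun_prop
  have hG1 : ∀ x y : Space d, Measurable fun t : ℝ => G (AffineMap.lineMap y x t) := fun x y =>
    hG.measurable_grad.comp AffineMap.lineMap_continuous.measurable
  have hpt : ∀ x ∈ A, ∀ y ∈ A, ‖u x - u y‖ₑ ^ 2 ≤
      D ^ 2 * ∫⁻ t in Set.Icc (0 : ℝ) 1, G (AffineMap.lineMap y x t) ^ 2 := by
    intro x hx y hy
    calc ‖u x - u y‖ₑ ^ 2
        ≤ (‖x - y‖ₑ * ∫⁻ t in Set.Icc (0 : ℝ) 1, G (AffineMap.lineMap y x t)) ^ 2 := by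
          gcongr
          exact hG.le_integral x y ((hconv.segment_subset hy hx).trans hAW)
      _ = ‖x - y‖ₑ ^ 2 * (∫⁻ t in Set.Icc (0 : ℝ) 1, G (AffineMap.lineMap y x t)) ^ 2 := by
          rw [mul_pow]
      _ ≤ _ := by
          gcongr
          · exact (edist_eq_enorm_sub x y).symm.trans_le (Metric.edist_le_ediam_of_mem hx hy)
          · exact lintegral_sq_le _ (hG1 x y).aemeasurable
  have hGm : Measurable fun p : (Space d × Space d) × ℝ =>
      G (AffineMap.lineMap p.1.2 p.1.1 p.2) ^ 2 := (hG.measurable_grad.comp hline).pow_const 2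
  calc ∫⁻ x in A, ∫⁻ y in A, ‖u x - u y‖ₑ ^ 2
      ≤ ∫⁻ x in A, ∫⁻ y in A, D ^ 2 * ∫⁻ t in Set.Icc (0 : ℝ) 1,
          G (AffineMap.lineMap y x t) ^ 2 := by
        refine setLIntegral_mono' hA fun x hx => setLIntegral_mono' hA fun y hy => hpt x hx y hy
    _ = D ^ 2 * ∫⁻ t in Set.Icc (0 : ℝ) 1, ∫⁻ x in A, ∫⁻ y in A,
          G (AffineMap.lineMap y x t) ^ 2 := by
        rw [← lintegral_rotate _ _ _ hGm, ← lintegral_const_mul' _ _ (ENNReal.pow_ne_top hDtop)]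
        refine lintegral_congr fun x => ?_
        rw [lintegral_const_mul' _ _ (ENNReal.pow_ne_top hDtop)]
    _ ≤ D ^ 2 * ∫⁻ _ in Set.Icc (0 : ℝ) 1, 2 ^ d * volume A * ∫⁻ x in A, G x ^ 2 := by
        gcongr 1
        refine setLIntegral_mono' measurableSet_Icc fun t ht => ?_
        exact lintegral_lineMap_le hA hconv (hG.measurable_grad.pow_const 2) ht
    _ = D ^ 2 * (2 ^ d * volume A) * ∫⁻ x in A, G x ^ 2 := by
        rw [lintegral_const, measure_univ, mul_one, ← mul_assoc]
    _ ≤ _ := by gcongr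

theorem PoincarePair.symm {d : ℕ} {W A B : Set (Space d)} (h : PoincarePair W A B) :
    PoincarePair W B A := by
  obtain ⟨C, hC, h⟩ := h
  refine ⟨C, hC, fun u G hG => ?_⟩
  rw [lintegral_lintegral_swap (measurable_diff_sq hG.measurable_fun).aemeasurable]
  simp_rw [fun x y => (enorm_sub_rev (u x) (u y))]
  exact h u G hG

theorem PoincarePair.mono {d : ℕ} {W A B A' B' : Set (Space d)} (h : PoincarePair W A B)
    (hA : A' ⊆ A) (hB : B' ⊆ B) : PoincarePair W A' B' := by
  obtain ⟨C, hC, h⟩ := h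
  refine ⟨C, hC, fun u G hG => le_trans ?_ (h u G hG)⟩
  exact lintegral_mono' (Measure.restrict_mono hA le_rfl) fun x => lintegral_mono_set hB

/-- Insert an intermediate value `u y` and average over `y ∈ B`, which needs `B` to have positive
finite volume. -/
theorem PoincarePair.trans {d : ℕ} {W A B C : Set (Space d)} (hAB : PoincarePair W A B)
    (hBC : PoincarePair W B C) (hA : volume A ≠ ⊤) (hB0 : volume B ≠ 0) (hB : volume B ≠ ⊤)
    (hC : volume C ≠ ⊤) : PoincarePair W A C := by
  obtain ⟨c₁, hc₁, h₁⟩ := hAB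
  obtain ⟨c₂, hc₂, h₂⟩ := hBC
  refine ⟨(volume B)⁻¹ * (2 * volume C * c₁ + 2 * volume A * c₂), ?_, fun u G hG => ?_⟩
  · refine ENNReal.mul_ne_top (ENNReal.inv_ne_top.2 hB0) (ENNReal.add_ne_top.2 ⟨?_, ?_⟩)
    · exact ENNReal.mul_ne_top (ENNReal.mul_ne_top (by simp) hC) hc₁
    · exact ENNReal.mul_ne_top (ENNReal.mul_ne_top (by simp) hA) hc₂
  have hm := measurable_diff_sq hG.measurable_fun
  have hu := hG.measurable_fun
  have hmx : ∀ x, Measurable fun y => ‖u x - u y‖ₑ ^ 2 := fun x =>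
    ((hu.const_sub (u x)).enorm).pow_const 2
  have hmz : ∀ z, Measurable fun y => ‖u y - u z‖ₑ ^ 2 := fun z =>
    ((hu.sub_const (u z)).enorm).pow_const 2
  have hms : Measurable fun p : Space d × Space d => ‖u p.2 - u p.1‖ₑ ^ 2 :=
    (((hu.comp measurable_snd).sub (hu.comp measurable_fst)).enorm).pow_const 2
  have hm1 : Measurable fun x => ∫⁻ y in B, ‖u x - u y‖ₑ ^ 2 := hm.lintegral_prod_right'
  have hm2 : Measurable fun z => ∫⁻ y in B, ‖u y - u z‖ₑ ^ 2 :=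
    hms.lintegral_prod_right'
  have key : volume B * ∫⁻ x in A, ∫⁻ z in C, ‖u x - u z‖ₑ ^ 2 ≤
      (2 * volume C * c₁ + 2 * volume A * c₂) * ∫⁻ x in W, G x ^ 2 := by
    calc volume B * ∫⁻ x in A, ∫⁻ z in C, ‖u x - u z‖ₑ ^ 2
        = ∫⁻ x in A, ∫⁻ z in C, ∫⁻ y in B, ‖u x - u z‖ₑ ^ 2 := by
          rw [← lintegral_const_mul' _ _ hB]
          refine lintegral_congr fun x => ?_
          rw [← lintegral_const_mul' _ _ hB]
          refine lintegral_congr fun z => ?_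
          rw [setLIntegral_const, mul_comm]
      _ ≤ ∫⁻ x in A, ∫⁻ z in C, ∫⁻ y in B, (2 * ‖u x - u y‖ₑ ^ 2 + 2 * ‖u y - u z‖ₑ ^ 2) :=
          lintegral_mono fun x => lintegral_mono fun z => lintegral_mono fun y =>
            enorm_sub_sq_le _ _ _
      _ = ∫⁻ x in A, ∫⁻ z in C, (2 * ∫⁻ y in B, ‖u x - u y‖ₑ ^ 2) +
            2 * ∫⁻ y in B, ‖u y - u z‖ₑ ^ 2 := by
          refine lintegral_congr fun x => lintegral_congr fun z => ?_
          rw [lintegral_add_left ((hmx x).const_mul 2), lintegral_const_mul _ (hmx x),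
            lintegral_const_mul _ (hmz z)]
      _ = ∫⁻ x in A, (2 * volume C * ∫⁻ y in B, ‖u x - u y‖ₑ ^ 2) +
            2 * ∫⁻ z in C, ∫⁻ y in B, ‖u y - u z‖ₑ ^ 2 := by
          refine lintegral_congr fun x => ?_
          rw [lintegral_add_left measurable_const, setLIntegral_const, lintegral_const_mul _ hm2]
          ring
      _ = (2 * volume C * ∫⁻ x in A, ∫⁻ y in B, ‖u x - u y‖ₑ ^ 2) +
            2 * volume A * ∫⁻ y in B, ∫⁻ z in C, ‖u y - u z‖ₑ ^ 2 := by
          rw [lintegral_add_left (hm1.const_mul _), setLIntegral_const, lintegral_const_mul _ hm1,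
            lintegral_lintegral_swap (f := fun z y => ‖u y - u z‖ₑ ^ 2) hms.aemeasurable]
          ring
      _ ≤ (2 * volume C * (c₁ * ∫⁻ x in W, G x ^ 2)) +
            2 * volume A * (c₂ * ∫⁻ x in W, G x ^ 2) := by
          gcongr
          · exact h₁ u G hG
          · exact h₂ u G hG
      _ = _ := by ring
  calc ∫⁻ x in A, ∫⁻ z in C, ‖u x - u z‖ₑ ^ 2
      = (volume B)⁻¹ * (volume B * ∫⁻ x in A, ∫⁻ z in C, ‖u x - u z‖ₑ ^ 2) := by
        rw [← mul_assoc, ENNReal.inv_mul_cancel hB0 hB, one_mul]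
    _ ≤ (volume B)⁻¹ * ((2 * volume C * c₁ + 2 * volume A * c₂) * ∫⁻ x in W, G x ^ 2) := by
        gcongr
    _ = _ := by ring

theorem PoincarePair.of_overlap {d : ℕ} {W A B : Set (Space d)} (hA : PoincarePair W A A)
    (hB : PoincarePair W B B) (hAf : volume A ≠ ⊤) (hBf : volume B ≠ ⊤)
    (h : volume (A ∩ B) ≠ 0) : PoincarePair W A B :=
  (hA.mono subset_rfl Set.inter_subset_left).trans (hB.mono Set.inter_subset_right subset_rfl)
    hAf h (measure_ne_top_of_subset Set.inter_subset_left hAf) hBf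

/-- In a connected open set any two small balls satisfy a common Poincaré inequality. -/
theorem exists_ball_poincarePair {d : ℕ} {Ω W : Set (Space d)} (ho : IsOpen Ω)
    (hc : IsPreconnected Ω) (hW : Ω ⊆ W) :
    ∃ r : Space d → ℝ, (∀ x ∈ Ω, 0 < r x ∧ Metric.ball x (r x) ⊆ Ω) ∧
      ∀ x ∈ Ω, ∀ y ∈ Ω, PoincarePair W (Metric.ball x (r x)) (Metric.ball y (r y)) := by
  have h : ∀ x, ∃ r, x ∈ Ω → 0 < r ∧ Metric.ball x r ⊆ Ω := by
    intro x
    by_cases hx : x ∈ Ω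
    · obtain ⟨r, h0, h1⟩ := Metric.isOpen_iff.1 ho x hx
      exact ⟨r, fun _ => ⟨h0, h1⟩⟩
    · exact ⟨0, fun h => absurd h hx⟩
  choose r hr using h
  have hself : ∀ x ∈ Ω, PoincarePair W (Metric.ball x (r x)) (Metric.ball x (r x)) := fun x hx =>
    .of_convex measurableSet_ball (convex_ball _ _) Metric.isBounded_ball ((hr x hx).2.trans hW)
  -- The relation is symmetric and transitive and holds between nearby centres, because their balls
  -- overlap; connectedness makes it hold throughout.
  refine ⟨r, hr, fun x hx y hy => hc.induction₂
    (fun x y => PoincarePair W (Metric.ball x (r x)) (Metric.ball y (r y)))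
    (fun x hx => ?_) (fun x y z _ hy _ h1 h2 => ?_) (fun x y _ _ h => h.symm) hx hy⟩
  · filter_upwards [self_mem_nhdsWithin, mem_nhdsWithin_of_mem_nhds
      (Metric.ball_mem_nhds x (hr x hx).1)] with y hy hyx
    refine .of_overlap (hself x hx) (hself y hy) measure_ball_lt_top.ne measure_ball_lt_top.ne ?_
    exact ((Metric.isOpen_ball.inter Metric.isOpen_ball).measure_pos volume
      ⟨y, hyx, Metric.mem_ball_self (hr y hy).1⟩).ne'
  · exact h1.trans h2 measure_ball_lt_top.ne (Metric.measure_ball_pos _ _ (hr y hy).1).ne'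
      measure_ball_lt_top.ne measure_ball_lt_top.ne

/-! ### Upper gradients of piecewise affine functions and the mesh-independent constant -/

namespace SimplicialMesh

variable {d : ℕ} (T : SimplicialMesh d)

theorem lagrange_of_notMem (U : T.Node → ℝ) {x : Space d} (hx : x ∉ ⋃ K ∈ T.elems, cell K) :
    T.lagrange U x = 0 := by
  refine Finset.sum_eq_zero fun i _ => ?_
  rw [hat, dif_neg, mul_zero]
  rintro ⟨K, hK, hxK⟩
  exact hx (Set.mem_iUnion₂.2 ⟨K, hK, hxK⟩)

theorem continuousOn_lagrange_cell (U : T.Node → ℝ) {K : Finset (Space d)} (hK : K ∈ T.elems) :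
    ContinuousOn (T.lagrange U) (cell K) := by
  refine ContinuousOn.congr (f := fun x => ∑ i, U i * T.bary K i x) ?_
    fun x hx => T.lagrange_eq U hK hx
  exact (continuous_finsetSum Finset.univ fun (i : T.Node) _ =>
    (T.continuous_bary K i).const_mul (U i)).continuousOn

theorem continuousOn_lagrange (U : T.Node → ℝ) :
    ContinuousOn (T.lagrange U) (⋃ K ∈ T.elems, cell K) := by
  have h : (⋃ K ∈ T.elems, cell K) = ⋃ K : T.elems, cell (K : Finset (Space d)) :=
    (Set.iUnion_subtype (fun K => K ∈ T.elems) fun K => cell (K : Finset (Space d))).symm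
  rw [h]
  exact (locallyFinite_of_finite _).continuousOn_iUnion
    (fun K => (isCompact_cell _).isClosed) fun K => T.continuousOn_lagrange_cell U K.2

theorem isClosed_iUnion_cell : IsClosed (⋃ K ∈ T.elems, cell K) :=
  T.elems.finite_toSet.isClosed_biUnion fun K _ => (isCompact_cell K).isClosed

theorem measurable_lagrange (U : T.Node → ℝ) : Measurable (T.lagrange U) := by
  classical
  have h : T.lagrange U = (⋃ K ∈ T.elems, cell K).piecewise (T.lagrange U) fun _ => 0 := by
    funext x
    by_cases hx : x ∈ ⋃ K ∈ T.elems, cell K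
    · rw [Set.piecewise_eq_of_mem _ _ _ hx]
    · rw [Set.piecewise_eq_of_notMem _ _ _ hx, T.lagrange_of_notMem U hx]
  rw [h]
  exact (T.continuousOn_lagrange U).measurable_piecewise continuousOn_const
    T.isClosed_iUnion_cell.measurableSet

/-- The norm of the piecewise constant gradient of a piecewise affine function. -/
def gradSize (U : T.Node → ℝ) (x : Space d) : ENNReal :=
  ∑ K ∈ T.elems, (cell K).indicator (fun _ => ‖T.elemGrad U K‖ₑ) x

theorem measurable_gradSize (U : T.Node → ℝ) : Measurable (T.gradSize U) :=
  Finset.measurable_sum _ fun K _ => measurable_const.indicator (measurableSet_cell K)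

theorem volume_image_lagrange_le (U : T.Node → ℝ) {K : Finset (Space d)} (hK : K ∈ T.elems)
    (x y : Space d) (I : Set ℝ) :
    volume ((fun t => T.lagrange U (AffineMap.lineMap y x t)) ''
        (I ∩ (AffineMap.lineMap y x : ℝ → Space d) ⁻¹' cell K)) ≤
      ‖T.elemGrad U K‖ₑ * ‖x - y‖ₑ *
        volume (I ∩ (AffineMap.lineMap y x : ℝ → Space d) ⁻¹' cell K) := by
  have hl : LipschitzOnWith (‖T.elemGrad U K‖₊ * ‖x - y‖₊)
      (fun t => T.lagrange U (AffineMap.lineMap y x t))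
      (I ∩ (AffineMap.lineMap y x : ℝ → Space d) ⁻¹' cell K) := by
    refine LipschitzOnWith.of_dist_le_mul fun s hs t ht => ?_
    rw [Real.dist_eq, T.lagrange_sub U hK ht.2 hs.2]
    have : AffineMap.lineMap y x s - AffineMap.lineMap y x t = (s - t) • (x - y) := by
      rw [AffineMap.lineMap_apply_module, AffineMap.lineMap_apply_module]; module
    rw [this]
    refine (abs_real_inner_le_norm _ _).trans (le_of_eq ?_)
    rw [norm_smul, Real.dist_eq, Real.norm_eq_abs]
    push_cast
    ring
  have := hl.hausdorffMeasure_image_le (d := 1) zero_le_one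
  rw [hausdorffMeasure_real, ENNReal.rpow_one] at this
  simpa [enorm] using this

/-- By the intermediate value theorem the image of the segment covers the interval between the end
values. It is also covered by the images of the pieces in single cells, whose lengths are bounded by
Lipschitz constants. Thus the crossings of the segment with the cells need not be ordered; parts
lying in several cells are counted repeatedly, as they are in `gradSize`. -/
theorem isUpperGradientOn (U : T.Node → ℝ) :
    IsUpperGradientOn (⋃ K ∈ T.elems, cell K) (T.lagrange U) (T.gradSize U) := by
  refine ⟨T.measurable_lagrange U, T.measurable_gradSize U, fun x y hxy => ?_⟩
  set γ : ℝ → Space d := fun t => AffineMap.lineMap y x t with hγ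
  have hγc : Continuous γ := AffineMap.lineMap_continuous
  have hmaps : Set.MapsTo γ (Set.Icc 0 1) (⋃ K ∈ T.elems, cell K) := fun t ht => by
    refine hxy ?_
    rw [segment_eq_image_lineMap]
    exact ⟨t, ht, rfl⟩
  set f : ℝ → ℝ := fun t => T.lagrange U (γ t) with hf
  have hfc : ContinuousOn f (Set.Icc 0 1) :=
    (T.continuousOn_lagrange U).comp hγc.continuousOn hmaps
  have h0 : f 0 = T.lagrange U y := by simp [hf, hγ]
  have h1 : f 1 = T.lagrange U x := by simp [hf, hγ]
  have hcov : f '' Set.Icc 0 1 ⊆ ⋃ K ∈ T.elems, f '' (Set.Icc 0 1 ∩ γ ⁻¹' cell K) := by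
    rintro _ ⟨t, ht, rfl⟩
    obtain ⟨K, hK, hKt⟩ := Set.mem_iUnion₂.1 (hmaps ht)
    exact Set.mem_iUnion₂.2 ⟨K, hK, t, ⟨ht, hKt⟩, rfl⟩
  calc ‖T.lagrange U x - T.lagrange U y‖ₑ = volume (Set.uIcc (f 0) (f 1)) := by
        rw [Real.volume_interval, h0, h1, ← ofReal_norm, Real.norm_eq_abs]
    _ ≤ volume (f '' Set.Icc 0 1) := measure_mono (by
        have := intermediate_value_uIcc (f := f) (a := 0) (b := 1)
          (by rwa [Set.uIcc_of_le zero_le_one])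
        rwa [Set.uIcc_of_le (zero_le_one (α := ℝ))] at this)
    _ ≤ ∑ K ∈ T.elems, volume (f '' (Set.Icc 0 1 ∩ γ ⁻¹' cell K)) :=
        (measure_mono hcov).trans (measure_biUnion_finset_le _ _)
    _ ≤ ∑ K ∈ T.elems, ‖T.elemGrad U K‖ₑ * ‖x - y‖ₑ * volume (Set.Icc 0 1 ∩ γ ⁻¹' cell K) :=
        Finset.sum_le_sum fun K hK => T.volume_image_lagrange_le U hK x y _
    _ = ‖x - y‖ₑ * ∫⁻ t in Set.Icc (0 : ℝ) 1, T.gradSize U (γ t) := by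
        have hm : ∀ K : Finset (Space d), MeasurableSet (γ ⁻¹' cell K) := fun K =>
          hγc.measurable (measurableSet_cell K)
        unfold gradSize
        have e : ∀ (K : Finset (Space d)) (t : ℝ),
            (cell K).indicator (fun _ => ‖T.elemGrad U K‖ₑ) (γ t) =
              (γ ⁻¹' cell K).indicator (fun _ => ‖T.elemGrad U K‖ₑ) t := fun K t => rfl
        simp_rw [e]
        rw [lintegral_finsetSum _ fun K _ => measurable_const.indicator (hm K), Finset.mul_sum]
        refine Finset.sum_congr rfl fun K _ => ?_
        rw [lintegral_indicator_const (hm K), Measure.restrict_apply (hm K), Set.inter_comm]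
        ring

theorem lintegral_gradSize_sq (U : T.Node → ℝ) :
    ∫⁻ x in ⋃ K ∈ T.elems, cell K, T.gradSize U x ^ 2 =
      ∑ K ∈ T.elems, volume (cell K) * ‖T.elemGrad U K‖ₑ ^ 2 := by
  rw [T.restrict_biUnion_cell subset_rfl, lintegral_finsetSum_measure]
  refine Finset.sum_congr rfl fun K hK => ?_
  rw [mul_comm, ← setLIntegral_const]
  refine lintegral_congr_ae ?_
  have h : ∀ᵐ x ∂volume.restrict (cell K), ∀ L ∈ T.elems, L ≠ K → x ∉ cell L := by
    rw [Filter.eventually_all_finset]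
    intro L hL
    by_cases hLK : L = K
    · exact Filter.Eventually.of_forall fun x hx => absurd hLK hx
    · rw [ae_restrict_iff' (measurableSet_cell K)]
      have := T.aedisjoint_cell hK hL (Ne.symm hLK)
      filter_upwards [measure_eq_zero_iff_ae_notMem.1 this] with x hx hxK _ hxL
      exact hx ⟨hxK, hxL⟩
  filter_upwards [h, ae_restrict_mem (measurableSet_cell K)] with x hx hxK
  rw [gradSize, Finset.sum_eq_single K]
  · rw [Set.indicator_of_mem hxK]
  · intro L hL hLK; exact Set.indicator_of_notMem (hx L hL hLK) _
  · intro h; exact absurd hK h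

/-- The Poincaré inequality for piecewise affine functions on all meshes of a domain, with a
constant that does not depend on the mesh. -/
theorem exists_poincare {Ω : Set (Space d)} (hc : IsPreconnected Ω)
    (hΩ : interior (closure Ω) = Ω) : ∃ C : ENNReal, C ≠ ⊤ ∧ ∀ T : SimplicialMesh d,
      T.Triangulates Ω → ∀ U : T.Node → ℝ,
        ∫⁻ x in Ω, ∫⁻ y in Ω, ‖T.lagrange U x - T.lagrange U y‖ₑ ^ 2 ≤
          C * ∑ K ∈ T.elems, volume (cell K) * ‖T.elemGrad U K‖ₑ ^ 2 := by
  -- An arbitrary but fixed mesh supplies the decomposition of `Ω` into convex pieces, and the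
  -- constant is built from it alone. The functions to be estimated may live on any other mesh.
  -- Without any mesh there is nothing to prove.
  by_cases hex : ∃ T₀ : SimplicialMesh d, T₀.Triangulates Ω
  swap
  · exact ⟨0, by simp, fun T hT => absurd ⟨T, hT⟩ hex⟩
  obtain ⟨T₀, hT₀⟩ := hex
  have ho : IsOpen Ω := hΩ ▸ isOpen_interior
  obtain ⟨r, hr, hball⟩ := exists_ball_poincarePair ho hc (subset_closure (s := Ω))
  have hcell : ∀ K ∈ T₀.elems, ∃ x ∈ Ω, PoincarePair (closure Ω) (cell K) (Metric.ball x (r x)) := by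
    intro K hK
    obtain ⟨x, hx⟩ := T₀.interior_cell_nonempty hK
    have hxΩ := T₀.interior_cell_subset hT₀ hΩ hK hx
    refine ⟨x, hxΩ, .of_overlap ?_ (hball x hxΩ x hxΩ) (volume_cell_ne_top K)
      measure_ball_lt_top.ne ?_⟩
    · exact .of_convex (measurableSet_cell K) (convex_cell K) (isCompact_cell K).isBounded
        (T₀.cell_subset_closure hT₀ hK)
    · refine ((isOpen_interior.inter Metric.isOpen_ball).measure_pos volume
        ⟨x, hx, Metric.mem_ball_self (hr x hxΩ).1⟩ |>.trans_le (measure_mono ?_)).ne'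
      exact Set.inter_subset_inter_left _ interior_subset
  have hcells : ∀ K ∈ T₀.elems, ∀ L ∈ T₀.elems, PoincarePair (closure Ω) (cell K) (cell L) := by
    intro K hK L hL
    obtain ⟨x, hx, hKx⟩ := hcell K hK
    obtain ⟨y, hy, hLy⟩ := hcell L hL
    have hb0 : ∀ z ∈ Ω, volume (Metric.ball z (r z)) ≠ 0 := fun z hz =>
      (Metric.measure_ball_pos _ _ (hr z hz).1).ne'
    -- The chain runs from `K` to a ball at an interior point of `K`, on to such a ball for `L`, and
    -- then to `L`.
    exact (hKx.trans (hball x hx y hy) (volume_cell_ne_top K) (hb0 x hx) measure_ball_lt_top.ne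
      measure_ball_lt_top.ne).trans hLy.symm (volume_cell_ne_top K) (hb0 y hy)
      measure_ball_lt_top.ne (volume_cell_ne_top L)
  choose! C hC hCle using hcells
  refine ⟨∑ K ∈ T₀.elems, ∑ L ∈ T₀.elems, C K L, ?_, fun T hT U => ?_⟩
  · exact ENNReal.sum_ne_top.2 fun K hK => ENNReal.sum_ne_top.2 fun L hL => hC K hK L hL
  · have hu := T.isUpperGradientOn U
    have hG := T.lintegral_gradSize_sq U
    rw [show _ = _ from hT] at hu hG
    rw [← hG, T₀.restrict_domain hT₀ hΩ, lintegral_finsetSum_measure, Finset.sum_mul]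
    refine Finset.sum_le_sum fun K hK => ?_
    simp_rw [lintegral_finsetSum_measure]
    have hm : ∀ L : Finset (Space d), Measurable fun x =>
        ∫⁻ y in cell L, ‖T.lagrange U x - T.lagrange U y‖ₑ ^ 2 := fun L =>
      (measurable_diff_sq (T.measurable_lagrange U)).lintegral_prod_right'
    rw [lintegral_finsetSum _ fun L _ => hm L, Finset.sum_mul]
    exact Finset.sum_le_sum fun L hL => hCle K hK L hL _ _ hu

/-! #### Mass lumping -/

open Classical in
theorem lagrange_node (U : T.Node → ℝ) (i : T.Node) : T.lagrange U i = U i := by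
  obtain ⟨K, hK, hi⟩ := T.exists_elem i
  rw [T.lagrange_eq U hK (mem_cell_of_mem hi), Finset.sum_eq_single i]
  · have := T.bary_vertex hK ⟨i, hi⟩ ⟨i, hi⟩
    simp only [if_true] at this
    rw [this, mul_one]
  · intro j _ hj
    by_cases hjK : (j : Space d) ∈ K
    · have := T.bary_vertex hK ⟨j, hjK⟩ ⟨i, hi⟩
      rw [if_neg fun h => hj (Subtype.ext (congrArg (fun v : K => (v : Space d)) h))] at this
      rw [this, mul_zero]
    · rw [T.bary_of_notMem hjK, mul_zero]
  · simp

/-- For affine `u` the vertex value is `2 u(z) - u(x)`, where `z` is the midpoint of the vertex and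
`x`. Integrating over `x`, with the change of variables `x ↦ z`, gives a constant independent of the
shape of the cell. -/
theorem volume_cell_mul_sq_le (U : T.Node → ℝ) (c : ℝ) {K : Finset (Space d)} (hK : K ∈ T.elems)
    {i : T.Node} (hi : (i : Space d) ∈ K) :
    volume (cell K) * ‖U i - c‖ₑ ^ 2 ≤
      (8 * 2 ^ d + 2) * ∫⁻ x in cell K, ‖T.lagrange U x - c‖ₑ ^ 2 := by
  have hm : Measurable fun x => ‖T.lagrange U x - c‖ₑ ^ 2 :=
    (((T.measurable_lagrange U).sub_const c).enorm).pow_const 2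
  have hiK : (i : Space d) ∈ cell K := mem_cell_of_mem hi
  have hmid : ∀ x ∈ cell K, (1 / 2 : ℝ) • (i : Space d) + (1 / 2 : ℝ) • x ∈ cell K := fun x hx =>
    convex_cell K hiK hx (by norm_num) (by norm_num) (by norm_num)
  have hpt : ∀ x ∈ cell K, ‖U i - c‖ₑ ^ 2 ≤
      8 * ‖T.lagrange U ((1 / 2 : ℝ) • (i : Space d) + (1 / 2 : ℝ) • x) - c‖ₑ ^ 2
        + 2 * ‖T.lagrange U x - c‖ₑ ^ 2 := by
    intro x hx
    set z := (1 / 2 : ℝ) • (i : Space d) + (1 / 2 : ℝ) • x with hz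
    have e1 := T.lagrange_sub U hK hiK (hmid x hx)
    have e2 := T.lagrange_sub U hK hiK hx
    rw [T.lagrange_node] at e1 e2
    have e3 : z - (i : Space d) = (1 / 2 : ℝ) • (x - i) := by rw [hz]; module
    rw [← hz, e3, inner_smul_right, ← e2] at e1
    have e4 : U i - c = 2 * (T.lagrange U z - c) + -(T.lagrange U x - c) := by linarith
    rw [e4]
    calc ‖2 * (T.lagrange U z - c) + -(T.lagrange U x - c)‖ₑ ^ 2
        ≤ (2 * ‖T.lagrange U z - c‖ₑ + ‖T.lagrange U x - c‖ₑ) ^ 2 := by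
          gcongr
          refine (enorm_add_le _ _).trans ?_
          rw [enorm_neg, enorm_mul]
          gcongr
          simp [enorm]
      _ ≤ 2 * (2 * ‖T.lagrange U z - c‖ₑ) ^ 2 + 2 * ‖T.lagrange U x - c‖ₑ ^ 2 :=
          sq_add_le_two_mul _ _
      _ = _ := by ring
  have hm' : Measurable fun x : Space d =>
      ‖T.lagrange U ((1 / 2 : ℝ) • (i : Space d) + (1 / 2 : ℝ) • x) - c‖ₑ ^ 2 :=
    hm.comp ((measurable_const_smul (1 / 2 : ℝ)).const_add _)
  calc volume (cell K) * ‖U i - c‖ₑ ^ 2 = ∫⁻ _ in cell K, ‖U i - c‖ₑ ^ 2 := by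
        rw [setLIntegral_const, mul_comm]
    _ ≤ ∫⁻ x in cell K,
          (8 * ‖T.lagrange U ((1 / 2 : ℝ) • (i : Space d) + (1 / 2 : ℝ) • x) - c‖ₑ ^ 2
            + 2 * ‖T.lagrange U x - c‖ₑ ^ 2) := setLIntegral_mono' (measurableSet_cell K) hpt
    _ = 8 * (∫⁻ x in cell K,
          ‖T.lagrange U ((1 / 2 : ℝ) • (i : Space d) + (1 / 2 : ℝ) • x) - c‖ₑ ^ 2)
            + 2 * ∫⁻ x in cell K, ‖T.lagrange U x - c‖ₑ ^ 2 := by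
        rw [lintegral_add_left (hm'.const_mul 8), lintegral_const_mul _ hm',
          lintegral_const_mul _ hm]
    _ ≤ 8 * (2 ^ d * ∫⁻ x in cell K, ‖T.lagrange U x - c‖ₑ ^ 2)
            + 2 * ∫⁻ x in cell K, ‖T.lagrange U x - c‖ₑ ^ 2 := by
        gcongr
        exact setLIntegral_comp_le (measurableSet_cell K) hm le_rfl _ hmid
    _ = _ := by ring

theorem ofReal_mass (i : T.Node) : ENNReal.ofReal (T.mass i) * (d + 1) = volume (T.patch i) := by
  rw [mass, ENNReal.ofReal_div_of_pos (by positivity), Measure.real,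
    ENNReal.ofReal_toReal (T.isCompact_patch i).measure_lt_top.ne]
  have : ENNReal.ofReal ((d : ℝ) + 1) = d + 1 := by
    rw [ENNReal.ofReal_add (by positivity) zero_le_one]; simp
  rw [this, ENNReal.div_mul_cancel (by simp) (by simp)]

theorem sum_ofReal_mass_mul_le {F : T.Node → ENNReal} {Φ : Finset (Space d) → ENNReal}
    (h : ∀ K ∈ T.elems, ∀ i : T.Node, (i : Space d) ∈ K → volume (cell K) * F i ≤ Φ K) :
    ∑ i, ENNReal.ofReal (T.mass i) * F i ≤ ∑ K ∈ T.elems, Φ K := by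
  classical
  have hd0 : ((d : ENNReal) + 1) ≠ 0 := by simp
  have hdt : ((d : ENNReal) + 1) ≠ ⊤ := by simp
  have hp : ∀ i : T.Node, volume (T.patch i) =
      ∑ K ∈ T.elems with (i : Space d) ∈ K, volume (cell K) := fun i => by
    have := congrArg (fun μ : Measure (Space d) => μ Set.univ) (T.restrict_patch i)
    simpa only [Measure.restrict_apply_univ, Measure.finsetSum_apply] using this
  rw [← ENNReal.mul_le_mul_iff_right hd0 hdt, Finset.mul_sum, Finset.mul_sum]
  have e : ∀ i : T.Node, ((d : ENNReal) + 1) * (ENNReal.ofReal (T.mass i) * F i) =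
      ∑ K ∈ T.elems with (i : Space d) ∈ K, volume (cell K) * F i := by
    intro i
    rw [← Finset.sum_mul, ← hp, ← ofReal_mass]
    ring
  simp_rw [e]
  rw [sum_node_sum_elem]
  refine Finset.sum_le_sum fun K hK => ?_
  calc ∑ i : T.Node, (if (i : Space d) ∈ K then volume (cell K) * F i else 0)
      ≤ ∑ i : T.Node, (if (i : Space d) ∈ K then Φ K else 0) := by
        refine Finset.sum_le_sum fun i _ => ?_
        split_ifs with hi
        · exact h K hK i hi
        · exact le_rfl
    _ = (d + 1) * Φ K := by
        rw [T.sum_node_const hK, nsmul_eq_mul]; push_cast; ring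

theorem sum_ofReal_mass_sq_le {Ω : Set (Space d)} (hT : T.Triangulates Ω)
    (hΩ : interior (closure Ω) = Ω) (U : T.Node → ℝ) (c : ℝ) :
    ∑ i, ENNReal.ofReal (T.mass i) * ‖U i - c‖ₑ ^ 2 ≤
      (8 * 2 ^ d + 2) * ∫⁻ x in Ω, ‖T.lagrange U x - c‖ₑ ^ 2 := by
  refine (T.sum_ofReal_mass_mul_le fun K hK i hi => T.volume_cell_mul_sq_le U c hK hi).trans ?_
  rw [← Finset.mul_sum, T.restrict_domain hT hΩ, lintegral_finsetSum_measure]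

/-- The discrete Poincaré inequality with lumped masses. -/
theorem exists_discrete_poincare {Ω : Set (Space d)} (hc : IsPreconnected Ω)
    (hΩ : interior (closure Ω) = Ω) : ∃ C : ℝ, 0 ≤ C ∧ ∀ T : SimplicialMesh d,
      T.Triangulates Ω → ∀ U : T.Node → ℝ,
        ∑ i, ∑ j, T.mass i * T.mass j * (U i - U j) ^ 2 ≤
          C * ∑ K ∈ T.elems, volume.real (cell K) * ‖T.elemGrad U K‖ ^ 2 := by
  obtain ⟨C, hC, h⟩ := exists_poincare hc hΩ
  set c : ENNReal := 8 * 2 ^ d + 2 with hcdef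
  have hctop : c ≠ ⊤ := by
    rw [hcdef]
    exact ENNReal.add_ne_top.2 ⟨ENNReal.mul_ne_top (by simp) (ENNReal.pow_ne_top (by simp)), by simp⟩
  have hCtop : c * (c * C) ≠ ⊤ := ENNReal.mul_ne_top hctop (ENNReal.mul_ne_top hctop hC)
  refine ⟨(c * (c * C)).toReal, ENNReal.toReal_nonneg, fun T hT U => ?_⟩
  set m : T.Node → ENNReal := fun i => ENNReal.ofReal (T.mass i) with hm
  have hu := T.measurable_lagrange U
  have h1 : ∑ j, m j * ∑ i, m i * ‖U i - U j‖ₑ ^ 2 ≤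
      c * (c * C) * ∑ K ∈ T.elems, volume (cell K) * ‖T.elemGrad U K‖ₑ ^ 2 := by
    -- The lumping estimate is used twice: in `i` with the constant `U j`, then in `j` with the
    -- constant `u(x)`.
    calc ∑ j, m j * ∑ i, m i * ‖U i - U j‖ₑ ^ 2
        ≤ ∑ j, m j * (c * ∫⁻ x in Ω, ‖T.lagrange U x - U j‖ₑ ^ 2) := by
          gcongr with j _
          exact T.sum_ofReal_mass_sq_le hT hΩ U (U j)
      _ = c * ∫⁻ x in Ω, ∑ j, m j * ‖U j - T.lagrange U x‖ₑ ^ 2 := by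
          have hmeas : ∀ j, Measurable fun x => ‖U j - T.lagrange U x‖ₑ ^ 2 := fun j =>
            ((hu.const_sub (U j)).enorm).pow_const 2
          rw [lintegral_finsetSum _ fun j _ => (hmeas j).const_mul _, Finset.mul_sum]
          refine Finset.sum_congr rfl fun j _ => ?_
          rw [lintegral_const_mul _ (hmeas j)]
          simp_rw [enorm_sub_rev (U j)]
          ring
      _ ≤ c * ∫⁻ x in Ω, c * ∫⁻ y in Ω, ‖T.lagrange U y - T.lagrange U x‖ₑ ^ 2 := by
          gcongr with x
          exact T.sum_ofReal_mass_sq_le hT hΩ U _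
      _ = c * (c * ∫⁻ x in Ω, ∫⁻ y in Ω, ‖T.lagrange U x - T.lagrange U y‖ₑ ^ 2) := by
          rw [lintegral_const_mul' _ _ hctop]
          simp_rw [fun x y => enorm_sub_rev (T.lagrange U y) (T.lagrange U x)]
      _ ≤ c * (c * (C * ∑ K ∈ T.elems, volume (cell K) * ‖T.elemGrad U K‖ₑ ^ 2)) := by
          gcongr
          exact h T hT U
      _ = _ := by ring
  have e1 : ∑ j, m j * ∑ i, m i * ‖U i - U j‖ₑ ^ 2 =
      ENNReal.ofReal (∑ i, ∑ j, T.mass i * T.mass j * (U i - U j) ^ 2) := by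
    have hmn : ∀ i, 0 ≤ T.mass i := fun i => (T.mass_pos i).le
    rw [Finset.sum_comm, ENNReal.ofReal_sum_of_nonneg fun j _ => Finset.sum_nonneg fun i _ =>
      mul_nonneg (mul_nonneg (hmn i) (hmn j)) (sq_nonneg _)]
    refine Finset.sum_congr rfl fun j _ => ?_
    rw [ENNReal.ofReal_sum_of_nonneg fun i _ =>
      mul_nonneg (mul_nonneg (hmn i) (hmn j)) (sq_nonneg _), Finset.mul_sum]
    refine Finset.sum_congr rfl fun i _ => ?_
    rw [ENNReal.ofReal_mul (mul_nonneg (hmn i) (hmn j)), ENNReal.ofReal_mul (hmn i),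
      ← ofReal_norm (U i - U j), ← ENNReal.ofReal_pow (norm_nonneg _), Real.norm_eq_abs, sq_abs]
    ring
  have e2 : ∑ K ∈ T.elems, volume (cell K) * ‖T.elemGrad U K‖ₑ ^ 2 =
      ENNReal.ofReal (∑ K ∈ T.elems, volume.real (cell K) * ‖T.elemGrad U K‖ ^ 2) := by
    rw [ENNReal.ofReal_sum_of_nonneg fun K _ => mul_nonneg measureReal_nonneg (sq_nonneg _)]
    refine Finset.sum_congr rfl fun K _ => ?_
    rw [ENNReal.ofReal_mul measureReal_nonneg, ENNReal.ofReal_pow (norm_nonneg _), ofReal_norm,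
      Measure.real, ENNReal.ofReal_toReal (volume_cell_ne_top K)]
  rw [e1, e2, ← ENNReal.ofReal_toReal hCtop, ← ENNReal.ofReal_mul ENNReal.toReal_nonneg] at h1
  refine (ENNReal.ofReal_le_ofReal_iff ?_).1 h1
  exact mul_nonneg ENNReal.toReal_nonneg
    (Finset.sum_nonneg fun K _ => mul_nonneg measureReal_nonneg (sq_nonneg _))

end SimplicialMesh

/-! ### The discrete source terms -/

/-- This is the nonnegativity of the variance, with `c` the mean value. -/
theorem sq_integral_le {α : Type*} [MeasurableSpace α] (μ : Measure α) [IsFiniteMeasure μ]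
    (h0 : 0 < μ.real Set.univ) {q : α → ℝ} (h1 : Integrable q μ)
    (h2 : Integrable (fun x => q x ^ 2) μ) :
    (∫ x, q x ∂μ) ^ 2 ≤ μ.real Set.univ * ∫ x, q x ^ 2 ∂μ := by
  set M := μ.real Set.univ
  set c := (∫ x, q x ∂μ) / M with hc
  have h : 0 ≤ ∫ x, (q x - c) ^ 2 ∂μ := integral_nonneg fun x => sq_nonneg _
  have e : ∀ x, (q x - c) ^ 2 = q x ^ 2 - 2 * c * q x + c ^ 2 := fun x => by ring
  simp_rw [e] at h
  have i1 : Integrable (fun x => 2 * c * q x) μ := h1.const_mul _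
  have i2 : Integrable (fun x => q x ^ 2 - 2 * c * q x) μ := h2.sub i1
  rw [integral_add i2 (integrable_const _), integral_sub h2 i1, integral_const_mul, integral_const, smul_eq_mul] at h
  have hcM : c * M = ∫ x, q x ∂μ := div_mul_cancel₀ _ h0.ne'
  rw [← hcM] at h ⊢
  change 0 ≤ _ - _ + M * c ^ 2 at h
  nlinarith

namespace FlowData

variable {d : ℕ} {D : FlowData d}

namespace Admissible

variable (hD : D.Admissible)
include hD

theorem isOpen_Ω : IsOpen D.Ω := hD.regular ▸ isOpen_interior

theorem measure_Ω_ne_top : volume D.Ω ≠ ⊤ := hD.bounded.measure_lt_top.ne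

theorem volume_real_Ω_pos : 0 < volume.real D.Ω :=
  ENNReal.toReal_pos (hD.isOpen_Ω.measure_pos volume hD.connected.nonempty).ne' hD.measure_Ω_ne_top

theorem step_pos {N : ℕ} (hN : 1 ≤ N) : 0 < D.step N :=
  div_pos hD.tf_pos (by exact_mod_cast hN)

end Admissible

theorem step_mul {N : ℕ} (hN : 1 ≤ N) : (N : ℝ) * D.step N = D.tf := by
  have : (N : ℝ) ≠ 0 := by positivity
  rw [step]; field_simp

/-- Lebesgue measure on the `n`-th time interval `]t_{n-1}, t_n]`. -/
def slab (D : FlowData d) (N n : ℕ) : Measure ℝ :=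
  volume.restrict (Set.Ioc (((n : ℝ) - 1) * D.step N) ((n : ℝ) * D.step N))

theorem cylinder_eq : D.cylinder =
    (volume.restrict D.Ω).prod (volume.restrict (Set.Ioo 0 D.tf)) := by
  rw [cylinder, Measure.volume_eq_prod, Measure.prod_restrict]

instance (N n : ℕ) : IsFiniteMeasure (D.slab N n) := by unfold slab; infer_instance

theorem slab_le (hD : D.Admissible) {N n : ℕ} (hN : 1 ≤ N) (hn : n ∈ Set.Icc 1 N) :
    D.slab N n ≤ volume.restrict (Set.Ioo 0 D.tf) := by
  rw [Measure.restrict_congr_set (Ioo_ae_eq_Ioc (a := (0 : ℝ)) (b := D.tf)), slab]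
  refine Measure.restrict_mono (Set.Ioc_subset_Ioc ?_ ?_) le_rfl
  · refine mul_nonneg ?_ (hD.step_pos hN).le
    have : (1 : ℝ) ≤ n := by exact_mod_cast hn.1
    linarith
  · rw [← step_mul hN]
    have : (n : ℝ) ≤ N := by exact_mod_cast hn.2
    exact mul_le_mul_of_nonneg_right this (hD.step_pos hN).le

theorem prod_slab_le (hD : D.Admissible) {N n : ℕ} (hN : 1 ≤ N) (hn : n ∈ Set.Icc 1 N) :
    (volume.restrict D.Ω).prod (D.slab N n) ≤ D.cylinder := by
  rw [cylinder_eq]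
  exact Measure.prod_mono le_rfl (slab_le hD hN hn)

theorem slab_real_univ (hD : D.Admissible) {N : ℕ} (hN : 1 ≤ N) (n : ℕ) :
    (D.slab N n).real Set.univ = D.step N := by
  have h := (hD.step_pos hN).le
  rw [slab, Measure.real, Measure.restrict_apply_univ, Real.volume_Ioc, ENNReal.toReal_ofReal]
  · ring
  · linarith

theorem timeMean_eq (hD : D.Admissible) {N : ℕ} (hN : 1 ≤ N) (f : ℝ → ℝ) (n : ℕ) :
    timeMean (D.step N) f n = (∫ t, f t ∂D.slab N n) / D.step N := by
  rw [timeMean, intervalIntegral.integral_of_le, slab]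
  have := hD.step_pos hN
  linarith

/-- A mesh of the domain of an admissible data set. -/
structure IsMesh (D : FlowData d) (T : SimplicialMesh d) : Prop where
  triangulates : T.Triangulates D.Ω
  regular : interior (closure D.Ω) = D.Ω

theorem IsMesh.patch_prod_slab_le {T : SimplicialMesh d} (hT : D.IsMesh T) (N n : ℕ) (i : T.Node) :
    (volume.restrict (T.patch i)).prod (D.slab N n) ≤ (volume.restrict D.Ω).prod (D.slab N n) :=
  Measure.prod_mono (T.restrict_patch_le hT.triangulates hT.regular i) le_rfl

theorem IsMesh.sum_integral_patch_prod {T : SimplicialMesh d} (hT : D.IsMesh T) {N n : ℕ}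
    {g : Space d × ℝ → ℝ}
    (hg : Integrable g ((volume.restrict D.Ω).prod (D.slab N n))) :
    ∑ i, ∫ p, g p ∂((volume.restrict (T.patch i)).prod (D.slab N n)) =
      (d + 1) * ∫ p, g p ∂((volume.restrict D.Ω).prod (D.slab N n)) := by
  have hfin : ∀ i, IsFiniteMeasure (volume.restrict (T.patch i)) := fun i =>
    ⟨by rw [Measure.restrict_apply_univ]; exact (T.isCompact_patch i).measure_lt_top⟩
  have hi : ∀ i, Integrable g ((volume.restrict (T.patch i)).prod (D.slab N n)) := fun i =>
    hg.mono_measure (hT.patch_prod_slab_le N n i)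
  have e : ∀ i, ∫ p, g p ∂((volume.restrict (T.patch i)).prod (D.slab N n)) =
      ∫ x in T.patch i, ∫ t, g (x, t) ∂D.slab N n := fun i => integral_prod _ (hi i)
  simp_rw [e]
  rw [T.sum_integral_patch hT.triangulates hT.regular hg.integral_prod_left, integral_prod _ hg]

theorem nodalMean_mul_mass (T : SimplicialMesh d) (g : Space d → ℝ) (i : T.Node) :
    T.mass i * T.nodalMean g i = (∫ x in T.patch i, g x) / (d + 1) := by
  have := (T.volume_real_patch_pos i).ne'
  rw [SimplicialMesh.mass, SimplicialMesh.nodalMean]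
  field_simp

/-- Interpolation by mean values preserves the integral. -/
theorem IsMesh.integral_lagrange_nodalMean_sub {T : SimplicialMesh d} (hT : D.IsMesh T)
    {g : Space d → ℝ} (hg : IntegrableOn g D.Ω) :
    ∫ x in D.Ω, (T.lagrange (T.nodalMean g) x - g x) = 0 := by
  rw [integral_sub _ hg, T.integral_lagrange hT.triangulates hT.regular]
  · simp_rw [nodalMean_mul_mass]
    rw [← Finset.sum_div, T.sum_integral_patch hT.triangulates hT.regular hg]
    field_simp
    ring
  · exact T.integrableOn_domain hT.triangulates hT.regular fun K hK =>
      T.integrableOn_lagrange_cell _ hK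

/-- The discrete rates are space-time averages. -/
theorem rateDisc_eq (hD : D.Admissible) {T : SimplicialMesh d} (hT : D.IsMesh T) {N n : ℕ}
    (hN : 1 ≤ N) {q : Space d → ℝ → ℝ}
    (hq : Integrable (fun p : Space d × ℝ => q p.1 p.2)
      ((volume.restrict D.Ω).prod (D.slab N n))) (i : T.Node) :
    D.rateDisc T N q n i =
      (∫ p, q p.1 p.2 ∂((volume.restrict (T.patch i)).prod (D.slab N n))) /
        (volume.real (T.patch i) * D.step N) := by
  have hfin : IsFiniteMeasure (volume.restrict D.Ω) :=
    ⟨by rw [Measure.restrict_apply_univ]; exact hD.bounded.measure_lt_top⟩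
  have hfin' : IsFiniteMeasure (volume.restrict (T.patch i)) :=
    ⟨by rw [Measure.restrict_apply_univ]; exact (T.isCompact_patch i).measure_lt_top⟩
  have hi := hq.mono_measure (hT.patch_prod_slab_le N n i)
  rw [rateDisc, timeMean_eq hD hN, integral_prod_symm _ hi]
  have h : ∀ᵐ t ∂D.slab N n, T.nodalMean (fun x => q x t) i -
      (∫ x in D.Ω, (T.lagrange (T.nodalMean (fun y => q y t)) x - q x t)) / volume.real D.Ω =
      (∫ x in T.patch i, q x t) / volume.real (T.patch i) := by
    -- For almost every `t` the time slice is integrable; interpolation by means preserves its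
    -- integral, so the correction term vanishes.
    filter_upwards [hq.prod_left_ae] with t ht
    rw [hT.integral_lagrange_nodalMean_sub ht, zero_div, sub_zero]
    rfl
  rw [integral_congr_ae h, integral_div, div_div]

theorem sum_mass_mul_rateDisc (hD : D.Admissible) {T : SimplicialMesh d} (hT : D.IsMesh T)
    {N n : ℕ} (hN : 1 ≤ N) {q : Space d → ℝ → ℝ}
    (hq : Integrable (fun p : Space d × ℝ => q p.1 p.2)
      ((volume.restrict D.Ω).prod (D.slab N n))) :
    ∑ i, T.mass i * D.rateDisc T N q n i =
      (∫ p, q p.1 p.2 ∂((volume.restrict D.Ω).prod (D.slab N n))) / D.step N := by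
  have hτ := (hD.step_pos hN).ne'
  have e : ∀ i, T.mass i * D.rateDisc T N q n i =
      (∫ p, q p.1 p.2 ∂((volume.restrict (T.patch i)).prod (D.slab N n))) /
        ((d + 1) * D.step N) := by
    intro i
    have := (T.volume_real_patch_pos i).ne'
    rw [rateDisc_eq hD hT hN hq, SimplicialMesh.mass]
    field_simp
  simp_rw [e]
  rw [← Finset.sum_div, hT.sum_integral_patch_prod hq]
  field_simp

theorem rateDisc_nonneg (hD : D.Admissible) {T : SimplicialMesh d} (hT : D.IsMesh T)
    {N n : ℕ} (hN : 1 ≤ N) (hn : n ∈ Set.Icc 1 N) {q : Space d → ℝ → ℝ}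
    (hq : Integrable (fun p : Space d × ℝ => q p.1 p.2) D.cylinder)
    (h0 : ∀ᵐ p ∂D.cylinder, 0 ≤ q p.1 p.2) (i : T.Node) : 0 ≤ D.rateDisc T N q n i := by
  rw [rateDisc_eq hD hT hN (hq.mono_measure (prod_slab_le hD hN hn))]
  refine div_nonneg (integral_nonneg_of_ae ?_)
    (mul_nonneg measureReal_nonneg (hD.step_pos hN).le)
  exact ae_mono ((hT.patch_prod_slab_le N n i).trans (prod_slab_le hD hN hn)) h0

/-- Jensen's inequality on each patch times the time interval; the factor `1 / (d + 1)` in the mass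
cancels the overlap of the patches. -/
theorem step_mul_sum_mass_mul_rateDisc_sq_le (hD : D.Admissible) {T : SimplicialMesh d}
    (hT : D.IsMesh T) {N n : ℕ} (hN : 1 ≤ N) {q : Space d → ℝ → ℝ}
    (hq : Integrable (fun p : Space d × ℝ => q p.1 p.2)
      ((volume.restrict D.Ω).prod (D.slab N n)))
    (hq2 : Integrable (fun p : Space d × ℝ => q p.1 p.2 ^ 2)
      ((volume.restrict D.Ω).prod (D.slab N n))) :
    D.step N * ∑ i, T.mass i * D.rateDisc T N q n i ^ 2 ≤
      ∫ p, q p.1 p.2 ^ 2 ∂((volume.restrict D.Ω).prod (D.slab N n)) := by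
  have hτ := hD.step_pos hN
  have e : ∀ i, D.step N * (T.mass i * D.rateDisc T N q n i ^ 2) ≤
      (∫ p, q p.1 p.2 ^ 2 ∂((volume.restrict (T.patch i)).prod (D.slab N n))) / (d + 1) := by
    intro i
    have hfin' : IsFiniteMeasure (volume.restrict (T.patch i)) :=
      ⟨by rw [Measure.restrict_apply_univ]; exact (T.isCompact_patch i).measure_lt_top⟩
    have hpos := T.volume_real_patch_pos i
    have hM : ((volume.restrict (T.patch i)).prod (D.slab N n)).real Set.univ =
        volume.real (T.patch i) * D.step N := by
      rw [← slab_real_univ hD hN n, ← Set.univ_prod_univ, measureReal_prod_prod]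
      simp
    have h := sq_integral_le ((volume.restrict (T.patch i)).prod (D.slab N n))
      (by rw [hM]; positivity) (hq.mono_measure (hT.patch_prod_slab_le N n i))
      (hq2.mono_measure (hT.patch_prod_slab_le N n i))
    rw [hM] at h
    rw [rateDisc_eq hD hT hN hq, SimplicialMesh.mass, div_pow, le_div_iff₀ (by positivity)]
    set J := ∫ p, q p.1 p.2 ∂((volume.restrict (T.patch i)).prod (D.slab N n))
    have e2 : D.step N * (volume.real (T.patch i) / (d + 1) *
        (J ^ 2 / (volume.real (T.patch i) * D.step N) ^ 2)) * (d + 1) =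
        J ^ 2 / (volume.real (T.patch i) * D.step N) := by
      field_simp
    rw [e2, div_le_iff₀ (by positivity)]
    linarith
  rw [Finset.mul_sum]
  refine (Finset.sum_le_sum fun i _ => e i).trans (le_of_eq ?_)
  rw [← Finset.sum_div, hT.sum_integral_patch_prod hq2]
  field_simp

theorem sum_integral_slab (hD : D.Admissible) {N : ℕ} (hN : 1 ≤ N) {g : Space d × ℝ → ℝ}
    (hg : Integrable g D.cylinder) :
    ∑ n ∈ Finset.Icc 1 N, ∫ p, g p ∂((volume.restrict D.Ω).prod (D.slab N n)) =
      ∫ p, g p ∂D.cylinder := by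
  have hfin : IsFiniteMeasure (volume.restrict D.Ω) :=
    ⟨by rw [Measure.restrict_apply_univ]; exact hD.bounded.measure_lt_top⟩
  have hτ := hD.step_pos hN
  set Q : ℝ → ℝ := fun t => ∫ x in D.Ω, g (x, t) with hQ
  have hQi : IntegrableOn Q (Set.Ioc 0 D.tf) := by
    rw [IntegrableOn, ← Measure.restrict_congr_set (Ioo_ae_eq_Ioc (a := (0 : ℝ)) (b := D.tf))]
    rw [cylinder_eq] at hg
    exact hg.integral_prod_right
  have e1 : ∫ p, g p ∂D.cylinder = ∫ t in (0 : ℝ)..D.tf, Q t := by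
    rw [intervalIntegral.integral_of_le hD.tf_pos.le,
      ← Measure.restrict_congr_set (Ioo_ae_eq_Ioc (a := (0 : ℝ)) (b := D.tf)), cylinder_eq,
      integral_prod_symm]
    rwa [cylinder_eq] at hg
  have e2 : ∀ n ∈ Finset.Icc 1 N, ∫ p, g p ∂((volume.restrict D.Ω).prod (D.slab N n)) =
      ∫ t in (((n : ℝ) - 1) * D.step N)..((n : ℝ) * D.step N), Q t := by
    intro n hn
    rw [intervalIntegral.integral_of_le (by linarith),
      integral_prod_symm _ (hg.mono_measure (prod_slab_le hD hN (Finset.mem_Icc.1 hn)))]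
    rfl
  rw [e1, Finset.sum_congr rfl e2]
  have h := intervalIntegral.sum_integral_adjacent_intervals (f := Q) (μ := volume)
    (a := fun k : ℕ => (k : ℝ) * D.step N) (n := N) fun k hk => by
      rw [intervalIntegrable_iff_integrableOn_Ioc_of_le (by push_cast; linarith)]
      refine hQi.mono_set (Set.Ioc_subset_Ioc (by positivity) ?_)
      rw [← step_mul hN]
      have : ((k + 1 : ℕ) : ℝ) ≤ N := by exact_mod_cast hk
      exact mul_le_mul_of_nonneg_right this hτ.le
  rw [step_mul hN] at h
  simp only [Nat.cast_zero, zero_mul] at h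
  rw [← h, Finset.range_eq_Ico, Finset.sum_Ico_eq_sum_range, ← Finset.Ico_add_one_right_eq_Icc,
    Finset.sum_Ico_eq_sum_range]
  refine Finset.sum_congr (by simp) fun k _ => ?_
  push_cast
  congr 1 <;> ring

theorem nodalMean_mem_Icc {T : SimplicialMesh d} (hT : D.IsMesh T) {g : Space d → ℝ}
    (hm : AEStronglyMeasurable g (volume.restrict D.Ω))
    (hb : ∀ᵐ x ∂(volume.restrict D.Ω), 0 ≤ g x ∧ g x ≤ 1) (i : T.Node) :
    T.nodalMean g i ∈ Set.Icc (0 : ℝ) 1 := by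
  have hle := T.restrict_patch_le hT.triangulates hT.regular i
  have hb' : ∀ᵐ x ∂(volume.restrict (T.patch i)), 0 ≤ g x ∧ g x ≤ 1 := ae_mono hle hb
  have hfin' : IsFiniteMeasure (volume.restrict (T.patch i)) :=
    ⟨by rw [Measure.restrict_apply_univ]; exact (T.isCompact_patch i).measure_lt_top⟩
  have hi : Integrable g (volume.restrict (T.patch i)) := by
    refine Integrable.of_bound (hm.mono_measure hle) 1 ?_
    filter_upwards [hb'] with x hx
    rw [Real.norm_eq_abs, abs_of_nonneg hx.1]
    exact hx.2
  refine ⟨div_nonneg (integral_nonneg_of_ae (hb'.mono fun x hx => hx.1)) measureReal_nonneg, ?_⟩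
  rw [SimplicialMesh.nodalMean, div_le_one (T.volume_real_patch_pos i)]
  calc ∫ x in T.patch i, g x ≤ ∫ _ in T.patch i, (1 : ℝ) :=
        integral_mono_ae hi (integrable_const 1) (hb'.mono fun x hx => hx.2)
    _ = volume.real (T.patch i) := by simp

end FlowData

/-! ### One time step of the scheme -/

theorem sum_sum_antisymm {ι : Type*} [Fintype ι] {k : ι → ι → ℝ} (hk : ∀ i j, k i j = k j i)
    (p : ι → ℝ) : ∑ i, ∑ j, k i j * (p j - p i) = 0 := by
  have h : ∑ i, ∑ j, k i j * (p j - p i) = -∑ i, ∑ j, k i j * (p j - p i) := by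
    conv_lhs => rw [Finset.sum_comm]
    rw [← Finset.sum_neg_distrib]
    refine Finset.sum_congr rfl fun i _ => ?_
    rw [← Finset.sum_neg_distrib]
    refine Finset.sum_congr rfl fun j _ => ?_
    rw [hk]; ring
  linarith

/-- Discrete integration by parts, by averaging the sum with its copy in which `i` and `j` are
exchanged. -/
theorem sum_mul_sum_symm {ι : Type*} [Fintype ι] {k : ι → ι → ℝ} (hk : ∀ i j, k i j = k j i)
    (p : ι → ℝ) : ∑ i, (∑ j, k i j * (p j - p i)) * p i =
      -(∑ i, ∑ j, k i j * (p i - p j) ^ 2) / 2 := by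
  have h1 : ∑ i, (∑ j, k i j * (p j - p i)) * p i = ∑ i, ∑ j, k i j * ((p j - p i) * p i) := by
    refine Finset.sum_congr rfl fun i _ => ?_
    rw [Finset.sum_mul]
    exact Finset.sum_congr rfl fun j _ => by ring
  have h2 : ∑ i, ∑ j, k i j * ((p j - p i) * p i) =
      ∑ i, ∑ j, k i j * ((p i - p j) * p j) := by
    rw [Finset.sum_comm]
    exact Finset.sum_congr rfl fun i _ => Finset.sum_congr rfl fun j _ => by rw [hk]
  have h3 : ∑ i, ∑ j, k i j * (p i - p j) ^ 2 =
      -(∑ i, ∑ j, k i j * ((p j - p i) * p i)) - ∑ i, ∑ j, k i j * ((p i - p j) * p j) := by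
    rw [← Finset.sum_neg_distrib, ← Finset.sum_sub_distrib]
    refine Finset.sum_congr rfl fun i _ => ?_
    rw [← Finset.sum_neg_distrib, ← Finset.sum_sub_distrib]
    exact Finset.sum_congr rfl fun j _ => by ring
  rw [h1, h3, ← h2]
  ring

/-- Weighted Young inequality for a source with vanishing mean. -/
theorem sum_mul_le_of_sum_eq_zero {ι : Type*} [Fintype ι] {m r U : ι → ℝ} (hm : ∀ i, 0 ≤ m i)
    (hr : ∑ i, m i * r i = 0) {A : ℝ} (hA : 0 < A) :
    (∑ i, m i) * ∑ i, m i * (r i * U i) ≤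
      A / 2 * ((∑ i, m i) * ∑ i, m i * r i ^ 2) +
        (∑ i, ∑ j, m i * m j * (U i - U j) ^ 2) / (2 * A) := by
  -- The vanishing mean of `r` allows the subtraction of `U j`, so only differences of `U` remain.
  have e1 : (∑ i, m i) * ∑ i, m i * (r i * U i) = ∑ i, ∑ j, m i * m j * (r i * (U i - U j)) := by
    have z : ∑ i, ∑ j, m i * m j * (r i * U j) = 0 := by
      have : ∀ i, ∑ j, m i * m j * (r i * U j) = m i * r i * ∑ j, m j * U j := fun i => by
        rw [Finset.mul_sum]; exact Finset.sum_congr rfl fun j _ => by ring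
      simp_rw [this]
      rw [← Finset.sum_mul, hr, zero_mul]
    have : ∑ i, ∑ j, m i * m j * (r i * (U i - U j)) =
        ∑ i, ∑ j, m i * m j * (r i * U i) - ∑ i, ∑ j, m i * m j * (r i * U j) := by
      simp_rw [← Finset.sum_sub_distrib]
      exact Finset.sum_congr rfl fun i _ => Finset.sum_congr rfl fun j _ => by ring
    rw [this, z, sub_zero, Finset.sum_mul_sum, Finset.sum_comm]
    exact Finset.sum_congr rfl fun i _ => Finset.sum_congr rfl fun j _ => by ring
  have e2 : (∑ i, m i) * ∑ i, m i * r i ^ 2 = ∑ i, ∑ j, m i * m j * r i ^ 2 := by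
    rw [Finset.sum_mul_sum, Finset.sum_comm]
    exact Finset.sum_congr rfl fun i _ => Finset.sum_congr rfl fun j _ => by ring
  rw [e1, e2, Finset.mul_sum, Finset.sum_div, ← Finset.sum_add_distrib]
  refine Finset.sum_le_sum fun i _ => ?_
  rw [Finset.mul_sum, Finset.sum_div, ← Finset.sum_add_distrib]
  refine Finset.sum_le_sum fun j _ => ?_
  have h : r i * (U i - U j) ≤ A / 2 * r i ^ 2 + (U i - U j) ^ 2 / (2 * A) := by
    have : A / 2 * r i ^ 2 + (U i - U j) ^ 2 / (2 * A) - r i * (U i - U j) =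
        (A * r i - (U i - U j)) ^ 2 / (2 * A) := by field_simp; ring
    have h2 : 0 ≤ (A * r i - (U i - U j)) ^ 2 / (2 * A) := by positivity
    linarith
  calc m i * m j * (r i * (U i - U j))
      ≤ m i * m j * (A / 2 * r i ^ 2 + (U i - U j) ^ 2 / (2 * A)) :=
        mul_le_mul_of_nonneg_left h (mul_nonneg (hm i) (hm j))
    _ = _ := by ring

/-- The equations of one time step, with the accumulation coefficients `a`, the masses `m`, the
stiffness coefficients `c`, the previous saturation `s'` and the rates `qi`, `qo`. -/
structure StepSolution {d : ℕ} (D : FlowData d) {ι : Type*} [Fintype ι] (a m : ι → ℝ)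
    (c : ι → ι → ℝ) (s s' pw po sin qi qo : ι → ℝ) : Prop where
  a_pos : ∀ i, 0 < a i
  m_pos : ∀ i, 0 < m i
  c_symm : ∀ i j, c i j = c j i
  c_nonneg : ∀ i j, 0 ≤ c i j
  qi_nonneg : ∀ i, 0 ≤ qi i
  qo_nonneg : ∀ i, 0 ≤ qo i
  balance : ∑ i, m i * qi i = ∑ i, m i * qo i
  wetting : ∀ i, a i * (s i - s' i)
      - ∑ j, c i j * extendConst D.ηw (upwindW (s i) (s j) (pw i) (pw j)) * (pw j - pw i)
      = m i * (extendConst D.fw (sin i) * qi i - extendConst D.fw (s i) * qo i)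
  nonwetting : ∀ i, -(a i) * (s i - s' i)
      - ∑ j, c i j * extendConst D.ηo (upwindO (s i) (s j) (po i) (po j)) * (po j - po i)
      = m i * (extendConst D.fo (sin i) * qi i - extendConst D.fo (s i) * qo i)
  capillary : ∀ i, po i - pw i = extendConst D.pc (s i)

/-- The discrete equation of the wetting phase at the last node follows from the others. -/
theorem wetting_of_ne {d : ℕ} (D : FlowData d) {ι : Type*} [Fintype ι] {a m : ι → ℝ}
    {c : ι → ι → ℝ} {s s' pw po sin qi qo : ι → ℝ} (hc : ∀ i j, c i j = c j i)
    (hq : ∑ i, m i * qi i = ∑ i, m i * qo i) (last : ι)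
    (hw : ∀ i, i ≠ last → a i * (s i - s' i)
      - ∑ j, c i j * extendConst D.ηw (upwindW (s i) (s j) (pw i) (pw j)) * (pw j - pw i)
      = m i * (extendConst D.fw (sin i) * qi i - extendConst D.fw (s i) * qo i))
    (ho : ∀ i, -(a i) * (s i - s' i)
      - ∑ j, c i j * extendConst D.ηo (upwindO (s i) (s j) (po i) (po j)) * (po j - po i)
      = m i * (extendConst D.fo (sin i) * qi i - extendConst D.fo (s i) * qo i)) (i : ι) :
    a i * (s i - s' i)
      - ∑ j, c i j * extendConst D.ηw (upwindW (s i) (s j) (pw i) (pw j)) * (pw j - pw i)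
      = m i * (extendConst D.fw (sin i) * qi i - extendConst D.fw (s i) * qo i) := by
  classical
  set R : ι → ℝ := fun i => (a i * (s i - s' i)
      - ∑ j, c i j * extendConst D.ηw (upwindW (s i) (s j) (pw i) (pw j)) * (pw j - pw i))
      - m i * (extendConst D.fw (sin i) * qi i - extendConst D.fw (s i) * qo i) with hR
  have hf : ∀ x, extendConst D.fo x = 1 - extendConst D.fw x := fun x => rfl
  -- Adding the nonwetting equations cancels the accumulation terms. Summed over the nodes, the
  -- fluxes then cancel by symmetry and the sources by the balance of the rates. Hence one vanishing
  -- residual is implied by the others.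
  have h1 : ∑ i, R i = 0 := by
    have e : ∀ i, R i = -(∑ j, c i j * extendConst D.ηw (upwindW (s i) (s j) (pw i) (pw j))
        * (pw j - pw i)) - (∑ j, c i j * extendConst D.ηo (upwindO (s i) (s j) (po i) (po j))
        * (po j - po i)) - (m i * qi i - m i * qo i) := by
      intro i
      have h := ho i
      rw [hf, hf] at h
      simp only [hR]
      linarith
    simp_rw [e]
    rw [Finset.sum_sub_distrib, Finset.sum_sub_distrib, Finset.sum_sub_distrib,
      Finset.sum_neg_distrib, sum_sum_antisymm, sum_sum_antisymm, hq]
    · ring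
    · intro i j; rw [hc, upwindO_symm]
    · intro i j; rw [hc, upwindW_symm]
  by_cases hi : i = last
  · rw [Finset.sum_eq_single last (fun j _ hj => sub_eq_zero.2 (hw j hj))
      (fun h => absurd (Finset.mem_univ _) h), ← hi] at h1
    exact sub_eq_zero.1 h1
  · exact hw i hi

/-! ### Monotonicity of the upwind fluxes -/

section Upwind

variable {d : ℕ} {D : FlowData d} (hD : D.Admissible)
include hD

theorem extendConst_ηw_nonneg (x : ℝ) : 0 ≤ extendConst D.ηw x := hD.ηw_nonneg _ (clamp_mem x)

theorem extendConst_ηo_nonneg (x : ℝ) : 0 ≤ extendConst D.ηo x := hD.ηo_nonneg _ (clamp_mem x)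

/-- If the flux enters node `i`, the upwind mobility is that of `sj` and is the larger one; if it
leaves, the mobility is that of `si` and equality holds. -/
theorem upwindW_flux_ge {si sj pi pj : ℝ} (h : si ≤ sj) :
    extendConst D.ηw si * (pj - pi) ≤ extendConst D.ηw (upwindW si sj pi pj) * (pj - pi) := by
  rcases lt_trichotomy pi pj with hp | hp | hp
  · rw [upwindW, if_neg hp.not_gt, if_pos hp]
    exact mul_le_mul_of_nonneg_right (hD.ηw_mono.extendConst h) (by linarith)
  · rw [hp]; simp
  · rw [upwindW, if_pos hp]

theorem upwindW_flux_le {si sj pi pj : ℝ} (h : sj ≤ si) :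
    extendConst D.ηw (upwindW si sj pi pj) * (pj - pi) ≤ extendConst D.ηw si * (pj - pi) := by
  rcases lt_trichotomy pi pj with hp | hp | hp
  · rw [upwindW, if_neg hp.not_gt, if_pos hp]
    exact mul_le_mul_of_nonneg_right (hD.ηw_mono.extendConst h) (by linarith)
  · rw [hp]; simp
  · rw [upwindW, if_pos hp]

theorem upwindO_flux_le {si sj pi pj : ℝ} (h : si ≤ sj) :
    extendConst D.ηo (upwindO si sj pi pj) * (pj - pi) ≤ extendConst D.ηo si * (pj - pi) := by
  rcases lt_trichotomy pi pj with hp | hp | hp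
  · rw [upwindO, if_neg hp.not_gt, if_pos hp]
    exact mul_le_mul_of_nonneg_right (hD.ηo_anti.extendConst h) (by linarith)
  · rw [hp]; simp
  · rw [upwindO, if_pos hp]

theorem upwindO_flux_ge {si sj pi pj : ℝ} (h : sj ≤ si) :
    extendConst D.ηo si * (pj - pi) ≤ extendConst D.ηo (upwindO si sj pi pj) * (pj - pi) := by
  rcases lt_trichotomy pi pj with hp | hp | hp
  · rw [upwindO, if_neg hp.not_gt, if_pos hp]
    exact mul_le_mul_of_nonneg_right (hD.ηo_anti.extendConst h) (by linarith)
  · rw [hp]; simp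
  · rw [upwindO, if_pos hp]

end Upwind

/-! ### Maximum principle and energy estimate for one step -/

namespace StepSolution

variable {d : ℕ} {D : FlowData d} {ι : Type*} [Fintype ι] {a m : ι → ℝ}
  {c : ι → ι → ℝ} {s s' pw po sin qi qo : ι → ℝ}

/-- Elimination of the total flow: the saturation equation in fractional flow form. -/
theorem saturation_eq (hD : D.Admissible) (h : StepSolution D a m c s s' pw po sin qi qo) (i : ι) :
    (extendConst D.ηw (s i) + extendConst D.ηo (s i)) * (a i * (s i - s' i)) =
      ∑ j, c i j * (extendConst D.ηo (s i) *
        (extendConst D.ηw (upwindW (s i) (s j) (pw i) (pw j)) * (pw j - pw i)) -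
        extendConst D.ηw (s i) *
          (extendConst D.ηo (upwindO (s i) (s j) (po i) (po j)) * (po j - po i))) +
      (extendConst D.ηw (s i) + extendConst D.ηo (s i)) *
        (m i * qi i * (extendConst D.fw (sin i) - extendConst D.fw (s i))) := by
  have hw := h.wetting i
  have ho := h.nonwetting i
  have hf : ∀ x, extendConst D.fo x = 1 - extendConst D.fw x := fun x => rfl
  have hfw : extendConst D.fw (s i) * (extendConst D.ηw (s i) + extendConst D.ηo (s i)) =
      extendConst D.ηw (s i) := hD.fw_mul_total (clamp_mem (s i))
  rw [hf, hf] at ho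
  set Aw := extendConst D.ηw (s i)
  set Ao := extendConst D.ηo (s i)
  set F := extendConst D.fw (s i)
  have e : ∑ j, c i j * (Ao *
        (extendConst D.ηw (upwindW (s i) (s j) (pw i) (pw j)) * (pw j - pw i)) -
        Aw * (extendConst D.ηo (upwindO (s i) (s j) (po i) (po j)) * (po j - po i))) =
      Ao * (∑ j, c i j * extendConst D.ηw (upwindW (s i) (s j) (pw i) (pw j)) * (pw j - pw i)) -
      Aw * ∑ j, c i j * extendConst D.ηo (upwindO (s i) (s j) (po i) (po j)) * (po j - po i) := by
    rw [Finset.mul_sum, Finset.mul_sum, ← Finset.sum_sub_distrib]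
    exact Finset.sum_congr rfl fun j _ => by ring
  rw [e]
  -- Crosswise multiplication by the mobilities removes the production term, because `f_w` and `f_o`
  -- are proportional to them.
  linear_combination Ao * hw - Aw * ho + m i * (qi i - qo i) * hfw

/-- At a node of minimal saturation the upwind inequalities bound each flux term below by `c η_w η_o
(p_c(s_k) - p_c(s_j)) ≥ 0`. A negative minimum would also make the injection term nonnegative, since
there `f_w` takes its smallest value, while the accumulation term would be negative. -/
theorem nonneg (hD : D.Admissible) (h : StepSolution D a m c s s' pw po sin qi qo)
    (h0 : ∀ i, 0 ≤ s' i) (i : ι) : 0 ≤ s i := by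
  have : Nonempty ι := ⟨i⟩
  obtain ⟨k, hk⟩ := Finite.exists_min s
  refine le_trans ?_ (hk i)
  by_contra! hneg
  have hpos : 0 < extendConst D.ηw (s k) + extendConst D.ηo (s k) := hD.total_pos (clamp_mem _)
  have hsrc : 0 ≤ m k * qi k * (extendConst D.fw (sin k) - extendConst D.fw (s k)) := by
    refine mul_nonneg (mul_nonneg (h.m_pos k).le (h.qi_nonneg k)) (sub_nonneg.2 ?_)
    have e : extendConst D.fw (s k) = extendConst D.fw 0 := by
      rw [extendConst, extendConst, max_eq_left ((min_le_left _ _).trans hneg.le)]; simp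
    rw [e]
    have := hD.fw_monotoneOn (a := 0) (b := max 0 (min (sin k) 1)) (by simp) (clamp_mem _)
      (clamp_mem _).1
    simpa [extendConst] using this
  have hflux : 0 ≤ ∑ j, c k j * (extendConst D.ηo (s k) *
        (extendConst D.ηw (upwindW (s k) (s j) (pw k) (pw j)) * (pw j - pw k)) -
        extendConst D.ηw (s k) *
          (extendConst D.ηo (upwindO (s k) (s j) (po k) (po j)) * (po j - po k))) := by
    refine Finset.sum_nonneg fun j _ => mul_nonneg (h.c_nonneg k j) ?_
    have f1 := mul_le_mul_of_nonneg_left (upwindW_flux_ge hD (pi := pw k) (pj := pw j) (hk j))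
      (extendConst_ηo_nonneg hD (s k))
    have f2 := mul_le_mul_of_nonneg_left (upwindO_flux_le hD (pi := po k) (pj := po j) (hk j))
      (extendConst_ηw_nonneg hD (s k))
    have hpc := hD.pc_anti.antitoneOn.extendConst (hk j)
    rw [← h.capillary, ← h.capillary] at hpc
    have := mul_nonneg (mul_nonneg (extendConst_ηo_nonneg hD (s k))
      (extendConst_ηw_nonneg hD (s k))) (sub_nonneg.2 hpc)
    nlinarith
  have heq := h.saturation_eq hD k
  have h1 : 0 ≤ (extendConst D.ηw (s k) + extendConst D.ηo (s k)) * (a k * (s k - s' k)) := by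
    rw [heq]; exact add_nonneg hflux (mul_nonneg hpos.le hsrc)
  have h2 : a k * (s k - s' k) < 0 := mul_neg_of_pos_of_neg (h.a_pos k) (by linarith [h0 k])
  linarith [mul_neg_of_pos_of_neg hpos h2]

theorem le_one (hD : D.Admissible) (h : StepSolution D a m c s s' pw po sin qi qo)
    (h0 : ∀ i, s' i ≤ 1) (i : ι) : s i ≤ 1 := by
  have : Nonempty ι := ⟨i⟩
  obtain ⟨k, hk⟩ := Finite.exists_max s
  refine (hk i).trans ?_
  by_contra! hneg
  have hpos : 0 < extendConst D.ηw (s k) + extendConst D.ηo (s k) := hD.total_pos (clamp_mem _)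
  have hsrc : m k * qi k * (extendConst D.fw (sin k) - extendConst D.fw (s k)) ≤ 0 := by
    refine mul_nonpos_of_nonneg_of_nonpos (mul_nonneg (h.m_pos k).le (h.qi_nonneg k))
      (sub_nonpos.2 ?_)
    have e : extendConst D.fw (s k) = extendConst D.fw 1 := by
      rw [extendConst, extendConst, min_eq_right hneg.le, min_self]
    rw [e]
    have := hD.fw_monotoneOn (b := 1) (a := max 0 (min (sin k) 1)) (clamp_mem _) (by simp)
      (clamp_mem _).2
    simpa [extendConst] using this
  have hflux : ∑ j, c k j * (extendConst D.ηo (s k) *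
        (extendConst D.ηw (upwindW (s k) (s j) (pw k) (pw j)) * (pw j - pw k)) -
        extendConst D.ηw (s k) *
          (extendConst D.ηo (upwindO (s k) (s j) (po k) (po j)) * (po j - po k))) ≤ 0 := by
    refine Finset.sum_nonpos fun j _ => mul_nonpos_of_nonneg_of_nonpos (h.c_nonneg k j) ?_
    have f1 := mul_le_mul_of_nonneg_left (upwindW_flux_le hD (pi := pw k) (pj := pw j) (hk j))
      (extendConst_ηo_nonneg hD (s k))
    have f2 := mul_le_mul_of_nonneg_left (upwindO_flux_ge hD (pi := po k) (pj := po j) (hk j))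
      (extendConst_ηw_nonneg hD (s k))
    have hpc := hD.pc_anti.antitoneOn.extendConst (hk j)
    rw [← h.capillary, ← h.capillary] at hpc
    have := mul_nonneg (mul_nonneg (extendConst_ηo_nonneg hD (s k))
      (extendConst_ηw_nonneg hD (s k))) (sub_nonneg.2 hpc)
    nlinarith
  have heq := h.saturation_eq hD k
  have h1 : (extendConst D.ηw (s k) + extendConst D.ηo (s k)) * (a k * (s k - s' k)) ≤ 0 := by
    rw [heq]; exact add_nonpos hflux (mul_nonpos_of_nonneg_of_nonpos hpos.le hsrc)
  have h2 : 0 < a k * (s k - s' k) := mul_pos (h.a_pos k) (by linarith [h0 k])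
  linarith [mul_pos hpos h2]

/-- The energy identity of one time step. -/
theorem energy_eq (h : StepSolution D a m c s s' pw po sin qi qo) :
    (∑ i, ∑ j, c i j *
      (extendConst D.ηw (upwindW (s i) (s j) (pw i) (pw j)) * (pw i - pw j) ^ 2
        + extendConst D.ηo (upwindO (s i) (s j) (po i) (po j)) * (po i - po j) ^ 2)) / 2 =
    ∑ i, a i * (s i - s' i) * extendConst D.pc (s i) +
      ∑ i, m i * (qi i * (pw i + extendConst D.fo (sin i) * extendConst D.pc (s i)) -
        qo i * (pw i + extendConst D.fo (s i) * extendConst D.pc (s i))) := by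
  have hf : ∀ x, extendConst D.fo x = 1 - extendConst D.fw x := fun x => rfl
  have e1 := sum_mul_sum_symm
    (k := fun i j => c i j * extendConst D.ηw (upwindW (s i) (s j) (pw i) (pw j)))
    (fun i j => by rw [h.c_symm, upwindW_symm]) pw
  have e2 := sum_mul_sum_symm
    (k := fun i j => c i j * extendConst D.ηo (upwindO (s i) (s j) (po i) (po j)))
    (fun i j => by rw [h.c_symm, upwindO_symm]) po
  have e3 : ∑ i, ∑ j, c i j *
      (extendConst D.ηw (upwindW (s i) (s j) (pw i) (pw j)) * (pw i - pw j) ^ 2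
        + extendConst D.ηo (upwindO (s i) (s j) (po i) (po j)) * (po i - po j) ^ 2) =
      ∑ i, ∑ j, c i j * extendConst D.ηw (upwindW (s i) (s j) (pw i) (pw j)) * (pw i - pw j) ^ 2
      + ∑ i, ∑ j, c i j * extendConst D.ηo (upwindO (s i) (s j) (po i) (po j)) *
        (po i - po j) ^ 2 := by
    simp_rw [← Finset.sum_add_distrib]
    exact Finset.sum_congr rfl fun i _ => Finset.sum_congr rfl fun j _ => by ring
  have e4 : ∀ i, (∑ j, c i j * extendConst D.ηw (upwindW (s i) (s j) (pw i) (pw j)) *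
      (pw j - pw i)) * pw i + (∑ j, c i j * extendConst D.ηo (upwindO (s i) (s j) (po i) (po j)) *
      (po j - po i)) * po i = -(a i * (s i - s' i) * extendConst D.pc (s i)) -
      m i * (qi i * (pw i + extendConst D.fo (sin i) * extendConst D.pc (s i)) -
        qo i * (pw i + extendConst D.fo (s i) * extendConst D.pc (s i))) := by
    intro i
    have hw := h.wetting i
    have ho := h.nonwetting i
    have hp : po i = pw i + extendConst D.pc (s i) := by linarith [h.capillary i]
    have hw' := congrArg (· * pw i) hw
    have ho' := congrArg (· * po i) ho
    rw [hf] at ho' ⊢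
    rw [hf] at ho' ⊢
    set X := ∑ j, c i j * extendConst D.ηw (upwindW (s i) (s j) (pw i) (pw j)) * (pw j - pw i)
    set Y := ∑ j, c i j * extendConst D.ηo (upwindO (s i) (s j) (po i) (po j)) * (po j - po i)
    rw [hp] at ho' ⊢
    -- The two accumulation terms leave only `p_c = p_o - p_w` as a factor, and `f_w + f_o = 1`
    -- collects the sources.
    linear_combination -hw' - ho'
  have e5 := Finset.sum_congr (rfl : (Finset.univ : Finset ι) = Finset.univ) fun i _ => e4 i
  rw [Finset.sum_add_distrib, e1, e2, Finset.sum_sub_distrib, Finset.sum_neg_distrib] at e5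
  rw [e3]
  linarith

/-- The energy estimate of one time step. -/
theorem energy_le (hD : D.Admissible) (h : StepSolution D a m c s s' pw po sin qi qo)
    (hs : ∀ i, s i ∈ Set.Icc (0 : ℝ) 1) {Cp B : ℝ} (hCp : 0 ≤ Cp)
    (hB : ∀ x ∈ Set.Icc (0 : ℝ) 1, |D.pc x| + |D.pwg x| ≤ B) (hm : 0 < ∑ i, m i)
    (hpoin : ∀ U : ι → ℝ, ∑ i, ∑ j, m i * m j * (U i - U j) ^ 2 ≤
      Cp * ((∑ i, ∑ j, c i j * (U i - U j) ^ 2) / 2)) :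
    (∑ i, ∑ j, c i j *
      (extendConst D.ηw (upwindW (s i) (s j) (pw i) (pw j)) * (pw i - pw j) ^ 2
        + extendConst D.ηo (upwindO (s i) (s j) (po i) (po j)) * (po i - po j) ^ 2)) / 4 ≤
    ∑ i, a i * (s i - s' i) * D.pc (s i) +
      ((Cp + 1) / (D.ηs * ∑ i, m i) / 2 + B / 2) *
        (∑ i, m i * qi i ^ 2 + ∑ i, m i * qo i ^ 2) + B * ∑ i, m i := by
  have heq := h.energy_eq
  set E := ∑ i, ∑ j, c i j *
      (extendConst D.ηw (upwindW (s i) (s j) (pw i) (pw j)) * (pw i - pw j) ^ 2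
        + extendConst D.ηo (upwindO (s i) (s j) (po i) (po j)) * (po i - po j) ^ 2) with hE
  set M := ∑ i, m i with hM
  set U : ι → ℝ := fun i => pw i + D.pwg (s i) with hU
  -- The Young parameter that makes the Poincaré term at most `M E / 4`, half of what the identity
  -- provides. The summand `1` keeps it positive when `Cp = 0`.
  set A := (Cp + 1) / (D.ηs * M) with hA
  have hηs := hD.ηs_pos
  have hApos : 0 < A := by positivity
  have hB0 : 0 ≤ B := (add_nonneg (abs_nonneg _) (abs_nonneg _)).trans (hB 0 (by simp))
  have hpc : ∀ i, extendConst D.pc (s i) = D.pc (s i) := fun i => extendConst_of_mem (hs i)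
  simp_rw [hpc] at heq
  -- the auxiliary pressure is controlled by the energy
  have hUE : D.ηs * ∑ i, ∑ j, c i j * (U i - U j) ^ 2 ≤ E := by
    rw [Finset.mul_sum]
    refine Finset.sum_le_sum fun i _ => ?_
    rw [Finset.mul_sum]
    refine Finset.sum_le_sum fun j _ => ?_
    have := hD.auxiliary_increment_le (hs i) (hs j) ((h.capillary i).trans (hpc i))
      ((h.capillary j).trans (hpc j))
    rw [extendConst_of_mem (upwindW_mem (hs i) (hs j) _ _),
      extendConst_of_mem (upwindO_mem (hs i) (hs j) _ _)]
    calc D.ηs * (c i j * (U i - U j) ^ 2) = c i j * (D.ηs * (U i - U j) ^ 2) := by ring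
      _ ≤ _ := mul_le_mul_of_nonneg_left this (h.c_nonneg i j)
  have hE0 : 0 ≤ E := by
    refine le_trans (mul_nonneg hηs.le ?_) hUE
    exact Finset.sum_nonneg fun i _ => Finset.sum_nonneg fun j _ =>
      mul_nonneg (h.c_nonneg i j) (sq_nonneg _)
  -- the source term
  have hpt : ∀ i, m i * (qi i * (pw i + extendConst D.fo (sin i) * D.pc (s i)) -
        qo i * (pw i + extendConst D.fo (s i) * D.pc (s i))) ≤
      m i * ((qi i - qo i) * U i) + (B / 2 * (m i * qi i ^ 2 + m i * qo i ^ 2) + B * m i) := by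
    intro i
    have hb := hB _ (hs i)
    have key : ∀ x, |extendConst D.fo x * D.pc (s i) - D.pwg (s i)| ≤ B := by
      intro x
      have f0 := hD.fo_nonneg (clamp_mem x)
      have f1 := hD.fo_le_one (clamp_mem x)
      refine (abs_sub _ _).trans (le_trans (add_le_add ?_ le_rfl) hb)
      rw [abs_mul, extendConst, abs_of_nonneg f0]
      exact mul_le_of_le_one_left (abs_nonneg _) f1
    have k1 := (abs_le.1 (key (sin i))).2
    have k2 := (abs_le.1 (key (s i))).1
    have q1 := mul_le_mul_of_nonneg_left k1 (h.qi_nonneg i)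
    have q2 := mul_le_mul_of_nonneg_left k2 (h.qo_nonneg i)
    have s1 := mul_nonneg hB0 (sq_nonneg (qi i - 1))
    have s2 := mul_nonneg hB0 (sq_nonneg (qo i - 1))
    have : qi i * (pw i + extendConst D.fo (sin i) * D.pc (s i)) -
        qo i * (pw i + extendConst D.fo (s i) * D.pc (s i)) ≤
        (qi i - qo i) * U i + (B / 2 * (qi i ^ 2 + qo i ^ 2) + B) := by
      simp only [hU]
      nlinarith
    refine (mul_le_mul_of_nonneg_left this (h.m_pos i).le).trans (le_of_eq ?_)
    ring
  have hsum := Finset.sum_le_sum fun i (_ : i ∈ Finset.univ) => hpt i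
  rw [Finset.sum_add_distrib, Finset.sum_add_distrib, ← Finset.mul_sum, ← Finset.mul_sum,
    Finset.sum_add_distrib, ← hM] at hsum
  have hbal : ∑ i, m i * (qi i - qo i) = 0 := by
    simp_rw [mul_sub]
    rw [Finset.sum_sub_distrib, h.balance, sub_self]
  have hy := sum_mul_le_of_sum_eq_zero (U := U) (fun i => (h.m_pos i).le) hbal hApos
  rw [← hM] at hy
  have hp2 : (∑ i, ∑ j, m i * m j * (U i - U j) ^ 2) / (2 * A) ≤ M * (E / 4) := by
    rw [div_le_iff₀ (by positivity)]
    set X := ∑ i, ∑ j, c i j * (U i - U j) ^ 2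
    have hX : X ≤ E / D.ηs := by rw [le_div_iff₀ hηs]; linarith
    have h3 : Cp * (X / 2) ≤ Cp * (E / D.ηs / 2) := by gcongr
    have h4 : Cp * (E / D.ηs / 2) ≤ (Cp + 1) * (E / D.ηs / 2) := by
      gcongr; linarith
    have h5 : M * (E / 4) * (2 * A) = (Cp + 1) * (E / D.ηs / 2) := by
      rw [hA]; field_simp; ring
    rw [h5]
    exact ((hpoin U).trans h3).trans h4
  have hr2 : ∑ i, m i * (qi i - qo i) ^ 2 ≤ ∑ i, m i * qi i ^ 2 + ∑ i, m i * qo i ^ 2 := by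
    rw [← Finset.sum_add_distrib]
    refine Finset.sum_le_sum fun i _ => ?_
    rw [← mul_add]
    refine mul_le_mul_of_nonneg_left ?_ (h.m_pos i).le
    nlinarith [mul_nonneg (h.qi_nonneg i) (h.qo_nonneg i)]
  have hsrc : ∑ i, m i * ((qi i - qo i) * U i) ≤
      A / 2 * (∑ i, m i * qi i ^ 2 + ∑ i, m i * qo i ^ 2) + E / 4 := by
    refine le_of_mul_le_mul_left ?_ hm
    calc M * ∑ i, m i * ((qi i - qo i) * U i)
        ≤ A / 2 * (M * ∑ i, m i * (qi i - qo i) ^ 2) + M * (E / 4) := hy.trans (by gcongr)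
      _ ≤ A / 2 * (M * (∑ i, m i * qi i ^ 2 + ∑ i, m i * qo i ^ 2)) + M * (E / 4) := by gcongr
      _ = _ := by ring
  linarith

end StepSolution

/-! ### The estimate for the discrete solution -/

namespace FlowData

variable {d : ℕ} {D : FlowData d}

/-- The constant value of the porosity on a cell inherits the almost everywhere bounds because the
cell has positive volume. -/
theorem integral_φ_cell {T : SimplicialMesh d} (hT : D.IsMesh T) (hφ : T.Resolves D.φ) {a b : ℝ}
    (hab : ∀ᵐ x ∂(volume.restrict D.Ω), a ≤ D.φ x ∧ D.φ x ≤ b) {K : Finset (Space d)}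
    (hK : K ∈ T.elems) : a * volume.real (cell K) ≤ ∫ x in cell K, D.φ x ∧
      ∫ x in cell K, D.φ x ≤ b * volume.real (cell K) := by
  obtain ⟨c, hc⟩ := hφ K hK
  have hle : volume.restrict (cell K) ≤ volume.restrict D.Ω := by
    rw [Measure.restrict_congr_set (T.ae_eq_closure hT.triangulates hT.regular)]
    exact Measure.restrict_mono (T.cell_subset_closure hT.triangulates hK) le_rfl
  have hab' : ∀ᵐ x ∂(volume.restrict (cell K)), a ≤ D.φ x ∧ D.φ x ≤ b := ae_mono hle hab
  have hne : volume.restrict (cell K) ≠ 0 := by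
    rw [Ne, Measure.restrict_eq_zero]; exact (T.volume_cell_pos hK).ne'
  have : NeZero (volume.restrict (cell K)) := ⟨hne⟩
  obtain ⟨x, hx1, hx2⟩ := (hc.and hab').exists
  rw [integral_congr_ae (g := fun _ => c) hc, setIntegral_const, smul_eq_mul, mul_comm (volume.real _)]
  rw [hx1] at hx2
  exact ⟨mul_le_mul_of_nonneg_right hx2.1 measureReal_nonneg,
    mul_le_mul_of_nonneg_right hx2.2 measureReal_nonneg⟩

theorem weightedMass_bounds {T : SimplicialMesh d} (hT : D.IsMesh T) (hφ : T.Resolves D.φ)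
    {a b : ℝ} (hab : ∀ᵐ x ∂(volume.restrict D.Ω), a ≤ D.φ x ∧ D.φ x ≤ b) (i : T.Node) :
    a * T.mass i ≤ T.weightedMass D.φ i ∧ T.weightedMass D.φ i ≤ b * T.mass i := by
  classical
  rw [SimplicialMesh.mass_eq, SimplicialMesh.weightedMass, Finset.mul_sum, Finset.mul_sum,
    Finset.sum_div]
  have h0 : (0 : ℝ) < d + 1 := by positivity
  constructor
  · refine Finset.sum_le_sum fun K hK => ?_
    rw [← mul_div_assoc, div_le_div_iff_of_pos_right h0]
    exact (integral_φ_cell hT hφ hab (Finset.mem_filter.1 hK).1).1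
  · refine Finset.sum_le_sum fun K hK => ?_
    rw [← mul_div_assoc, div_le_div_iff_of_pos_right h0]
    exact (integral_φ_cell hT hφ hab (Finset.mem_filter.1 hK).1).2

theorem weightedMass_pos (hD : D.Admissible) {T : SimplicialMesh d} (hT : D.IsMesh T)
    (hφ : T.Resolves D.φ) (i : T.Node) : 0 < T.weightedMass D.φ i := by
  obtain ⟨a, b, ha, hab⟩ := hD.φ_bounds
  exact (mul_pos ha (T.mass_pos i)).trans_le (weightedMass_bounds hT hφ hab i).1

namespace Admissible

variable (hD : D.Admissible)
include hD

theorem isFiniteMeasure_cylinder : IsFiniteMeasure D.cylinder := by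
  have hfin : IsFiniteMeasure (volume.restrict D.Ω) :=
    ⟨by rw [Measure.restrict_apply_univ]; exact hD.bounded.measure_lt_top⟩
  rw [cylinder_eq]
  infer_instance

theorem integrable_of_memLp {q : Space d → ℝ → ℝ}
    (hq : MemLp (fun p : Space d × ℝ => q p.1 p.2) 2 D.cylinder) :
    Integrable (fun p : Space d × ℝ => q p.1 p.2) D.cylinder :=
  have := hD.isFiniteMeasure_cylinder
  hq.integrable (by norm_num)

theorem sum_mass_mul_rateDisc_eq {T : SimplicialMesh d} (hT : D.IsMesh T) {N n : ℕ} (hN : 1 ≤ N)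
    (hn : n ∈ Set.Icc 1 N) :
    ∑ i, T.mass i * D.rateDisc T N D.qin n i = ∑ i, T.mass i * D.rateDisc T N D.qout n i := by
  have hfin : IsFiniteMeasure (volume.restrict D.Ω) :=
    ⟨by rw [Measure.restrict_apply_univ]; exact hD.bounded.measure_lt_top⟩
  have h1 := (hD.integrable_of_memLp hD.qin_memLp).mono_measure (prod_slab_le hD hN hn)
  have h2 := (hD.integrable_of_memLp hD.qout_memLp).mono_measure (prod_slab_le hD hN hn)
  rw [sum_mass_mul_rateDisc hD hT hN h1, sum_mass_mul_rateDisc hD hT hN h2,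
    integral_prod_symm _ h1, integral_prod_symm _ h2]
  congr 1
  exact integral_congr_ae (ae_mono (slab_le hD hN hn) hD.q_balance)

end Admissible

theorem IsDiscreteSolution.stepSolution (hD : D.Admissible) {T : SimplicialMesh d}
    (hT : D.IsMesh T) (hφ : T.Resolves D.φ) {N : ℕ} (hN : 1 ≤ N) {S Pw Po : ℕ → T.Node → ℝ}
    (h : D.IsDiscreteSolution T N S Pw Po) {n : ℕ} (hn : n ∈ Set.Icc 1 N) :
    StepSolution D (fun i => T.weightedMass D.φ i / D.step N) T.mass T.stiff (S n) (S (n - 1))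
      (Pw n) (Po n) (D.sinDisc T N n) (D.rateDisc T N D.qin n) (D.rateDisc T N D.qout n) where
  a_pos i := div_pos (weightedMass_pos hD hT hφ i) (hD.step_pos hN)
  m_pos := T.mass_pos
  c_symm := T.stiff_symm
  c_nonneg := T.stiff_nonneg
  qi_nonneg := rateDisc_nonneg hD hT hN hn (hD.integrable_of_memLp hD.qin_memLp) hD.qin_nonneg
  qo_nonneg := rateDisc_nonneg hD hT hN hn (hD.integrable_of_memLp hD.qout_memLp) hD.qout_nonneg
  balance := hD.sum_mass_mul_rateDisc_eq hT hN hn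
  wetting := by
    obtain ⟨last, hw⟩ := h.wetting
    exact wetting_of_ne D T.stiff_symm (hD.sum_mass_mul_rateDisc_eq hT hN hn) last (hw n hn)
      (h.nonwetting n hn)
  nonwetting := h.nonwetting n hn
  capillary := h.capillary n hn

/-- The maximum principle. -/
theorem IsDiscreteSolution.mem_Icc (hD : D.Admissible) {T : SimplicialMesh d}
    (hT : D.IsMesh T) (hφ : T.Resolves D.φ) {N : ℕ} (hN : 1 ≤ N) {S Pw Po : ℕ → T.Node → ℝ}
    (h : D.IsDiscreteSolution T N S Pw Po) (n : ℕ) (hn : n ≤ N) (i : T.Node) :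
    S n i ∈ Set.Icc (0 : ℝ) 1 := by
  induction n generalizing i with
  | zero =>
    rw [h.initial]
    exact nodalMean_mem_Icc hT hD.s0_meas hD.s0_bounds i
  | succ k ih =>
    have hs := h.stepSolution hD hT hφ hN (n := k + 1) ⟨by omega, hn⟩
    rw [Nat.add_sub_cancel] at hs
    exact ⟨hs.nonneg hD (fun j => (ih (by omega) j).1) i,
      hs.le_one hD (fun j => (ih (by omega) j).2) i⟩

/-- Summation of the one-step estimates over time. The three terms of the constant come from the
telescoped accumulation, the squared rates, and the bounded remainder of the source. -/
theorem pressureEnergy_le (hD : D.Admissible) {T : SimplicialMesh d} (hT : D.IsMesh T)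
    (hobt : T.Nonobtuse) (hφ : T.Resolves D.φ) {a b : ℝ}
    (hab : ∀ᵐ x ∂(volume.restrict D.Ω), a ≤ D.φ x ∧ D.φ x ≤ b) {N : ℕ} (hN : 1 ≤ N)
    {S Pw Po : ℕ → T.Node → ℝ} (h : D.IsDiscreteSolution T N S Pw Po) {Cp B : ℝ} (hCp : 0 ≤ Cp)
    (hB : ∀ x ∈ Set.Icc (0 : ℝ) 1, |D.pc x| + |D.pwg x| ≤ B)
    (hpoin : ∀ U : T.Node → ℝ, ∑ i, ∑ j, T.mass i * T.mass j * (U i - U j) ^ 2 ≤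
      Cp * ∑ K ∈ T.elems, volume.real (cell K) * ‖T.elemGrad U K‖ ^ 2) :
    D.pressureEnergy T N S Pw Po ≤ 4 * (b * volume.real D.Ω * B +
      ((Cp + 1) / (D.ηs * volume.real D.Ω) / 2 + B / 2) *
        (∫ p, D.qin p.1 p.2 ^ 2 ∂D.cylinder + ∫ p, D.qout p.1 p.2 ^ 2 ∂D.cylinder)
      + B * volume.real D.Ω * D.tf) := by
  have hτ := hD.step_pos hN
  have hΩ := hD.volume_real_Ω_pos
  have hηs := hD.ηs_pos
  have hM : ∑ i, T.mass i = volume.real D.Ω := T.sum_mass hT.triangulates hT.regular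
  have hB0 : 0 ≤ B := (add_nonneg (abs_nonneg _) (abs_nonneg _)).trans (hB 0 (by simp))
  have hmem := h.mem_Icc hD hT hφ hN
  set τ := D.step N with hτdef
  set κ := (Cp + 1) / (D.ηs * volume.real D.Ω) / 2 + B / 2 with hκ
  have hκ0 : 0 ≤ κ := by positivity
  set E : ℕ → ℝ := fun n => ∑ i, ∑ j, T.stiff i j *
    (extendConst D.ηw (upwindW (S n i) (S n j) (Pw n i) (Pw n j)) * (Pw n i - Pw n j) ^ 2
      + extendConst D.ηo (upwindO (S n i) (S n j) (Po n i) (Po n j)) * (Po n i - Po n j) ^ 2)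
    with hE
  have hstep : ∀ n ∈ Finset.Icc 1 N, τ * E n ≤ 4 * (
      (∑ i, T.weightedMass D.φ i * ∫ x in S (n - 1) i..S n i, D.pc x) +
      κ * (∫ p, D.qin p.1 p.2 ^ 2 ∂((volume.restrict D.Ω).prod (D.slab N n)) +
        ∫ p, D.qout p.1 p.2 ^ 2 ∂((volume.restrict D.Ω).prod (D.slab N n)))
      + B * volume.real D.Ω * τ) := by
    intro n hn
    have hn' : n ∈ Set.Icc 1 N := Finset.mem_Icc.1 hn
    have hle := prod_slab_le hD hN hn'
    have hst := (h.stepSolution hD hT hφ hN hn').energy_le hD (hmem n hn'.2) hCp hB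
      (by rw [hM]; exact hΩ) (fun U => by rw [← T.dirichlet_eq hobt]; exact hpoin U)
    rw [hM, ← hκ] at hst
    have hq1 := step_mul_sum_mass_mul_rateDisc_sq_le hD hT hN (n := n)
      ((hD.integrable_of_memLp hD.qin_memLp).mono_measure hle)
      (hD.qin_memLp.integrable_sq.mono_measure hle)
    have hq2 := step_mul_sum_mass_mul_rateDisc_sq_le hD hT hN (n := n)
      ((hD.integrable_of_memLp hD.qout_memLp).mono_measure hle)
      (hD.qout_memLp.integrable_sq.mono_measure hle)
    -- Concavity of the primitive of `pc`, in the direction favourable to the implicit scheme.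
    have hacc : τ * ∑ i, T.weightedMass D.φ i / τ * (S n i - S (n - 1) i) * D.pc (S n i) ≤
        ∑ i, T.weightedMass D.φ i * ∫ x in S (n - 1) i..S n i, D.pc x := by
      rw [Finset.mul_sum]
      refine Finset.sum_le_sum fun i _ => ?_
      have := sub_mul_le_integral_of_antitoneOn hD.pc_cont hD.pc_anti.antitoneOn
        (hmem (n - 1) ((Nat.sub_le _ _).trans hn'.2) i) (hmem n hn'.2 i)
      calc τ * (T.weightedMass D.φ i / τ * (S n i - S (n - 1) i) * D.pc (S n i))
          = T.weightedMass D.φ i * ((S n i - S (n - 1) i) * D.pc (S n i)) := by field_simp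
        _ ≤ _ := mul_le_mul_of_nonneg_left this (weightedMass_pos hD hT hφ i).le
    have hst' := mul_le_mul_of_nonneg_left hst hτ.le
    have hq := mul_le_mul_of_nonneg_left (add_le_add hq1 hq2) hκ0
    change τ * (E n / 4) ≤ _ at hst'
    rw [mul_add, mul_add] at hst'
    rw [← mul_add] at hq
    linarith
  have hsum := Finset.sum_le_sum hstep
  rw [← Finset.mul_sum, ← Finset.mul_sum, Finset.sum_add_distrib, Finset.sum_add_distrib,
    ← Finset.mul_sum, Finset.sum_add_distrib, sum_integral_slab hD hN hD.qin_memLp.integrable_sq,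
    sum_integral_slab hD hN hD.qout_memLp.integrable_sq] at hsum
  have htel : ∑ n ∈ Finset.Icc 1 N, ∑ i, T.weightedMass D.φ i * ∫ x in S (n - 1) i..S n i, D.pc x
      ≤ b * volume.real D.Ω * B := by
    rw [Finset.sum_comm, ← hM, Finset.mul_sum, Finset.sum_mul]
    refine Finset.sum_le_sum fun i _ => ?_
    rw [← Finset.mul_sum]
    have ii : ∀ k l, k ≤ N → l ≤ N → IntervalIntegrable D.pc volume (S k i) (S l i) :=
      fun k l hk hl => (hD.pc_cont.mono
        (Set.uIcc_subset_Icc (hmem k hk i) (hmem l hl i))).intervalIntegrable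
    have e : ∑ n ∈ Finset.Icc 1 N, ∫ x in S (n - 1) i..S n i, D.pc x =
        ∫ x in S 0 i..S N i, D.pc x := by
      rw [← intervalIntegral.sum_integral_adjacent_intervals (a := fun k => S k i) (n := N)
        fun k hk => ii k (k + 1) hk.le hk, ← Finset.Ico_add_one_right_eq_Icc,
        Finset.sum_Ico_eq_sum_range]
      refine Finset.sum_congr (by simp) fun k _ => ?_
      rw [Nat.add_sub_cancel_left, add_comm]
    rw [e]
    have hle : |∫ x in S 0 i..S N i, D.pc x| ≤ B := by
      have hb := intervalIntegral.norm_integral_le_of_norm_le_const (f := D.pc) (C := B)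
        (a := S 0 i) (b := S N i) fun x hx => by
          have hx' := Set.uIcc_subset_Icc (hmem 0 (Nat.zero_le _) i) (hmem N le_rfl i)
            (Set.uIoc_subset_uIcc hx)
          rw [Real.norm_eq_abs]
          linarith [hB x hx', abs_nonneg (D.pwg x)]
      refine hb.trans (mul_le_of_le_one_right hB0 ?_)
      have h0 := hmem 0 (Nat.zero_le _) i
      have h1 := hmem N le_rfl i
      rw [abs_le]
      constructor <;> linarith [h0.1, h0.2, h1.1, h1.2]
    calc T.weightedMass D.φ i * ∫ x in S 0 i..S N i, D.pc x
        ≤ T.weightedMass D.φ i * B := mul_le_mul_of_nonneg_left ((le_abs_self _).trans hle)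
          (weightedMass_pos hD hT hφ i).le
      _ ≤ b * T.mass i * B :=
        mul_le_mul_of_nonneg_right (weightedMass_bounds hT hφ hab i).2 hB0
  have hT' : ∑ _n ∈ Finset.Icc 1 N, B * volume.real D.Ω * τ = B * volume.real D.Ω * D.tf := by
    rw [Finset.sum_const, Nat.card_Icc, Nat.add_sub_cancel, nsmul_eq_mul, ← step_mul hN]
    ring
  rw [hT'] at hsum
  have hgoal : D.pressureEnergy T N S Pw Po = τ * ∑ n ∈ Finset.Icc 1 N, E n := rfl
  rw [hgoal]
  linarith

/-- The gradient norm of a function that is piecewise constant in time and piecewise affine in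
space. -/
theorem gradNorm_spaceTime_sq_le (hD : D.Admissible) {T : SimplicialMesh d} (hT : D.IsMesh T)
    {N : ℕ} (hN : 1 ≤ N) (V : ℕ → T.Node → ℝ) :
    D.gradNorm (D.spaceTime T N V) ^ 2 ≤ ENNReal.ofReal (D.step N * ∑ n ∈ Finset.Icc 1 N,
      ∑ K ∈ T.elems, volume.real (cell K) * ‖T.elemGrad (V n) K‖ ^ 2) := by
  have hτ := hD.step_pos hN
  set τ := D.step N with hτdef
  set F : Space d × ℝ → Space d := fun p => gradient (fun x => D.spaceTime T N V x p.2) p.1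
  have e0 : D.gradNorm (D.spaceTime T N V) ^ 2 = ∫⁻ p, ‖F p‖ₑ ^ 2 ∂D.cylinder := by
    have := eLpNorm_nnreal_pow_eq_lintegral (f := F) (μ := D.cylinder) (p := 2) (by norm_num)
    simpa [gradNorm] using this
  -- The cylinder is covered, up to a null set, by boxes on which the gradient is constant.
  -- Countable subadditivity suffices, so no disjointness is needed.
  let ι := {n // n ∈ Finset.Icc 1 N} × {K // K ∈ T.elems}
  let P : ι → Set (Space d × ℝ) := fun k =>
    interior (cell (k.2 : Finset (Space d))) ×ˢ
      Set.Ioc ((((k.1 : ℕ) : ℝ) - 1) * τ) (((k.1 : ℕ) : ℝ) * τ)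
  have hPm : ∀ k, MeasurableSet (P k) := fun k =>
    isOpen_interior.measurableSet.prod measurableSet_Ioc
  have hPF : ∀ k, ∀ p ∈ P k, F p = T.elemGrad (V k.1) k.2 := by
    rintro ⟨⟨n, hn⟩, ⟨K, hK⟩⟩ ⟨x, t⟩ ⟨hx, ht⟩
    have hn1 := (Finset.mem_Icc.1 hn).1
    have hceil : ⌈t / τ⌉₊ = n := by
      rw [Nat.ceil_eq_iff (by omega), Nat.cast_sub hn1, Nat.cast_one, lt_div_iff₀ hτ,
        div_le_iff₀ hτ]
      exact ht
    simp only [F, spaceTime]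
    rw [← hτdef, hceil]
    exact T.gradient_lagrange _ hK hx
  have hcov : D.Ω ×ˢ Set.Ioo 0 D.tf ≤ᵐ[volume] ⋃ k, P k := by
    rw [ae_le_set]
    refine measure_mono_null
      (t := (⋃ K ∈ T.elems, frontier (cell K)) ×ˢ (Set.univ : Set ℝ)) ?_ ?_
    · rintro ⟨x, t⟩ ⟨⟨hx, ht⟩, hnot⟩
      refine ⟨?_, Set.mem_univ _⟩
      have hx' := subset_closure hx
      rw [← show _ = _ from hT.triangulates] at hx'
      obtain ⟨K, hK, hxK⟩ := Set.mem_iUnion₂.1 hx'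
      refine Set.mem_iUnion₂.2 ⟨K, hK, ?_⟩
      rw [(isCompact_cell K).isClosed.frontier_eq]
      refine ⟨hxK, fun hint => hnot ?_⟩
      have hpos : 0 < t / τ := div_pos ht.1 hτ
      have hn1 : 1 ≤ ⌈t / τ⌉₊ := Nat.one_le_iff_ne_zero.2 (Nat.ceil_pos.2 hpos).ne'
      have hnN : ⌈t / τ⌉₊ ≤ N := by
        rw [Nat.ceil_le, div_le_iff₀ hτ, step_mul hN]
        exact ht.2.le
      refine Set.mem_iUnion.2 ⟨(⟨_, Finset.mem_Icc.2 ⟨hn1, hnN⟩⟩, ⟨K, hK⟩), hint, ?_, ?_⟩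
      · have := Nat.ceil_lt_add_one hpos.le
        rw [← lt_div_iff₀ hτ]
        simp only
        linarith
      · rw [← div_le_iff₀ hτ]
        exact Nat.le_ceil _
    · have hnull : volume (⋃ K ∈ T.elems, frontier (cell K)) = 0 :=
        (measure_biUnion_null_iff T.elems.countable_toSet).2 fun K _ =>
          SimplicialMesh.volume_frontier_cell K
      rw [Measure.volume_eq_prod, Measure.prod_prod, hnull, zero_mul]
  have hP : ∀ k, ∫⁻ p in P k, ‖F p‖ₑ ^ 2 =
      ENNReal.ofReal (τ * (volume.real (cell (k.2 : Finset (Space d))) *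
        ‖T.elemGrad (V k.1) k.2‖ ^ 2)) := by
    intro k
    rw [setLIntegral_congr_fun (hPm k) fun p hp => by rw [hPF k p hp], setLIntegral_const,
      Measure.volume_eq_prod, Measure.prod_prod, Real.volume_Ioc,
      measure_congr (SimplicialMesh.interior_cell_ae_eq _), ENNReal.ofReal_mul hτ.le,
      ENNReal.ofReal_mul measureReal_nonneg, ENNReal.ofReal_pow (norm_nonneg _), ofReal_norm,
      Measure.real, ENNReal.ofReal_toReal (volume_cell_ne_top _)]
    have : ((k.1 : ℕ) : ℝ) * τ - (((k.1 : ℕ) : ℝ) - 1) * τ = τ := by ring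
    rw [this]
    ring
  calc D.gradNorm (D.spaceTime T N V) ^ 2 = ∫⁻ p in D.Ω ×ˢ Set.Ioo 0 D.tf, ‖F p‖ₑ ^ 2 := e0
    _ ≤ ∫⁻ p in ⋃ k, P k, ‖F p‖ₑ ^ 2 := lintegral_mono_set' hcov
    _ ≤ ∑' k, ∫⁻ p in P k, ‖F p‖ₑ ^ 2 := lintegral_iUnion_le _ _
    _ = ENNReal.ofReal (τ * ∑ n ∈ Finset.Icc 1 N,
          ∑ K ∈ T.elems, volume.real (cell K) * ‖T.elemGrad (V n) K‖ ^ 2) := by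
      simp_rw [hP]
      have h0 : ∀ k : ι, 0 ≤ τ * (volume.real (cell (k.2 : Finset (Space d))) *
        ‖T.elemGrad (V k.1) k.2‖ ^ 2) := fun k => by positivity
      rw [tsum_fintype, ← ENNReal.ofReal_sum_of_nonneg fun k _ => h0 k, ← Finset.mul_sum,
        Fintype.sum_prod_type,
        ← Finset.sum_coe_sort (Finset.Icc 1 N) fun n => ∑ K ∈ T.elems,
          volume.real (cell K) * ‖T.elemGrad (V n) K‖ ^ 2]
      congr 2
      refine Finset.sum_congr rfl fun n _ => ?_
      exact Finset.sum_coe_sort T.elems fun K => volume.real (cell K) * ‖T.elemGrad (V n) K‖ ^ 2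

/-- Functions with the increments of the auxiliary pressures are controlled by the energy. -/
theorem ofReal_mul_gradNorm_sq_le (hD : D.Admissible) {T : SimplicialMesh d} (hT : D.IsMesh T)
    (hobt : T.Nonobtuse) (hφ : T.Resolves D.φ) {N : ℕ} (hN : 1 ≤ N)
    {S Pw Po : ℕ → T.Node → ℝ} (h : D.IsDiscreteSolution T N S Pw Po) {V : ℕ → T.Node → ℝ}
    (hV : ∀ n ∈ Set.Icc 1 N, ∀ i j,
      V n i - V n j = (Pw n i + D.pwg (S n i)) - (Pw n j + D.pwg (S n j))) {C : ℝ}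
    (hC : D.pressureEnergy T N S Pw Po ≤ C) :
    ENNReal.ofReal D.ηs * D.gradNorm (D.spaceTime T N V) ^ 2 ≤ ENNReal.ofReal C := by
  have hτ := hD.step_pos hN
  have hηs := hD.ηs_pos
  have hmem := h.mem_Icc hD hT hφ hN
  refine (mul_le_mul_right (gradNorm_spaceTime_sq_le hD hT hN V) _).trans ?_
  rw [← ENNReal.ofReal_mul hηs.le]
  refine ENNReal.ofReal_le_ofReal (le_trans ?_ hC)
  rw [pressureEnergy, mul_left_comm]
  refine mul_le_mul_of_nonneg_left ?_ hτ.le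
  rw [Finset.mul_sum]
  refine Finset.sum_le_sum fun n hn => ?_
  have hn' : n ∈ Set.Icc 1 N := Finset.mem_Icc.1 hn
  have hcap : ∀ i, Po n i - Pw n i = D.pc (S n i) := fun i => by
    rw [h.capillary n hn', extendConst_of_mem (hmem n hn'.2 i)]
  rw [T.dirichlet_eq hobt]
  have hle : D.ηs * ∑ i, ∑ j, T.stiff i j * (V n i - V n j) ^ 2 ≤ ∑ i, ∑ j, T.stiff i j *
      (extendConst D.ηw (upwindW (S n i) (S n j) (Pw n i) (Pw n j)) * (Pw n i - Pw n j) ^ 2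
        + extendConst D.ηo (upwindO (S n i) (S n j) (Po n i) (Po n j)) *
          (Po n i - Po n j) ^ 2) := by
    rw [Finset.mul_sum]
    refine Finset.sum_le_sum fun i _ => ?_
    rw [Finset.mul_sum]
    refine Finset.sum_le_sum fun j _ => ?_
    have hi := hmem n hn'.2 i
    have hj := hmem n hn'.2 j
    have := hD.auxiliary_increment_le hi hj (hcap i) (hcap j)
    rw [extendConst_of_mem (upwindW_mem hi hj _ _), extendConst_of_mem (upwindO_mem hi hj _ _),
      hV n hn', mul_left_comm]
    exact mul_le_mul_of_nonneg_left this (T.stiff_nonneg i j)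
  -- The Dirichlet energy is half the edge sum; nonnegativity allows the factor `1/2` to be dropped.
  have h0 : 0 ≤ D.ηs * ∑ i, ∑ j, T.stiff i j * (V n i - V n j) ^ 2 :=
    mul_nonneg hηs.le (Finset.sum_nonneg fun i _ => Finset.sum_nonneg fun j _ =>
      mul_nonneg (T.stiff_nonneg i j) (sq_nonneg _))
  linarith

theorem Admissible.exists_pc_bound (hD : D.Admissible) :
    ∃ B, ∀ x ∈ Set.Icc (0 : ℝ) 1, |D.pc x| + |D.pwg x| ≤ B := by
  obtain ⟨B, hB⟩ := isCompact_Icc.exists_bound_of_continuousOn hD.pc_cont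
  exact ⟨B + (D.pc 0 - D.pc 1), fun x hx => add_le_add (hB x hx) (hD.abs_pwg_le hx)⟩

end FlowData

end

theorem mainTheorem6 (d : ℕ) (hd : d = 2 ∨ d = 3) (D : FlowData d) (hD : D.Admissible) (σ : ℝ) :
    ∃ C : ℝ, ∀ T : SimplicialMesh d,
      T.Triangulates D.Ω → T.Nonobtuse → T.ShapeRegular σ → T.Resolves D.φ →
      ∀ N : ℕ, 1 ≤ N → ∀ S Pw Po : ℕ → T.Node → ℝ, D.IsDiscreteSolution T N S Pw Po →
        D.pressureEnergy T N S Pw Po ≤ C ∧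
        ENNReal.ofReal D.ηs * D.gradNorm (D.Uw T N S Pw) ^ 2 ≤ ENNReal.ofReal C ∧
        ENNReal.ofReal D.ηs * D.gradNorm (D.Uo T N S Po) ^ 2 ≤ ENNReal.ofReal C := by
  obtain ⟨a, b, -, hab⟩ := hD.φ_bounds
  obtain ⟨B, hB⟩ := hD.exists_pc_bound
  obtain ⟨Cp, hCp, hpoin⟩ :=
    SimplicialMesh.exists_discrete_poincare hD.connected.isPreconnected hD.regular
  refine ⟨4 * (b * volume.real D.Ω * B +
      ((Cp + 1) / (D.ηs * volume.real D.Ω) / 2 + B / 2) *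
        (∫ p, D.qin p.1 p.2 ^ 2 ∂D.cylinder + ∫ p, D.qout p.1 p.2 ^ 2 ∂D.cylinder)
      + B * volume.real D.Ω * D.tf), fun T htri hobt _ hφ N hN S Pw Po h => ?_⟩
  have hT : D.IsMesh T := ⟨htri, hD.regular⟩
  have hE := FlowData.pressureEnergy_le hD hT hobt hφ hab hN h hCp hB (hpoin T htri)
  refine ⟨hE, FlowData.ofReal_mul_gradNorm_sq_le hD hT hobt hφ hN h (fun n _ i j => rfl) hE,
    FlowData.ofReal_mul_gradNorm_sq_le hD hT hobt hφ hN h (fun n hn i j => ?_) hE⟩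
  -- Since `p_{wg} + p_{og} = p_c - p_c(0)`, the nodal values of the two auxiliary pressures differ
  -- by the constant `p_c(0)`, so their increments agree.
  have hmem := h.mem_Icc hD hT hφ hN n hn.2
  have hcap : ∀ i, Po n i - Pw n i = D.pc (S n i) := fun i => by
    rw [h.capillary n hn, extendConst_of_mem (hmem i)]
  linarith [hcap i, hcap j, hD.pwg_add_pog (hmem i), hD.pwg_add_pog (hmem j)]
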